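/- **Proposition 3.** Setting. Let $N,n\in\mathbb N$ with $n\ge 1$. Let $\mathcal F=\bigoplus_{m\ge 0}\bigotimes^m_{(s)}L^2(\mathbb R^3)$ be the boson Fock space (the $m$-boson component $\psi^{(m)}(k_1,\dots,k_m)$ of $\psi\in\mathcal F$ is a permutation-symmetric $L^2$ function on $(\mathbb R^3)^m$), with vacuum $\Omega_0=(1,0,0,\dots)$ and inner product antilinear in the first argument. Let $H_{\rm f}=\mathrm d\Gamma(|k|)$, that is $(H_{\rm f}\psi)^{(m)}(k_1,\dots,k_m)=\sum_{j=1}^m|k_j|\,\psi^{(m)}(k_1,\dots,k_m)$ on its maximal domain $\mathcal D=D(H_{\rm f})$, which is equipped with the graph norm $\|\psi\|+\|H_{\rm f}\psi\|$. For $f\in L^2(\mathbb R^3)$ let $a(f)$ be the annihilation operator on $\{\psi:\sum_m m\|\psi^{(m)}\|^2<\infty\}$, $$(a(f)\psi)^{(m)}(k_1,\dots,k_m)=\sqrt{m+1}\int_{\mathbb R^3}\overline{f(k)}\,\psi^{(m+1)}(k,k_1,\dots,k_m)\,dk ,$$ let $a^*(f)$ be its adjoint, and let $\Phi(f)$ be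 the closure of $\frac1{\sqrt2}(a(f)+a^*(f))$ from this domain, which is a self-adjoint operator. For a Banach space $Y$ let $C^n_{\rm b}(\mathbb R^{3N},Y)$ be the set of the $n$ times continuously (norm-)differentiable functions $\mathbb R^{3N}\to Y$ whose partial derivatives up to order $n$ are all bounded. Hypotheses. Let $v:\mathbb R^{3N}\times\mathbb R^3\to\mathbb C$ be such that $v(x,\cdot)$ and $|\cdot|\,v(x,\cdot)$ are in $L^2(\mathbb R^3)$ for all $x$, and assume 1. (i) $x\mapsto v(x,\cdot)$ and $x\mapsto|\cdot|\,v(x,\cdot)$ are $n$ times continuously differentiable as maps from $\mathbb R^{3N}$ into $L^2(\mathbb R^3)$; $\partial_x^\alpha v(x,\cdot)$ denotes the $L^2$-valued derivatives, so that $|\cdot|\,\partial_x^\alpha v(x,\cdot)\in L^2(\mathbb R^3)$ for all $x$ and $|\alpha|\le n$; 2. (ii) $\sup_x\|\sqrt{|\cdot|}\,\partial_x^\alpha v(x,\cdot)\|_{L^2}<\infty$ for $0\le|\alpha|\le n$; 3. (iii) $\sup_x\|\partial_x^\alpha v(x,\cdot)\|_{L^2}<\infty$ for $1\le|\alpha|\le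 n$; 4. (iv) $\mathrm{Im}\,\langle v(x,\cdot),\nabla_x v(x,\cdot)\rangle_{L^2}=0$ for all $x$, and $V_{\rm IR}\in C^n_{\rm b}(\mathbb R^{3N},\mathbb R)$. Put $H_0(x)=H_{\rm f}+\Phi(|\cdot|\,v(x,\cdot))+V_{\rm IR}(x)$ on $D(H_{\rm f})\cap D(\Phi(|\cdot|v(x,\cdot)))$. Then: 1. For every $x\in\mathbb R^{3N}$ the domain of $H_0(x)$ is $\mathcal D=D(H_{\rm f})$ and $H_0(x)$ is self-adjoint. The map $H_0(\cdot)$ is $n$ times continuously differentiable from $\mathbb R^{3N}$ into the bounded operators $\mathcal L(\mathcal D,\mathcal F)$, and $H_0(\cdot)\in C^n_{\rm b}(\mathbb R^{3N},\mathcal L(\mathcal D,\mathcal F))$ provided that also $\sup_x\|\,|\cdot|\,\partial_x^\alpha v(x,\cdot)\|_{L^2}<\infty$ for $0\le|\alpha|\le n$. 2. For every $x\in\mathbb R^{3N}$, $H_0(x)$ has a ground state (an eigenvector whose eigenvalue is the infimum of the spectrum), unique up to scalar multiples. It is given by $\Omega(x)=U(x)\Omega_0$ with the unitary operator (Weyl,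 or Bogoliubov, transformation) $U(x)=\exp\big(i\Phi(iv(x,\cdot))\big)$, and $H_0(x)\Omega(x)=E(x)\Omega(x)$ with $$E(x)=-\frac12\int_{\mathbb R^3}|k|\,|v(x,k)|^2\,dk+V_{\rm IR}(x).$$ Furthermore $\Omega(\cdot)\in C^n_{\rm b}(\mathbb R^{3N},\mathcal F)$. -/

import Mathlib

open MeasureTheory

namespace Nelson

noncomputable section

/-! ### Boson Fock space over `L²(ℝ³)` -/

/-- Momentum space `ℝ³` with the Euclidean norm and Lebesgue measure. -/
abbrev Momentum : Type := EuclideanSpace ℝ (Fin 3)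

/-- The one-boson space `L²(ℝ³)`. -/
abbrev OneBoson : Type := Lp ℂ 2 (volume : Measure Momentum)

/-- `L²((ℝ³)^m)`, without symmetry condition. -/
abbrev NBody (m : ℕ) : Type := Lp ℂ 2 (volume : Measure (Fin m → Momentum))

theorem measurePreserving_perm {m : ℕ} (σ : Equiv.Perm (Fin m)) :
    MeasurePreserving (fun K : Fin m → Momentum => fun i => K (σ i)) := by
  have h := volume_measurePreserving_piCongrLeft (fun _ : Fin m => Momentum) σ.symm
  have e : (fun K : Fin m → Momentum => fun i => K (σ i)) =
      ⇑(MeasurableEquiv.piCongrLeft (fun _ : Fin m => Momentum) σ.symm) := by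
    funext K i
    have := Equiv.piCongrLeft_apply_apply (P := fun _ : Fin m => Momentum) σ.symm K (σ i)
    simpa [MeasurableEquiv.coe_piCongrLeft] using this.symm
  rw [e]
  exact h

/-- The `m`-boson sector: the elements of `L²((ℝ³)^m)` that are invariant (almost everywhere)
under all permutations of the `m` momenta. -/
def Sector (m : ℕ) : Submodule ℂ (NBody m) :=
  ⨅ σ : Equiv.Perm (Fin m),
    LinearMap.eqLocus
      (Lp.compMeasurePreservingₗ ℂ (fun K : Fin m → Momentum => fun i => K (σ i))
        (measurePreserving_perm σ))
      LinearMap.id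

theorem mem_sector_iff {m : ℕ} {ψ : NBody m} :
    ψ ∈ Sector m ↔
      ∀ σ : Equiv.Perm (Fin m), (fun K => ψ (fun i => K (σ i))) =ᵐ[volume] ψ := by
  simp only [Sector, Submodule.mem_iInf, LinearMap.mem_eqLocus, LinearMap.id_apply]
  refine forall_congr' fun σ => ?_
  rw [Lp.ext_iff]
  have h := Lp.coeFn_compMeasurePreserving ψ (measurePreserving_perm σ)
  exact ⟨fun h' => h.symm.trans h', fun h' => h.trans h'⟩

theorem isClosed_sector (m : ℕ) : IsClosed (Sector m : Set (NBody m)) := by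
  simp only [Sector, Submodule.coe_iInf]
  refine isClosed_iInter fun σ => ?_
  exact isClosed_eq
    (Lp.isometry_compMeasurePreserving (measurePreserving_perm σ)).continuous continuous_id

instance (m : ℕ) : CompleteSpace (Sector m) :=
  (isClosed_sector m).completeSpace_coe

/-- The boson Fock space: the Hilbert sum of the symmetric sectors. -/
abbrev Fock : Type := lp (fun m : ℕ => Sector m) 2

/-- The wave function `ψ^(m)(k₁, …, k_m)` of the `m`-boson component of `ψ`. -/
def waveFun (ψ : Fock) (m : ℕ) : NBody m := (ψ m : NBody m)

theorem volume_fin_zero : (volume : Measure (Fin 0 → Momentum)) Set.univ = 1 := by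
  rw [← Set.pi_univ Set.univ, volume_pi_pi]
  simp

/-- The zero-boson wave function with the value `1`. -/
def vacuumWave : Sector 0 :=
  ⟨indicatorConstLp 2 MeasurableSet.univ (by rw [volume_fin_zero]; simp) (1 : ℂ), by
    rw [mem_sector_iff]
    intro σ
    refine Filter.Eventually.of_forall fun K => ?_
    exact congrArg _ (Subsingleton.elim _ _)⟩

/-- The Fock vacuum `Ω₀ = (1, 0, 0, …)`. -/
def vacuum : Fock := lp.single 2 0 vacuumWave

/-! ### The free field Hamiltonian -/

/-- The graph of `dΓ(|k|)` on its maximal domain: the pairs `(ψ, φ)` with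
`φ^(m)(k₁, …, k_m) = (|k₁| + ⋯ + |k_m|) ψ^(m)(k₁, …, k_m)` for all `m`. -/
def freeFieldGraph : Submodule ℂ (Fock × Fock) where
  carrier := {p | ∀ m : ℕ,
    waveFun p.2 m =ᵐ[volume] fun K => ((∑ j, ‖K j‖ : ℝ) : ℂ) * waveFun p.1 m K}
  zero_mem' := fun m => by
    have h0 : waveFun (0 : Fock) m = 0 := rfl
    filter_upwards [Lp.coeFn_zero ℂ 2 (volume : Measure (Fin m → Momentum))] with K hK
    simp only [Prod.fst_zero, Prod.snd_zero, h0, hK, Pi.zero_apply, mul_zero]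
  add_mem' := fun {p q} hp hq m => by
    have h2 := Lp.coeFn_add (waveFun p.2 m) (waveFun q.2 m)
    have h1 := Lp.coeFn_add (waveFun p.1 m) (waveFun q.1 m)
    filter_upwards [hp m, hq m, h1, h2] with K a b c d
    have e2 : waveFun (p + q).2 m = waveFun p.2 m + waveFun q.2 m := rfl
    have e1 : waveFun (p + q).1 m = waveFun p.1 m + waveFun q.1 m := rfl
    rw [e1, e2, c, d, Pi.add_apply, Pi.add_apply, a, b, mul_add]
  smul_mem' := fun z p hp m => by
    have h2 := Lp.coeFn_smul z (waveFun p.2 m)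
    have h1 := Lp.coeFn_smul z (waveFun p.1 m)
    filter_upwards [hp m, h1, h2] with K a c d
    have e2 : waveFun (z • p).2 m = z • waveFun p.2 m := rfl
    have e1 : waveFun (z • p).1 m = z • waveFun p.1 m := rfl
    rw [e1, e2, c, d, Pi.smul_apply, Pi.smul_apply, a, smul_eq_mul, smul_eq_mul]
    ring

/-- The free field Hamiltonian `H_f = dΓ(|k|)` on its maximal domain. -/
def freeField : Fock →ₗ.[ℂ] Fock := freeFieldGraph.toLinearPMap

theorem graph_freeField : freeField.graph = freeFieldGraph := by
  refine Submodule.toLinearPMap_graph_eq _ fun p hp h0 => ?_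
  refine lp.ext (funext fun m => Subtype.ext (Lp.ext ?_))
  have h0' : waveFun p.1 m = 0 := by rw [h0]; rfl
  filter_upwards [hp m, Lp.coeFn_zero ℂ 2 (volume : Measure (Fin m → Momentum))] with K a b
  have a' : (p.2 m : NBody m) K = ((∑ j, ‖K j‖ : ℝ) : ℂ) * waveFun p.1 m K := a
  have b' : (((0 : Fock) m : Sector m) : NBody m) K = 0 := b
  rw [a', b', h0', b, Pi.zero_apply, mul_zero]

/-! ### Annihilation, creation and field operators -/

theorem measurePreserving_snoc (m : ℕ) :
    MeasurePreserving
      (fun p : (Fin m → Momentum) × Momentum => (Fin.cons p.2 p.1 : Fin (m + 1) → Momentum))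
      (volume.prod volume) volume := by
  have h := (volume_preserving_piFinSuccAbove (fun _ : Fin (m + 1) => Momentum) 0).symm
  have h2 := h.comp (Measure.measurePreserving_swap
    (μ := (volume : Measure (Fin m → Momentum))) (ν := (volume : Measure Momentum)))
  have e : (fun p : (Fin m → Momentum) × Momentum =>
        (Fin.cons p.2 p.1 : Fin (m + 1) → Momentum)) =
      ⇑(MeasurableEquiv.piFinSuccAbove (fun _ : Fin (m + 1) => Momentum) 0).symm ∘ Prod.swap := by
    funext p
    have h0 : (MeasurableEquiv.piFinSuccAbove (fun _ : Fin (m + 1) => Momentum) 0).symm p.swap =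
        Fin.insertNth 0 p.2 p.1 := rfl
    rw [Function.comp_apply, h0, Fin.insertNth_zero']
  rw [e]
  exact h2

/-- `√(m+1) ∫ dk  conj f(k) ψ(k, k₁, …, k_m)`. -/
def annihilateFun (f : OneBoson) {m : ℕ} (ψ : NBody (m + 1)) (K : Fin m → Momentum) : ℂ :=
  (√(m + 1 : ℝ) : ℂ) * ∫ k, (starRingEnd ℂ) (f k) * ψ (Fin.cons k K)

theorem aemeasurable_slice_sq {m : ℕ} (ψ : NBody (m + 1)) :
    AEMeasurable (fun p : (Fin m → Momentum) × Momentum =>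
      ‖ψ (Fin.cons p.2 p.1)‖ₑ ^ (2 : ℝ)) (volume.prod volume) :=
  (((Lp.aestronglyMeasurable ψ).comp_measurePreserving
    (measurePreserving_snoc m)).enorm).pow_const 2

theorem lintegral_slice_sq {m : ℕ} (ψ : NBody (m + 1)) :
    ∫⁻ K : Fin m → Momentum, ∫⁻ k : Momentum, ‖ψ (Fin.cons k K)‖ₑ ^ (2 : ℝ) =
      eLpNorm ψ 2 volume ^ (2 : ℝ) := by
  have h1 : eLpNorm ψ 2 volume ^ (2 : ℝ) = ∫⁻ L : Fin (m + 1) → Momentum, ‖ψ L‖ₑ ^ (2 : ℝ) := by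
    have := eLpNorm_nnreal_pow_eq_lintegral (f := ψ) (p := 2)
      (μ := (volume : Measure (Fin (m + 1) → Momentum))) (by norm_num)
    simpa using this
  have h2 := (measurePreserving_snoc m).map_eq
  have h3 : AEMeasurable (fun L => ‖ψ L‖ₑ ^ (2 : ℝ))
      (Measure.map (fun p : (Fin m → Momentum) × Momentum =>
        (Fin.cons p.2 p.1 : Fin (m + 1) → Momentum)) (volume.prod volume)) := by
    rw [h2]
    exact ((Lp.aestronglyMeasurable ψ).enorm).pow_const 2
  have h4 := lintegral_map' h3 (measurePreserving_snoc m).measurable.aemeasurable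
  rw [h2, lintegral_prod _ (aemeasurable_slice_sq ψ)] at h4
  rw [h1, h4]

theorem memLp_slice {m : ℕ} (ψ : NBody (m + 1)) :
    ∀ᵐ K : Fin m → Momentum, MemLp (fun k : Momentum => ψ (Fin.cons k K)) 2 volume := by
  have hm : AEStronglyMeasurable (fun p : (Fin m → Momentum) × Momentum =>
      ψ (Fin.cons p.2 p.1)) (volume.prod volume) :=
    (Lp.aestronglyMeasurable ψ).comp_measurePreserving (measurePreserving_snoc m)
  have hfin : ∀ᵐ K : Fin m → Momentum,
      ∫⁻ k : Momentum, ‖ψ (Fin.cons k K)‖ₑ ^ (2 : ℝ) < ⊤ := by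
    refine ae_lt_top' (aemeasurable_slice_sq ψ).lintegral_prod_right' ?_
    rw [lintegral_slice_sq]
    exact (ENNReal.rpow_lt_top_of_nonneg (by norm_num) (Lp.memLp ψ).2.ne).ne
  filter_upwards [hfin, hm.prodMk_left] with K h1 h2
  refine ⟨h2, ?_⟩
  rw [eLpNorm_lt_top_iff_lintegral_rpow_enorm_lt_top (by norm_num) (by norm_num)]
  simpa using h1

theorem annihilateFun_bound (f : OneBoson) {m : ℕ} (ψ : NBody (m + 1)) :
    MemLp (annihilateFun f ψ) 2 volume ∧
      eLpNorm (annihilateFun f ψ) 2 volume ≤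
        ENNReal.ofReal (√(m + 1 : ℝ) * ‖f‖ * ‖ψ‖) := by
  have hm : AEStronglyMeasurable (annihilateFun f ψ) volume := by
    refine AEStronglyMeasurable.const_mul ?_ _
    refine AEStronglyMeasurable.integral_prod_right'
      (f := fun p : (Fin m → Momentum) × Momentum =>
        (starRingEnd ℂ) (f p.2) * ψ (Fin.cons p.2 p.1)) ?_
    refine AEStronglyMeasurable.mul ?_ ?_
    · exact (Complex.continuous_conj.comp_aestronglyMeasurable
        (Lp.aestronglyMeasurable f)).comp_snd
    · exact (Lp.aestronglyMeasurable ψ).comp_measurePreserving (measurePreserving_snoc m)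
  have hpt : ∀ᵐ K : Fin m → Momentum, ‖annihilateFun f ψ K‖ₑ ^ (2 : ℝ) ≤
      ENNReal.ofReal (m + 1 : ℝ) * eLpNorm f 2 volume ^ (2 : ℝ) *
        ∫⁻ k : Momentum, ‖ψ (Fin.cons k K)‖ₑ ^ (2 : ℝ) := by
    filter_upwards [memLp_slice ψ] with K hK
    have hf2 : (∫⁻ k : Momentum, ‖f k‖ₑ ^ (2 : ℝ)) ^ (1 / (2 : ℝ)) = eLpNorm f 2 volume := by
      rw [eLpNorm_eq_lintegral_rpow_enorm_toReal (by norm_num) (by norm_num)]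
      simp
    have h1 : ‖∫ k, (starRingEnd ℂ) (f k) * ψ (Fin.cons k K)‖ₑ ≤
        eLpNorm f 2 volume *
          (∫⁻ k : Momentum, ‖ψ (Fin.cons k K)‖ₑ ^ (2 : ℝ)) ^ (1 / (2 : ℝ)) := by
      refine (enorm_integral_le_lintegral_enorm _).trans ?_
      rw [← hf2]
      refine le_trans (le_of_eq ?_) (ENNReal.lintegral_mul_le_Lp_mul_Lq volume
        Real.HolderConjugate.two_two (Lp.aestronglyMeasurable f).enorm hK.1.enorm)
      refine lintegral_congr fun k => ?_
      simp [enorm_mul]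
    have h2 : ‖annihilateFun f ψ K‖ₑ ≤ ENNReal.ofReal √(m + 1 : ℝ) * (eLpNorm f 2 volume *
          (∫⁻ k : Momentum, ‖ψ (Fin.cons k K)‖ₑ ^ (2 : ℝ)) ^ (1 / (2 : ℝ))) := by
      rw [annihilateFun, enorm_mul]
      refine mul_le_mul' (le_of_eq ?_) h1
      rw [← ofReal_norm, Complex.norm_real, Real.norm_of_nonneg (Real.sqrt_nonneg _)]
    refine (ENNReal.rpow_le_rpow h2 (by norm_num)).trans (le_of_eq ?_)
    rw [ENNReal.mul_rpow_of_nonneg _ _ (by norm_num), ENNReal.mul_rpow_of_nonneg _ _ (by norm_num),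
      ← ENNReal.rpow_mul, ENNReal.ofReal_rpow_of_nonneg (Real.sqrt_nonneg _) (by norm_num)]
    have h3 : √(m + 1 : ℝ) ^ (2 : ℝ) = m + 1 := by
      rw [Real.rpow_two, Real.sq_sqrt (by positivity)]
    rw [h3]
    norm_num [mul_assoc]
  have hle : eLpNorm (annihilateFun f ψ) 2 volume ≤
      ENNReal.ofReal (√(m + 1 : ℝ) * ‖f‖ * ‖ψ‖) := by
    rw [← ENNReal.rpow_le_rpow_iff (z := 2) (by norm_num)]
    have h1 := eLpNorm_nnreal_pow_eq_lintegral (f := annihilateFun f ψ) (p := 2)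
      (μ := (volume : Measure (Fin m → Momentum))) (by norm_num)
    have h1' : eLpNorm (annihilateFun f ψ) 2 volume ^ (2 : ℝ) =
      ∫⁻ K, ‖annihilateFun f ψ K‖ₑ ^ (2 : ℝ) := by simpa using h1
    rw [h1']
    refine (lintegral_mono_ae hpt).trans (le_of_eq ?_)
    rw [lintegral_const_mul' _ _ (ENNReal.mul_ne_top ENNReal.ofReal_ne_top
      (ENNReal.rpow_lt_top_of_nonneg (by norm_num) (Lp.memLp f).2.ne).ne), lintegral_slice_sq,
      ← Lp.enorm_def, ← Lp.enorm_def, ← ofReal_norm, ← ofReal_norm,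
      ENNReal.ofReal_rpow_of_nonneg (norm_nonneg _) (by norm_num),
      ENNReal.ofReal_rpow_of_nonneg (norm_nonneg _) (by norm_num),
      ENNReal.ofReal_rpow_of_nonneg (by positivity) (by norm_num),
      ← ENNReal.ofReal_mul (by positivity), ← ENNReal.ofReal_mul (by positivity)]
    congr 1
    rw [Real.rpow_two, Real.rpow_two, Real.rpow_two, mul_pow, mul_pow, Real.sq_sqrt (by positivity)]
  exact ⟨⟨hm, hle.trans_lt ENNReal.ofReal_lt_top⟩, hle⟩

theorem annihilateFun_perm (f : OneBoson) {m : ℕ} {ψ : NBody (m + 1)} (hψ : ψ ∈ Sector (m + 1))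
    (σ : Equiv.Perm (Fin m)) :
    (fun K => annihilateFun f ψ (fun i => K (σ i))) =ᵐ[volume] annihilateFun f ψ := by
  let τ : Equiv.Perm (Fin (m + 1)) := Equiv.Perm.decomposeFin.symm (0, σ)
  have h1 := (measurePreserving_snoc m).quasiMeasurePreserving.ae_eq_comp
    (mem_sector_iff.1 hψ τ)
  filter_upwards [Measure.ae_ae_of_ae_prod h1] with K hK
  simp only [annihilateFun]
  congr 1
  refine integral_congr_ae ?_
  filter_upwards [hK] with k hk
  have hk' : ψ (fun i => (Fin.cons k K : Fin (m + 1) → Momentum) (τ i)) = ψ (Fin.cons k K) := hk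
  rw [← hk']
  congr 2
  funext i
  refine Fin.cases ?_ (fun j => ?_) i
  · simp [τ]
  · simp [τ]

theorem annihilateFun_add (f : OneBoson) {m : ℕ} (ψ φ : NBody (m + 1)) :
    annihilateFun f (ψ + φ) =ᵐ[volume] annihilateFun f ψ + annihilateFun f φ := by
  have h1 := (measurePreserving_snoc m).quasiMeasurePreserving.ae_eq_comp (Lp.coeFn_add ψ φ)
  filter_upwards [Measure.ae_ae_of_ae_prod h1, memLp_slice ψ, memLp_slice φ] with K hK h4 h5
  simp only [annihilateFun, Pi.add_apply, ← mul_add]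
  congr 1
  have hf : MemLp (fun k => (starRingEnd ℂ) (f k)) 2 volume := (Lp.memLp f).star
  have h6 := integral_add (G := ℂ) (hf.integrable_mul h4) (hf.integrable_mul h5)
  refine (integral_congr_ae ?_).trans h6
  filter_upwards [hK] with k hk
  have hk' : (ψ + φ) (Fin.cons k K) = ψ (Fin.cons k K) + φ (Fin.cons k K) := hk
  simp only [hk', mul_add, Pi.mul_apply]

theorem annihilateFun_smul (f : OneBoson) {m : ℕ} (z : ℂ) (ψ : NBody (m + 1)) :
    annihilateFun f (z • ψ) =ᵐ[volume] z • annihilateFun f ψ := by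
  have h1 := (measurePreserving_snoc m).quasiMeasurePreserving.ae_eq_comp (Lp.coeFn_smul z ψ)
  filter_upwards [Measure.ae_ae_of_ae_prod h1] with K hK
  simp only [annihilateFun, Pi.smul_apply, smul_eq_mul]
  have h2 : ∫ k, (starRingEnd ℂ) (f k) * (z • ψ) (Fin.cons k K) =
      ∫ k, z * ((starRingEnd ℂ) (f k) * ψ (Fin.cons k K)) := by
    refine integral_congr_ae ?_
    filter_upwards [hK] with k hk
    have hk' : (z • ψ) (Fin.cons k K) = z * ψ (Fin.cons k K) := hk
    rw [hk', mul_left_comm]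
  rw [h2, integral_const_mul, mul_left_comm]

/-- Annihilation of a boson in the state `f`, as a map from the `(m+1)`-boson sector to the
`m`-boson sector. -/
def annihilateSector (f : OneBoson) (m : ℕ) : Sector (m + 1) →ₗ[ℂ] Sector m where
  toFun ψ := ⟨MemLp.toLp (annihilateFun f ψ.1) (annihilateFun_bound f ψ.1).1, by
    rw [mem_sector_iff]
    intro σ
    have hT := MemLp.coeFn_toLp (annihilateFun_bound f ψ.1).1
    have hTσ := (measurePreserving_perm σ).quasiMeasurePreserving.ae_eq_comp hT
    exact (hTσ.trans (annihilateFun_perm f ψ.2 σ)).trans hT.symm⟩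
  map_add' ψ φ := by
    refine Subtype.ext ?_
    have h := MemLp.toLp_add (annihilateFun_bound f ψ.1).1 (annihilateFun_bound f φ.1).1
    refine Eq.trans (MemLp.toLp_congr (annihilateFun_bound f (ψ + φ).1).1
      ((annihilateFun_bound f ψ.1).1.add (annihilateFun_bound f φ.1).1)
      (annihilateFun_add f ψ.1 φ.1)) h
  map_smul' z ψ := by
    refine Subtype.ext ?_
    have h := MemLp.toLp_const_smul z (annihilateFun_bound f ψ.1).1
    refine Eq.trans (MemLp.toLp_congr (annihilateFun_bound f (z • ψ).1).1
      ((annihilateFun_bound f ψ.1).1.const_smul z)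
      (annihilateFun_smul f z ψ.1)) h

theorem norm_annihilateSector_le (f : OneBoson) (m : ℕ) (ψ : Sector (m + 1)) :
    ‖annihilateSector f m ψ‖ ≤ √(m + 1 : ℝ) * ‖f‖ * ‖ψ‖ := by
  have e : ‖annihilateSector f m ψ‖ =
      ENNReal.toReal (eLpNorm (annihilateFun f ψ.1) 2 volume) :=
    Lp.norm_toLp _ (annihilateFun_bound f ψ.1).1
  rw [e]
  exact ENNReal.toReal_le_of_le_ofReal (by positivity) (annihilateFun_bound f ψ.1).2

/-- `D(√𝒩)`, `𝒩` the number operator: the `ψ` with `∑ m ‖ψ^(m)‖² < ∞`. -/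
def sqrtNumberDomain : Submodule ℂ Fock where
  carrier := {ψ | Summable fun m : ℕ => (m : ℝ) * ‖ψ m‖ ^ 2}
  zero_mem' := by
    have : (fun m : ℕ => (m : ℝ) * ‖(0 : Fock) m‖ ^ 2) = fun _ => 0 := by
      funext m
      simp
    simp only [Set.mem_ofPred_eq, this]
    exact summable_zero
  add_mem' := fun {ψ φ} hψ hφ => by
    refine Summable.of_nonneg_of_le (fun m => by positivity) (fun m => ?_)
      ((Summable.mul_left 2 hψ).add (Summable.mul_left 2 hφ))
    have h1 : ‖(ψ + φ) m‖ ≤ ‖ψ m‖ + ‖φ m‖ := norm_add_le _ _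
    have h2 : ‖(ψ + φ) m‖ ^ 2 ≤ 2 * ‖ψ m‖ ^ 2 + 2 * ‖φ m‖ ^ 2 := by
      nlinarith [norm_nonneg ((ψ + φ) m), norm_nonneg (ψ m), norm_nonneg (φ m),
        sq_nonneg (‖ψ m‖ - ‖φ m‖)]
    have h3 : (0 : ℝ) ≤ m := Nat.cast_nonneg m
    nlinarith [mul_le_mul_of_nonneg_left h2 h3]
  smul_mem' := fun z ψ hψ => by
    have h : (fun m : ℕ => (m : ℝ) * ‖(z • ψ) m‖ ^ 2) =
        fun m : ℕ => ‖z‖ ^ 2 * ((m : ℝ) * ‖ψ m‖ ^ 2) := by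
      funext m
      have : ‖(z • ψ) m‖ = ‖z‖ * ‖ψ m‖ := norm_smul z (ψ m)
      rw [this]
      ring
    simp only [Set.mem_ofPred_eq, h]
    exact Summable.mul_left _ hψ

theorem memℓp_annihilate (f : OneBoson) {ψ : Fock} (hψ : ψ ∈ sqrtNumberDomain) :
    Memℓp (fun m : ℕ => annihilateSector f m (ψ (m + 1))) 2 := by
  refine memℓp_gen ?_
  have hψ' : Summable fun m : ℕ => (m : ℝ) * ‖ψ m‖ ^ 2 := hψ
  have h := ((summable_nat_add_iff 1).2 hψ').mul_left (‖f‖ ^ 2)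
  refine Summable.of_nonneg_of_le (fun m => by positivity) (fun m => ?_) h
  have h1 := norm_annihilateSector_le f m (ψ (m + 1))
  have h2 : ‖annihilateSector f m (ψ (m + 1))‖ ^ 2 ≤
      (√(m + 1 : ℝ) * ‖f‖ * ‖ψ (m + 1)‖) ^ 2 := pow_le_pow_left₀ (norm_nonneg _) h1 2
  have h3 : (√(m + 1 : ℝ) * ‖f‖ * ‖ψ (m + 1)‖) ^ 2 =
      ‖f‖ ^ 2 * (((m + 1 : ℕ) : ℝ) * ‖ψ (m + 1)‖ ^ 2) := by
    rw [mul_pow, mul_pow, Real.sq_sqrt (by positivity)]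
    push_cast
    ring
  rw [h3] at h2
  simpa using h2

/-- The annihilation operator `a(f)` on `D(√𝒩)`:
`(a(f)ψ)^(m)(k₁, …, k_m) = √(m+1) ∫ dk  conj f(k) ψ^(m+1)(k, k₁, …, k_m)`. -/
def annihilation (f : OneBoson) : Fock →ₗ.[ℂ] Fock where
  domain := sqrtNumberDomain
  toFun :=
    { toFun := fun ψ => ⟨fun m => annihilateSector f m (ψ.1 (m + 1)), memℓp_annihilate f ψ.2⟩
      map_add' := fun _ _ => lp.ext (funext fun m => map_add (annihilateSector f m) _ _)
      map_smul' := fun z _ => lp.ext (funext fun m => map_smul (annihilateSector f m) z _) }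

theorem annihilation_apply (f : OneBoson) (ψ : sqrtNumberDomain) (m : ℕ) :
    waveFun (annihilation f ψ) m =ᵐ[volume] fun K =>
      (√(m + 1 : ℝ) : ℂ) * ∫ k, (starRingEnd ℂ) (f k) * waveFun ψ.1 (m + 1) (Fin.cons k K) :=
  MemLp.coeFn_toLp (annihilateFun_bound f (ψ.1 (m + 1)).1).1

open scoped LinearPMap in
/-- The Segal field operator `Φ(f) = (a(f) + a*(f))/√2` on `D(√𝒩)`, where `a*(f)` is the
Hilbert space adjoint of `a(f)`. -/
def segalCore (f : OneBoson) : Fock →ₗ.[ℂ] Fock :=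
  (((√2 : ℝ) : ℂ)⁻¹) • (annihilation f + (annihilation f)†)

/-- The self-adjoint field operator `Φ(f)`, the closure of `(a(f) + a*(f))/√2` on `D(√𝒩)`. -/
def segal (f : OneBoson) : Fock →ₗ.[ℂ] Fock := (segalCore f).closure

/-- `H_f + Φ(f) + c` on its natural domain `D(H_f) ∩ D(Φ(f))`. -/
def fiberHamiltonian (f : OneBoson) (c : ℝ) : Fock →ₗ.[ℂ] Fock :=
  ((c : ℂ) • (LinearMap.id : Fock →ₗ[ℂ] Fock)) +ᵥ (freeField + segal f)

/-! ### Unbounded operators -/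

section Operators

variable {H : Type*} [NormedAddCommGroup H] [InnerProductSpace ℂ H]

/-- The embedding `ψ ↦ (ψ, A ψ)` of `D(A)` into `H ⊕ H` with the norm `‖ψ‖ + ‖φ‖`. -/
def graphEmbed (A : H →ₗ.[ℂ] H) : A.domain →ₗ[ℂ] WithLp 1 (H × H) :=
  (WithLp.linearEquiv 1 ℂ (H × H)).symm.toLinearMap ∘ₗ A.domain.subtype.prod A.toFun

theorem graphEmbed_injective (A : H →ₗ.[ℂ] H) : Function.Injective (graphEmbed A) :=
  fun _ _ h => Subtype.ext (congrArg (fun p : WithLp 1 (H × H) => (WithLp.ofLp p).1) h)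

/-- The domain of an operator, with the graph norm `‖ψ‖ + ‖A ψ‖`. -/
def GraphDomain (A : H →ₗ.[ℂ] H) : Type _ := A.domain

instance (A : H →ₗ.[ℂ] H) : AddCommGroup (GraphDomain A) :=
  inferInstanceAs (AddCommGroup A.domain)

instance (A : H →ₗ.[ℂ] H) : Module ℂ (GraphDomain A) :=
  inferInstanceAs (Module ℂ A.domain)

/-- The map `graphEmbed A` on the type synonym. -/
def GraphDomain.embed (A : H →ₗ.[ℂ] H) : GraphDomain A →ₗ[ℂ] WithLp 1 (H × H) := graphEmbed A

instance (A : H →ₗ.[ℂ] H) : NormedAddCommGroup (GraphDomain A) :=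
  NormedAddCommGroup.induced (GraphDomain A) (WithLp 1 (H × H)) (GraphDomain.embed A)
    (graphEmbed_injective A)

instance (A : H →ₗ.[ℂ] H) : NormedSpace ℂ (GraphDomain A) :=
  NormedSpace.induced ℂ (GraphDomain A) (WithLp 1 (H × H)) (GraphDomain.embed A)

/-- An element of the domain of `A`, as an element of the space with the graph norm. -/
def GraphDomain.of (A : H →ₗ.[ℂ] H) (ψ : A.domain) : GraphDomain A := ψ

theorem GraphDomain.norm_of (A : H →ₗ.[ℂ] H) (ψ : A.domain) :
    ‖GraphDomain.of A ψ‖ = ‖(ψ : H)‖ + ‖A ψ‖ :=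
  WithLp.prod_norm_eq_of_L1 (GraphDomain.embed A (GraphDomain.of A ψ))

/-- `z` is in the spectrum of `A` if `A - z` has no bounded everywhere defined inverse. -/
def opSpectrum (A : H →ₗ.[ℂ] H) : Set ℂ :=
  {z | ¬ ∃ B : H →L[ℂ] H,
    (∀ φ : H, ∃ h : B φ ∈ A.domain, A ⟨B φ, h⟩ - z • B φ = φ) ∧
    (∀ ψ : A.domain, B (A ψ - z • (ψ : H)) = ψ)}

/-- `Ω` is a ground state of `A` with energy `E`: a nonzero eigenvector for the eigenvalue `E`,
which is the infimum of the spectrum. -/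
def IsGroundState (A : H →ₗ.[ℂ] H) (E : ℝ) (Ω : H) : Prop :=
  IsLeast {r : ℝ | (r : ℂ) ∈ opSpectrum A} E ∧ Ω ≠ 0 ∧
    ∃ h : Ω ∈ A.domain, A ⟨Ω, h⟩ = (E : ℂ) • Ω

/-- `U = exp(iA)` for a self-adjoint operator `A`: `U = W(1)` for the strongly continuous
one-parameter unitary group `W(t)` with `d/dt W(t)ψ = iAψ` at `t = 0` for `ψ ∈ D(A)`. (The
generator of `W` is self-adjoint and extends `A`, so it is `A`, and `W(t) = exp(itA)`.) -/
def IsExpI (A : H →ₗ.[ℂ] H) (U : H ≃ₗᵢ[ℂ] H) : Prop :=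
  ∃ W : ℝ → (H ≃ₗᵢ[ℂ] H),
    (∀ s t ψ, W (s + t) ψ = W s (W t ψ)) ∧
    (∀ ψ, Continuous fun t => W t ψ) ∧
    (∀ ψ : A.domain, HasDerivAt (fun t => W t (ψ : H)) (Complex.I • A ψ) 0) ∧
    U = W 1

end Operators

/-! ### Regularity -/

/-- `C^n_b`: `n` times continuously differentiable, all derivatives up to order `n` bounded. -/
def IsCnb {X Y : Type*} [NormedAddCommGroup X] [NormedSpace ℝ X] [NormedAddCommGroup Y]
    [NormedSpace ℝ Y] (n : ℕ) (f : X → Y) : Prop :=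
  ContDiff ℝ n f ∧ ∀ m : ℕ, m ≤ n → ∃ C : ℝ, ∀ x, ‖iteratedFDeriv ℝ m f x‖ ≤ C

/-- The configuration space `ℝ^{3N}` of `N` particles. -/
abbrev Config (N : ℕ) : Type := EuclideanSpace ℝ (Fin N × Fin 3)

/-- The function `k ↦ |k|^s f(k)`. -/
def weight (s : ℝ) (f : Momentum → ℂ) (k : Momentum) : ℂ := ((‖k‖ ^ s : ℝ) : ℂ) * f k

/-- The `L²`-valued map `x ↦ g(x, ·)`. -/
def toL2 {X : Type*} {g : X → Momentum → ℂ} (hg : ∀ x, MemLp (g x) 2 volume) (x : X) : OneBoson :=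
  (hg x).toLp (g x)

end

end Nelson

/-!
The proof rests on the exponential vectors `ε(h) = ∑ h^⊗m / √m!`, which are total in the Fock space
and satisfy `⟪ε(g), ε(h)⟫ = exp ⟪g, h⟫` (`isTotal_expVec`, `inner_expVec`).

*Weyl operators.* The maps `ε(g) ↦ exp(-‖f‖²/2 - ⟪f, g⟫) ε(g + f)` preserve inner products, so they
extend to unitary operators `W(f)`, and `t ↦ W(tf)` is a strongly continuous group. Its derivative
on exponential vectors is `a*(f) - a(f)`. The exponential vectors span a core of every operator
bounded relative to the square root of the number operator, and the generator is closed, so with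
`f = -v/√2` this gives `W(f) = exp(iΦ(iv))` (`isExpI_weyl`).

*Intertwining.* Let `G = |k| v`, and assume that `|k|^(1/2) v` is square integrable. By the estimate
`‖a(G)ψ‖² ≤ ‖|k|^(1/2) v‖² ⟪ψ, H_f ψ⟫` the field operator `Φ(G)` is infinitesimally small relative
to `H_f` (`exists_segal_apply`), so `H₀ = H_f + Φ(G) + c` has the domain of `H_f` and is closed. On
exponential vectors of momentum-bounded functions `g`, `H_f ε(g) = a*(|k| g) ε(g)`, and completing
the square gives `H₀ W(f) ε(g) = W(f) (H_f + E) ε(g)` with `f = -v/√2` and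
`E = c - ⟪|k| f, f⟫ = c - ½ ∫ |k| |v|²`. These vectors span a core of `H_f` (`isTotal_coreVec`), so
`H₀ W(f) = W(f) (H_f + E)` on all of `D(H_f)` (`weyl_mem_graph`). As `H_f ≥ 0` and `H_f + r` is onto
for `r > 0`, `H₀ - r` is onto for real `r < E`. This gives the self-adjointness of the symmetric
operator `H₀`, shows that `W(f)` maps `D(H_f)` onto `D(H₀)`, and reduces everything about the ground
state of `H₀` to the kernel of `H_f`, which is spanned by the vacuum
(`isGroundState_weyl_vacuum`, `exists_eq_smul_weyl_vacuum`).

*Regularity of `H₀`.* By the estimate on `Φ(G)`, the map that takes `(|k|^(1/2) + |k|) v` to the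
restriction of `Φ(|k| v)` to `D(H_f)` is real-linear and bounded from `L²` to `L(D(H_f), F)`
(`fieldL`), so `H₀` inherits its regularity from `|k|^(1/2) v`, `|k| v` and `V_IR`.

*Regularity of the ground state.* Let `h(x) = -v(x)/√2`. The vector `W(h(x)) Ω₀` is
`exp(-‖h(x)‖²/2) ε(h(x))`, and `ε` is entire, so the ground state is as smooth as `h`. But `h`
itself need not be bounded. By the Weyl relations, `W(h(x)) Ω₀ = W(h(a)) F(θ(x), h(x) - h(a))` with
`F(t, g) = e^{it} W(g) Ω₀` and the phase `θ(x) = Im ⟪h(a), h(x) - h(a)⟫`. As `W(h(a))` is unitary,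
the derivatives at `a` are bounded by those of `F` at `0` and those of `θ` and `h` at `a`. Because
of `Im ⟪h, ∇h⟫ = 0`, `∇θ(x) = -Im ⟪h(x) - h(a), ∇h(x)⟫`, and the derivatives of this at `x = a` are
bounded in terms of those of `h` of order at least one (`isCnb_weyl_vacuum`).
-/

namespace Nelson

noncomputable section

/-! ### Operators on Hilbert spaces -/

section HilbertSpace

open Filter Topology
open scoped InnerProductSpace LinearPMap

variable {H : Type*} [NormedAddCommGroup H] [InnerProductSpace ℂ H]

/-- A family of vectors is total if only `0` is orthogonal to all of them. -/
def IsTotal {ι : Type*} (e : ι → H) : Prop :=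
  ∀ φ : H, (∀ i, ⟪e i, φ⟫_ℂ = 0) → φ = 0

theorem IsTotal.topologicalClosure_span [CompleteSpace H] {ι : Type*} {e : ι → H}
    (he : IsTotal e) : (Submodule.span ℂ (Set.range e)).topologicalClosure = ⊤ := by
  rw [Submodule.topologicalClosure_eq_top_iff, Submodule.eq_bot_iff]
  intro φ hφ
  exact he φ fun i => (Submodule.mem_orthogonal _ _).1 hφ _ (Submodule.subset_span ⟨i, rfl⟩)

theorem IsTotal.subset_of_isClosed [CompleteSpace H] {ι : Type*} {e : ι → H} (he : IsTotal e)
    {S : Submodule ℂ H} (hS : IsClosed (S : Set H)) (h : ∀ i, e i ∈ S) (φ : H) : φ ∈ S := by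
  have h1 : (Submodule.span ℂ (Set.range e)).topologicalClosure ≤ S :=
    Submodule.topologicalClosure_minimal _ (Submodule.span_le.2
      (by rintro _ ⟨i, rfl⟩; exact h i)) hS
  rw [he.topologicalClosure_span] at h1
  exact h1 trivial

theorem IsTotal.eq_of_forall_inner {ι : Type*} {e : ι → H} (he : IsTotal e) {φ ψ : H}
    (h : ∀ i, ⟪e i, φ⟫_ℂ = ⟪e i, ψ⟫_ℂ) : φ = ψ :=
  sub_eq_zero.1 (he _ fun i => by rw [inner_sub_right, h i, sub_self])

theorem IsTotal.clm_ext [CompleteSpace H] {F : Type*} [NormedAddCommGroup F] [NormedSpace ℂ F]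
    {ι : Type*} {e : ι → H} (he : IsTotal e) {A B : H →L[ℂ] F} (h : ∀ i, A (e i) = B (e i)) :
    A = B := by
  ext φ
  exact he.subset_of_isClosed (S := LinearMap.eqLocus A.toLinearMap B.toLinearMap)
    (isClosed_eq A.continuous B.continuous) h φ

theorem IsTotal.dense [CompleteSpace H] {ι : Type*} {e : ι → H} (he : IsTotal e)
    {S : Submodule ℂ H} (h : ∀ i, e i ∈ S) : Dense (S : Set H) := by
  rw [Submodule.dense_iff_topologicalClosure_eq_top, eq_top_iff]
  exact fun φ _ => he.subset_of_isClosed S.isClosed_topologicalClosure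
    (fun i => S.le_topologicalClosure (h i)) φ

/-- Two total families with the same Gram matrix are intertwined by a unitary operator. Its graph
is the closed span of the pairs `(e i, e' i)`, on which both projections are isometric. -/
theorem exists_unitary_of_gram [CompleteSpace H] {ι : Type*} {e e' : ι → H} (he : IsTotal e)
    (he' : IsTotal e') (hG : ∀ i j, ⟪e i, e j⟫_ℂ = ⟪e' i, e' j⟫_ℂ) :
    ∃ W : H ≃ₗᵢ[ℂ] H, ∀ i, W (e i) = e' i := by
  set S : Submodule ℂ (H × H) := Submodule.span ℂ (Set.range fun i => (e i, e' i)) with hS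
  have h1 : ∀ p ∈ S, ∀ i, ⟪e i, p.1⟫_ℂ = ⟪e' i, p.2⟫_ℂ := by
    intro p hp i
    induction hp using Submodule.span_induction with
    | mem x hx => obtain ⟨j, rfl⟩ := hx; exact hG i j
    | zero => simp
    | add x y _ _ hx hy => simp [hx, hy]
    | smul c x _ hx => simp [hx]
  have h2 : ∀ p ∈ S, ∀ q ∈ S, ⟪q.1, p.1⟫_ℂ = ⟪q.2, p.2⟫_ℂ := by
    intro p hp q hq
    induction hq using Submodule.span_induction with
    | mem x hx => obtain ⟨j, rfl⟩ := hx; exact h1 p hp j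
    | zero => simp
    | add x y _ _ hx hy => simp [hx, hy]
    | smul c x _ hx => simp [hx]
  have h3 : ∀ p ∈ S.topologicalClosure, ‖p.1‖ = ‖p.2‖ := by
    intro p hp
    have hcl : IsClosed {p : H × H | ‖p.1‖ = ‖p.2‖} :=
      isClosed_eq continuous_fst.norm continuous_snd.norm
    refine (closure_minimal (fun p hp => ?_) hcl : closure (S : Set (H × H)) ⊆ _) hp
    have := h2 p hp p hp
    rw [inner_self_eq_norm_sq_to_K, inner_self_eq_norm_sq_to_K] at this
    have h' : ‖p.1‖ ^ 2 = ‖p.2‖ ^ 2 := by exact_mod_cast this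
    exact (pow_left_inj₀ (norm_nonneg _) (norm_nonneg _) two_ne_zero).1 h'
  set G := S.topologicalClosure
  have hGc : CompleteSpace G := S.isClosed_topologicalClosure.completeSpace_coe
  let f : G →ₗᵢ[ℂ] H :=
    { toLinearMap := LinearMap.fst ℂ H H ∘ₗ G.subtype
      norm_map' := fun p => by
        have := h3 p.1 p.2
        change ‖p.1.1‖ = ‖p.1‖
        rw [Prod.norm_def, this, max_self] }
  let g : G →ₗᵢ[ℂ] H :=
    { toLinearMap := LinearMap.snd ℂ H H ∘ₗ G.subtype
      norm_map' := fun p => by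
        have := h3 p.1 p.2
        change ‖p.1.2‖ = ‖p.1‖
        rw [Prod.norm_def, this, max_self] }
  have hmem : ∀ i, (e i, e' i) ∈ G := fun i =>
    S.le_topologicalClosure (Submodule.subset_span ⟨i, rfl⟩)
  have hf : Function.Surjective f := fun φ =>
    he.subset_of_isClosed (S := LinearMap.range f.toLinearMap)
      (by rw [LinearMap.coe_range]; exact f.isometry.isClosedEmbedding.isClosed_range)
      (fun i => ⟨⟨_, hmem i⟩, rfl⟩) φ
  have hg : Function.Surjective g := fun φ =>
    he'.subset_of_isClosed (S := LinearMap.range g.toLinearMap)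
      (by rw [LinearMap.coe_range]; exact g.isometry.isClosedEmbedding.isClosed_range)
      (fun i => ⟨⟨_, hmem i⟩, rfl⟩) φ
  refine ⟨(LinearIsometryEquiv.ofSurjective f hf).symm.trans
    (LinearIsometryEquiv.ofSurjective g hg), fun i => ?_⟩
  have : (LinearIsometryEquiv.ofSurjective f hf).symm (e i) = ⟨_, hmem i⟩ := by
    rw [LinearIsometryEquiv.symm_apply_eq]
    rfl
  rw [LinearIsometryEquiv.trans_apply, this]
  rfl

theorem exists_apply_of_mem_graph {A : H →ₗ.[ℂ] H} {ψ φ : H} (h : (ψ, φ) ∈ A.graph) :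
    ∃ h : ψ ∈ A.domain, A ⟨ψ, h⟩ = φ := by
  obtain ⟨χ, h1, h2⟩ := (LinearPMap.mem_graph_iff _).1 h
  simp only at h1 h2
  subst h1
  exact ⟨χ.2, h2⟩

theorem isFormalAdjoint_closure {A : H →ₗ.[ℂ] H} (hA : A.IsClosable) (hs : A.IsFormalAdjoint A) :
    A.closure.IsFormalAdjoint A.closure := by
  have h0 : ∀ p ∈ A.graph, ∀ q ∈ A.graph, ⟪p.2, q.1⟫_ℂ = ⟪p.1, q.2⟫_ℂ := by
    intro p hp q hq
    obtain ⟨ψ, h1, h2⟩ := (LinearPMap.mem_graph_iff A).1 hp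
    obtain ⟨φ, h3, h4⟩ := (LinearPMap.mem_graph_iff A).1 hq
    rw [← h1, ← h2, ← h3, ← h4]
    exact hs ψ φ
  have h1 : ∀ p ∈ closure (A.graph : Set (H × H)), ∀ q ∈ A.graph,
      ⟪p.2, q.1⟫_ℂ = ⟪p.1, q.2⟫_ℂ := fun p hp q hq =>
    closure_minimal (t := {p : H × H | ⟪p.2, q.1⟫_ℂ = ⟪p.1, q.2⟫_ℂ})
      (fun p hp => h0 p hp q hq) (isClosed_eq (by fun_prop) (by fun_prop)) hp
  have h2 : ∀ p ∈ closure (A.graph : Set (H × H)), ∀ q ∈ closure (A.graph : Set (H × H)),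
      ⟪p.2, q.1⟫_ℂ = ⟪p.1, q.2⟫_ℂ := fun p hp q hq =>
    closure_minimal (t := {q : H × H | ⟪p.2, q.1⟫_ℂ = ⟪p.1, q.2⟫_ℂ})
      (fun q hq => h1 p hp q hq) (isClosed_eq (by fun_prop) (by fun_prop)) hq
  have hg : ∀ ψ : A.closure.domain, ((ψ : H), A.closure ψ) ∈ closure (A.graph : Set (H × H)) := by
    intro ψ
    have := A.closure.mem_graph ψ
    rwa [← hA.graph_closure_eq_closure_graph] at this
  exact fun ψ φ => h2 _ (hg ψ) _ (hg φ)

/-- A densely defined symmetric operator `A` is self-adjoint if `A - r` is onto for some real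
number `r`. -/
theorem isSelfAdjoint_of_surjective [CompleteSpace H] {A : H →ₗ.[ℂ] H}
    (hd : Dense (A.domain : Set H)) (hs : A.IsFormalAdjoint A) (r : ℝ)
    (hr : ∀ φ : H, ∃ ψ : A.domain, A ψ - (r : ℂ) • (ψ : H) = φ) : IsSelfAdjoint A := by
  rw [LinearPMap.isSelfAdjoint_def]
  refine le_antisymm ?_ (hs.le_adjoint hd)
  have key : ∀ φ : A†.domain, ∃ ψ : A.domain, (ψ : H) = φ ∧ A ψ = A† φ := by
    intro φ
    obtain ⟨ψ, hψ⟩ := hr (A† φ - (r : ℂ) • (φ : H))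
    have h0 : ∀ χ : A.domain, ⟪(φ : H) - ψ, A χ - (r : ℂ) • (χ : H)⟫_ℂ = 0 := by
      intro χ
      have e1 : ⟪A† φ, (χ : H)⟫_ℂ = ⟪(φ : H), A χ⟫_ℂ := A.adjoint_isFormalAdjoint hd φ χ
      have e2 : ⟪A ψ, (χ : H)⟫_ℂ = ⟪(ψ : H), A χ⟫_ℂ := hs ψ χ
      have e3 := congrArg (fun z => ⟪z, (χ : H)⟫_ℂ) hψ
      simp only [inner_sub_left, inner_smul_left, Complex.conj_ofReal] at e3
      rw [inner_sub_left, inner_sub_right, inner_sub_right, inner_smul_right, inner_smul_right]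
      rw [e1, e2] at e3
      linear_combination -e3
    obtain ⟨χ, hχ⟩ := hr ((φ : H) - ψ)
    have h1 := h0 χ
    rw [hχ, inner_self_eq_zero, sub_eq_zero] at h1
    refine ⟨ψ, h1.symm, ?_⟩
    rw [h1] at hψ
    simpa using hψ
  refine ⟨fun φ hφ => ?_, fun φ ψ h => ?_⟩
  · obtain ⟨ψ, h, -⟩ := key ⟨φ, hφ⟩
    change (ψ : H) = φ at h
    exact h ▸ ψ.2
  · obtain ⟨ψ', h1, h2⟩ := key φ
    rw [← h2]
    congr 1
    exact Subtype.ext (h1.trans h)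

/-- A point `z` at which `A - z` is onto and bounded below is not in the spectrum. -/
theorem notMem_opSpectrum {A : H →ₗ.[ℂ] H} {z : ℂ} {c : ℝ} (hc : 0 < c)
    (hr : ∀ φ : H, ∃ ψ : A.domain, A ψ - z • (ψ : H) = φ)
    (hb : ∀ ψ : A.domain, c * ‖(ψ : H)‖ ≤ ‖A ψ - z • (ψ : H)‖) : z ∉ opSpectrum A := by
  let T : A.domain →ₗ[ℂ] H := A.toFun - z • A.domain.subtype
  have hT : ∀ ψ, T ψ = A ψ - z • (ψ : H) := fun ψ => rfl
  have hinj : Function.Injective T := by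
    rw [injective_iff_map_eq_zero]
    intro ψ h
    have := hb ψ
    rw [← hT, h, norm_zero] at this
    have h2 : ‖(ψ : H)‖ ≤ 0 := by
      by_contra h3
      push Not at h3
      nlinarith [mul_pos hc h3]
    exact Subtype.ext (norm_le_zero_iff.1 h2)
  let Te := LinearEquiv.ofBijective T ⟨hinj, fun φ => hr φ⟩
  let B : H →L[ℂ] H := LinearMap.mkContinuous (A.domain.subtype ∘ₗ Te.symm.toLinearMap) c⁻¹ (by
    intro φ
    have := hb (Te.symm φ)
    rw [← hT] at this
    have h2 : T (Te.symm φ) = φ := Te.apply_symm_apply φ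
    rw [h2] at this
    rw [inv_mul_eq_div, le_div_iff₀ hc, mul_comm]
    exact this)
  have hB : ∀ φ, B φ = Te.symm φ := fun φ => rfl
  intro hmem
  refine hmem ⟨B, fun φ => ⟨(Te.symm φ).2, ?_⟩, fun ψ => ?_⟩
  · exact Te.apply_symm_apply φ
  · rw [← hT, hB]
    exact congrArg Subtype.val (Te.symm_apply_apply ψ)

theorem mem_opSpectrum_of_eigenvector {A : H →ₗ.[ℂ] H} {z : ℂ} {ψ : H} (hψ : ψ ≠ 0)
    (h : ∃ h : ψ ∈ A.domain, A ⟨ψ, h⟩ = z • ψ) : z ∈ opSpectrum A := by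
  rintro ⟨B, -, hB⟩
  obtain ⟨hd, he⟩ := h
  have := hB ⟨ψ, hd⟩
  rw [he] at this
  simp only [sub_self, map_zero] at this
  exact hψ this.symm

/-- The graph of the generator of a one-parameter group `W`: the pairs `(ψ, φ)` such that
`d/dt W(t)ψ = W(t)φ` at all times. -/
def generatorGraph (W : ℝ → (H ≃ₗᵢ[ℂ] H)) : Submodule ℂ (H × H) where
  carrier := {p | ∀ t, HasDerivAt (fun s => W s p.1) (W t p.2) t}
  zero_mem' := fun t => by simpa using hasDerivAt_const t (0 : H)
  add_mem' := fun {p q} hp hq t => by simpa using! (hp t).add (hq t)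
  smul_mem' := fun z p hp t => by simpa using! (hp t).const_smul z

/-- The graph of the generator is closed: as the `W(t)` are isometries, `W(t)ψ` and its derivative
`W(t)φ` converge uniformly in `t` when `ψ` and `φ` converge. -/
theorem isClosed_generatorGraph (W : ℝ → (H ≃ₗᵢ[ℂ] H)) :
    IsClosed (generatorGraph W : Set (H × H)) := by
  refine isSeqClosed_iff_isClosed.1 fun p q hp hpq t => ?_
  have h1 : Tendsto (fun n => (p n).1) atTop (𝓝 q.1) := (continuous_fst.tendsto q).comp hpq
  have h2 : Tendsto (fun n => (p n).2) atTop (𝓝 q.2) := (continuous_snd.tendsto q).comp hpq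
  have hu : TendstoUniformly (fun n t => W t (p n).2) (fun t => W t q.2) atTop := by
    rw [Metric.tendstoUniformly_iff]
    intro ε hε
    filter_upwards [Metric.tendsto_nhds.1 h2 ε hε] with n hn t
    rw [(W t).dist_map, dist_comm]
    exact hn
  refine hasDerivAt_of_tendstoUniformly hu (Eventually.of_forall fun n x => hp n x)
    (fun x => ((W x).continuous.tendsto _).comp h1) t

/-- The vectors `ψ` for which `t ↦ W(t)ψ` is continuous. -/
def continuousVectors (W : ℝ → (H ≃ₗᵢ[ℂ] H)) : Submodule ℂ H where
  carrier := {ψ | Continuous fun t => W t ψ}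
  zero_mem' := by simpa using! continuous_const
  add_mem' := fun {ψ φ} (hψ : Continuous _) (hφ : Continuous _) => by simpa using! hψ.add hφ
  smul_mem' := fun z ψ (hψ : Continuous _) => by simpa using! hψ.const_smul z

theorem isClosed_continuousVectors (W : ℝ → (H ≃ₗᵢ[ℂ] H)) :
    IsClosed (continuousVectors W : Set H) := by
  refine isSeqClosed_iff_isClosed.1 fun p q hp hpq => ?_
  have hu : TendstoUniformly (fun n t => W t (p n)) (fun t => W t q) atTop := by
    rw [Metric.tendstoUniformly_iff]
    intro ε hε
    filter_upwards [Metric.tendsto_nhds.1 hpq ε hε] with n hn t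
    rw [(W t).dist_map, dist_comm]
    exact hn
  exact hu.continuous (Frequently.of_forall hp)

theorem mem_generatorGraph {W : ℝ → (H ≃ₗᵢ[ℂ] H)} (hW : ∀ s t ψ, W (s + t) ψ = W s (W t ψ))
    {ψ φ : H} (h : HasDerivAt (fun s => W s ψ) φ 0) : (ψ, φ) ∈ generatorGraph W := by
  intro t
  have h1 : HasDerivAt (fun s => W t (W (s - t) ψ)) (W t φ) t := by
    have h2 : HasDerivAt (fun s => W (s - t) ψ) φ t := by
      have : HasDerivAt (fun s => W s ψ) φ (t - t) := by rwa [sub_self]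
      simpa using this.comp_sub_const t t
    exact (((W t).toContinuousLinearEquiv : H →L[ℂ] H).restrictScalars
      ℝ).hasFDerivAt.comp_hasDerivAt t h2
  refine h1.congr_of_eventuallyEq (Eventually.of_forall fun s => ?_)
  change W s ψ = W t (W (s - t) ψ)
  rw [← hW, add_sub_cancel]

end HilbertSpace

/-- The coefficients of a power series that vanishes identically are zero. -/
theorem eq_zero_of_hasSum_pow {b : ℕ → ℂ} (h : ∀ z : ℂ, HasSum (fun m => z ^ m * b m) 0) (m : ℕ) :
    b m = 0 := by
  let p : FormalMultilinearSeries ℂ ℂ ℂ := fun n =>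
    ContinuousMultilinearMap.mkPiRing ℂ (Fin n) (b n)
  have hp : HasFPowerSeriesAt (0 : ℂ → ℂ) p 0 := by
    rw [hasFPowerSeriesAt_iff]
    refine Filter.Eventually.of_forall fun z => ?_
    simpa [p, FormalMultilinearSeries.coeff] using h z
  have h0 := hp.eq_zero
  have h1 : p m (fun _ => 1) = 0 := by rw [h0]; rfl
  simpa [p] using h1

/-! ### Adding a boson: tensor products and creation operators -/

/-! Shortcuts that keep the instance search on the sectors short. They are local, as the instances
that the theorem refers to are the ones found by the general search. -/

local instance (m : ℕ) : NormedAddCommGroup (Sector m) := Submodule.normedAddCommGroup _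
local instance (m : ℕ) : InnerProductSpace ℂ (Sector m) := Submodule.innerProductSpace _
local instance (m : ℕ) : NormedSpace ℂ (Sector m) := Submodule.normedSpace _
local instance (m : ℕ) : MulAction ℂ (Sector m) := Module.toDistribMulAction.toMulAction
local instance : NormedAddCommGroup OneBoson := inferInstance
local instance : InnerProductSpace ℂ OneBoson := inferInstance
local instance : NormedSpace ℂ OneBoson := inferInstance
local instance : AddCommGroup OneBoson := inferInstance
local instance : AddCommMonoid OneBoson := inferInstance
local instance : Module ℂ OneBoson := inferInstance
local instance : SMul ℂ OneBoson := inferInstance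
local instance : TopologicalSpace OneBoson := inferInstance
local instance : CompleteSpace OneBoson := inferInstance
local instance : SeminormedAddCommGroup OneBoson := inferInstance
local instance (m : ℕ) : NormedAddCommGroup (NBody m) := inferInstance
local instance (m : ℕ) : InnerProductSpace ℂ (NBody m) := inferInstance
local instance (m : ℕ) : NormedSpace ℂ (NBody m) := inferInstance
local instance (m : ℕ) : AddCommGroup (NBody m) := inferInstance
local instance (m : ℕ) : AddCommMonoid (NBody m) := inferInstance
local instance (m : ℕ) : Module ℂ (NBody m) := inferInstance
local instance (m : ℕ) : SMul ℂ (NBody m) := inferInstance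
local instance (m : ℕ) : TopologicalSpace (NBody m) := inferInstance
local instance (m : ℕ) : SeminormedAddCommGroup (NBody m) := inferInstance
local instance (m : ℕ) : AddCommGroup (Sector m) := inferInstance
local instance (m : ℕ) : AddCommMonoid (Sector m) := inferInstance
local instance (m : ℕ) : Module ℂ (Sector m) := inferInstance
local instance (m : ℕ) : SMul ℂ (Sector m) := inferInstance
local instance (m : ℕ) : TopologicalSpace (Sector m) := inferInstance
local instance (m : ℕ) : SeminormedAddCommGroup (Sector m) := inferInstance

open scoped InnerProductSpace

theorem measurePreserving_tail (m : ℕ) :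
    MeasurePreserving (fun L : Fin (m + 1) → Momentum => (Fin.tail L, L 0)) volume
      (volume.prod volume) :=
  Measure.measurePreserving_swap.comp
    (volume_preserving_piFinSuccAbove (fun _ : Fin (m + 1) => Momentum) 0)

theorem integral_cons {m : ℕ} {F : (Fin (m + 1) → Momentum) → ℂ}
    (hF : AEStronglyMeasurable F volume) :
    ∫ L, F L = ∫ p : (Fin m → Momentum) × Momentum, F (Fin.cons p.2 p.1) ∂(volume.prod volume) := by
  rw [← (measurePreserving_snoc m).map_eq] at hF ⊢
  exact integral_map (measurePreserving_snoc m).measurable.aemeasurable hF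

theorem memLp_tensor (f : OneBoson) {m : ℕ} (χ : NBody m) :
    MemLp (fun L : Fin (m + 1) → Momentum => f (L 0) * χ (Fin.tail L)) 2 volume := by
  have hm : AEStronglyMeasurable (fun p : (Fin m → Momentum) × Momentum => f p.2 * χ p.1)
      (volume.prod volume) :=
    (Lp.aestronglyMeasurable f).comp_snd.mul (Lp.aestronglyMeasurable χ).comp_fst
  have h : MemLp (fun p : (Fin m → Momentum) × Momentum => f p.2 * χ p.1) 2
      (volume.prod volume) := by
    rw [memLp_two_iff_integrable_sq_norm hm]
    have h1 := (memLp_two_iff_integrable_sq_norm (Lp.aestronglyMeasurable f)).1 (Lp.memLp f)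
    have h2 := (memLp_two_iff_integrable_sq_norm (Lp.aestronglyMeasurable χ)).1 (Lp.memLp χ)
    refine (h2.mul_prod h1).congr (Filter.Eventually.of_forall fun p => ?_)
    simp only [norm_mul, mul_pow]
    ring
  exact h.comp_measurePreserving (measurePreserving_tail m)

/-- The product `f ⊗ χ`, `(f ⊗ χ)(k₀, …, k_m) = f(k₀) χ(k₁, …, k_m)`, without symmetrization. -/
def tensor (f : OneBoson) {m : ℕ} (χ : NBody m) : NBody (m + 1) := (memLp_tensor f χ).toLp _

theorem coeFn_tensor (f : OneBoson) {m : ℕ} (χ : NBody m) :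
    tensor f χ =ᵐ[volume] fun L => f (L 0) * χ (Fin.tail L) :=
  MemLp.coeFn_toLp _

theorem coeFn_tensor_cons (f : OneBoson) {m : ℕ} (χ : NBody m) :
    ∀ᵐ p : (Fin m → Momentum) × Momentum ∂(volume.prod volume),
      tensor f χ (Fin.cons p.2 p.1) = f p.2 * χ p.1 :=
  (measurePreserving_snoc m).quasiMeasurePreserving.ae_eq_comp (coeFn_tensor f χ)

theorem ae_tail {m : ℕ} {p : (Fin m → Momentum) → Prop} (h : ∀ᵐ K, p K) :
    ∀ᵐ L : Fin (m + 1) → Momentum, p (Fin.tail L) :=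
  (Measure.quasiMeasurePreserving_fst.comp
    (measurePreserving_tail m).quasiMeasurePreserving).ae h

theorem ae_head {m : ℕ} {p : Momentum → Prop} (h : ∀ᵐ k, p k) :
    ∀ᵐ L : Fin (m + 1) → Momentum, p (L 0) :=
  (Measure.quasiMeasurePreserving_snd.comp
    (measurePreserving_tail m).quasiMeasurePreserving).ae h

theorem tensor_add_left (f g : OneBoson) {m : ℕ} (χ : NBody m) :
    tensor (f + g) χ = tensor f χ + tensor g χ := by
  refine Lp.ext ?_
  filter_upwards [coeFn_tensor (f + g) χ, coeFn_tensor f χ, coeFn_tensor g χ,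
    Lp.coeFn_add (tensor f χ) (tensor g χ), ae_head (Lp.coeFn_add f g)] with L h1 h2 h3 h4 h5
  rw [h1, h4, Pi.add_apply, h2, h3, h5, Pi.add_apply, add_mul]

theorem tensor_smul_left (z : ℂ) (f : OneBoson) {m : ℕ} (χ : NBody m) :
    tensor (z • f) χ = z • tensor f χ := by
  refine Lp.ext ?_
  filter_upwards [coeFn_tensor (z • f) χ, coeFn_tensor f χ,
    Lp.coeFn_smul z (tensor f χ), ae_head (Lp.coeFn_smul z f)] with L h1 h2 h4 h5
  rw [h1, h4, Pi.smul_apply, h2, h5, Pi.smul_apply, smul_eq_mul, smul_eq_mul, mul_assoc]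

theorem tensor_add_right (f : OneBoson) {m : ℕ} (χ ψ : NBody m) :
    tensor f (χ + ψ) = tensor f χ + tensor f ψ := by
  refine Lp.ext ?_
  filter_upwards [coeFn_tensor f (χ + ψ), coeFn_tensor f χ, coeFn_tensor f ψ,
    Lp.coeFn_add (tensor f χ) (tensor f ψ), ae_tail (Lp.coeFn_add χ ψ)] with L h1 h2 h3 h4 h5
  rw [h1, h4, Pi.add_apply, h2, h3, h5, Pi.add_apply, mul_add]

theorem tensor_smul_right (z : ℂ) (f : OneBoson) {m : ℕ} (χ : NBody m) :
    tensor f (z • χ) = z • tensor f χ := by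
  refine Lp.ext ?_
  filter_upwards [coeFn_tensor f (z • χ), coeFn_tensor f χ,
    Lp.coeFn_smul z (tensor f χ), ae_tail (Lp.coeFn_smul z χ)] with L h1 h2 h4 h5
  rw [h1, h4, Pi.smul_apply, h2, h5, Pi.smul_apply, smul_eq_mul, smul_eq_mul, mul_left_comm]

theorem inner_tensor_tensor (f g : OneBoson) {m : ℕ} (χ ψ : NBody m) :
    ⟪tensor f χ, tensor g ψ⟫_ℂ = ⟪f, g⟫_ℂ * ⟪χ, ψ⟫_ℂ := by
  rw [L2.inner_def, integral_cons (L2.integrable_inner _ _).aestronglyMeasurable, L2.inner_def,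
    L2.inner_def, mul_comm, ← integral_prod_mul]
  refine integral_congr_ae ?_
  filter_upwards [coeFn_tensor_cons f χ, coeFn_tensor_cons g ψ] with p h1 h2
  rw [h1, h2]
  simp only [RCLike.inner_apply, map_mul]
  ring

theorem norm_tensor (f : OneBoson) {m : ℕ} (χ : NBody m) : ‖tensor f χ‖ = ‖f‖ * ‖χ‖ := by
  have h := inner_tensor_tensor f f χ χ
  rw [inner_self_eq_norm_sq_to_K, inner_self_eq_norm_sq_to_K, inner_self_eq_norm_sq_to_K] at h
  have h' : ‖tensor f χ‖ ^ 2 = (‖f‖ * ‖χ‖) ^ 2 := by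
    rw [mul_pow]
    exact_mod_cast h
  exact (pow_left_inj₀ (norm_nonneg _) (by positivity) two_ne_zero).1 h'

theorem inner_tensor (f : OneBoson) {m : ℕ} (χ : NBody m) (ψ : NBody (m + 1)) :
    ⟪tensor f χ, ψ⟫_ℂ =
      ∫ K, (∫ k, (starRingEnd ℂ) (f k) * ψ (Fin.cons k K)) * (starRingEnd ℂ) (χ K) := by
  have hi := L2.integrable_inner (𝕜 := ℂ) (tensor f χ) ψ
  rw [L2.inner_def, integral_cons hi.aestronglyMeasurable]
  have hi' : Integrable (fun p : (Fin m → Momentum) × Momentum =>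
      ⟪tensor f χ (Fin.cons p.2 p.1), ψ (Fin.cons p.2 p.1)⟫_ℂ) (volume.prod volume) :=
    (measurePreserving_snoc m).integrable_comp_of_integrable hi
  rw [integral_prod _ hi']
  refine integral_congr_ae ?_
  filter_upwards [Measure.ae_ae_of_ae_prod (coeFn_tensor_cons f χ)] with K hK
  rw [← integral_mul_const]
  refine integral_congr_ae ?_
  filter_upwards [hK] with k hk
  rw [hk]
  simp only [RCLike.inner_apply, map_mul]
  ring

/-- Annihilating a boson is, up to the factor `√(m+1)`, the adjoint of adding one. -/
theorem inner_annihilateSector (f : OneBoson) {m : ℕ} (χ : NBody m) (ψ : Sector (m + 1)) :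
    ⟪χ, (annihilateSector f m ψ : NBody m)⟫_ℂ =
      (√(m + 1 : ℝ) : ℂ) * ⟪tensor f χ, (ψ : NBody (m + 1))⟫_ℂ := by
  rw [inner_tensor, L2.inner_def, ← integral_const_mul]
  refine integral_congr_ae ?_
  filter_upwards [MemLp.coeFn_toLp (annihilateFun_bound f ψ.1).1] with K hK
  have hK' : (annihilateSector f m ψ : NBody m) K = annihilateFun f ψ.1 K := hK
  rw [hK']
  simp only [RCLike.inner_apply, annihilateFun]
  ring

/-- The creation operator from the `m`-boson sector to the `(m+1)`-boson sector,
`ψ ↦ √(m+1) P(f ⊗ ψ)` with `P` the orthogonal projection onto the symmetric functions. -/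
def create (m : ℕ) : OneBoson →L[ℂ] Sector m →L[ℂ] Sector (m + 1) :=
  LinearMap.mkContinuous₂
    (LinearMap.mk₂ ℂ (fun (f : OneBoson) (ψ : Sector m) => (√(m + 1 : ℝ) : ℂ) •
        (Sector (m + 1)).orthogonalProjectionOnto (tensor f (ψ : NBody m)))
      (fun f g ψ => by rw [tensor_add_left, map_add, smul_add])
      (fun z f ψ => by rw [tensor_smul_left, map_smul, smul_comm])
      (fun f ψ φ => by rw [Submodule.coe_add, tensor_add_right, map_add, smul_add])
      (fun z f ψ => by rw [Submodule.coe_smul, tensor_smul_right, map_smul, smul_comm]))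
    √(m + 1 : ℝ) (fun f ψ => by
      rw [LinearMap.mk₂_apply, norm_smul, Complex.norm_real,
        Real.norm_of_nonneg (Real.sqrt_nonneg _),
        mul_assoc]
      gcongr
      refine (Submodule.norm_orthogonalProjectionOnto_apply_le _ _).trans ?_
      rw [norm_tensor]
      rfl)

theorem create_apply (f : OneBoson) {m : ℕ} (ψ : Sector m) :
    create m f ψ = (√(m + 1 : ℝ) : ℂ) •
      (Sector (m + 1)).orthogonalProjectionOnto (tensor f (ψ : NBody m)) := rfl

theorem norm_create_le (m : ℕ) : ‖create m‖ ≤ √(m + 1 : ℝ) :=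
  LinearMap.mkContinuous₂_norm_le _ (Real.sqrt_nonneg _) _

theorem norm_create_apply_le (f : OneBoson) {m : ℕ} (ψ : Sector m) :
    ‖create m f ψ‖ ≤ √(m + 1 : ℝ) * ‖f‖ * ‖ψ‖ :=
  (create m).le_of_opNorm₂_le_of_le (norm_create_le m) le_rfl le_rfl

theorem inner_create_left (f : OneBoson) {m : ℕ} (ψ : Sector m) (φ : Sector (m + 1)) :
    ⟪create m f ψ, φ⟫_ℂ = ⟪ψ, annihilateSector f m φ⟫_ℂ := by
  rw [create_apply, inner_smul_left, Complex.conj_ofReal]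
  have h := inner_annihilateSector f (ψ : NBody m) φ
  rw [Submodule.inner_orthogonalProjectionOnto_eq_of_mem_right φ, Submodule.coe_inner (Sector m), h]

theorem inner_create_right (f : OneBoson) {m : ℕ} (ψ : Sector m) (φ : Sector (m + 1)) :
    ⟪φ, create m f ψ⟫_ℂ = ⟪annihilateSector f m φ, ψ⟫_ℂ := by
  rw [← inner_conj_symm, inner_create_left, inner_conj_symm]

theorem inner_tensor_tensor_swap (f g : OneBoson) {m : ℕ} (χ : NBody m) (ψ : Sector (m + 2)) :
    ⟪tensor f (tensor g χ), (ψ : NBody (m + 2))⟫_ℂ =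
      ⟪tensor g (tensor f χ), (ψ : NBody (m + 2))⟫_ℂ := by
  let σ : Equiv.Perm (Fin (m + 2)) := Equiv.swap 0 1
  let T := Lp.compMeasurePreservingₗᵢ ℂ (E := ℂ) (p := 2)
    (fun K : Fin (m + 2) → Momentum => fun i => K (σ i)) (measurePreserving_perm σ)
  have hT : ∀ η : NBody (m + 2), T η =ᵐ[volume] fun K => η (fun i => K (σ i)) := fun η =>
    Lp.coeFn_compMeasurePreserving η (measurePreserving_perm σ)
  have h1 : T ψ = ψ := Lp.ext ((hT ψ).trans (mem_sector_iff.1 ψ.2 σ))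
  have h2 : T (tensor f (tensor g χ)) = tensor g (tensor f χ) := by
    refine Lp.ext ((hT _).trans ?_)
    have e1 := (coeFn_tensor f (tensor g χ)).and (ae_tail (coeFn_tensor g χ))
    have e2 := (measurePreserving_perm σ).quasiMeasurePreserving.ae e1
    filter_upwards [e2, coeFn_tensor g (tensor f χ), ae_tail (coeFn_tensor f χ)] with K h1 h2 h3
    rw [h1.1, h1.2, h2, h3]
    have a1 : σ 0 = 1 := Equiv.swap_apply_left 0 1
    have a2 : σ 1 = 0 := Equiv.swap_apply_right 0 1
    have a3 : ∀ j : Fin m, σ j.succ.succ = j.succ.succ := fun j =>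
      Equiv.swap_apply_of_ne_of_ne (Fin.succ_ne_zero _)
        (by rw [← Fin.succ_zero_eq_one, Ne, Fin.succ_inj]; exact Fin.succ_ne_zero _)
    have a4 : (Fin.tail (Fin.tail fun i => K (σ i)) : Fin m → Momentum) =
        Fin.tail (Fin.tail K) := funext fun j => congrArg K (a3 j)
    rw [a4]
    simp only [Fin.tail, Fin.succ_zero_eq_one, a1, a2]
    ring
  rw [← h2, ← T.inner_map_map, h1]

theorem annihilateSector_comm (f g : OneBoson) {m : ℕ} (ψ : Sector (m + 2)) :
    annihilateSector f m (annihilateSector g (m + 1) ψ) =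
      annihilateSector g m (annihilateSector f (m + 1) ψ) := by
  refine Subtype.ext (ext_inner_left ℂ fun χ => ?_)
  rw [inner_annihilateSector, inner_annihilateSector, inner_annihilateSector,
    inner_annihilateSector, inner_tensor_tensor_swap]

theorem create_comm (f g : OneBoson) {m : ℕ} (ψ : Sector m) :
    create (m + 1) f (create m g ψ) = create (m + 1) g (create m f ψ) := by
  refine ext_inner_right ℂ fun χ => ?_
  rw [inner_create_left, inner_create_left, inner_create_left, inner_create_left,
    annihilateSector_comm]

/-! ### Product states -/

local instance : Fact ((2 : ENNReal) ≠ ⊤) := ⟨ENNReal.ofNat_ne_top⟩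

theorem coeFn_vacuumWave : ((vacuumWave : Sector 0) : NBody 0) =ᵐ[volume] fun _ => 1 :=
  (indicatorConstLp_coeFn (p := 2) (hs := MeasurableSet.univ)
    (hμs := by rw [volume_fin_zero]; simp)).trans (Filter.Eventually.of_forall fun K => by simp)

theorem norm_vacuumWave : ‖vacuumWave‖ = 1 := by
  have h : ‖(vacuumWave : NBody 0)‖ = 1 := by
    refine (norm_indicatorConstLp (hs := MeasurableSet.univ)
      (hμs := by rw [volume_fin_zero]; simp) (by norm_num) (by norm_num)).trans ?_
    rw [Measure.real, volume_fin_zero]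
    simp
  exact h

theorem exists_eq_smul_vacuumWave (φ : Sector 0) : ∃ c : ℂ, φ = c • vacuumWave := by
  refine ⟨(φ : NBody 0) default, Subtype.ext (Lp.ext ?_)⟩
  filter_upwards [Lp.coeFn_smul ((φ : NBody 0) default) (vacuumWave : NBody 0),
    coeFn_vacuumWave] with K h1 h2
  rw [Submodule.coe_smul, h1, Pi.smul_apply, h2, smul_eq_mul, mul_one, Subsingleton.elim K default]

/-- The product state `h ⊗ ⋯ ⊗ h` of `m` bosons. -/
def rawPow (h : OneBoson) : (m : ℕ) → NBody m
  | 0 => vacuumWave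
  | m + 1 => tensor h (rawPow h m)

theorem coeFn_rawPow (h : OneBoson) (m : ℕ) :
    rawPow h m =ᵐ[volume] fun K => ∏ i, h (K i) := by
  induction m with
  | zero => simpa [rawPow] using coeFn_vacuumWave
  | succ m ih =>
    filter_upwards [coeFn_tensor h (rawPow h m), ae_tail ih] with L h1 h2
    rw [rawPow, h1, h2, Fin.prod_univ_succ]
    rfl

theorem rawPow_mem_sector (h : OneBoson) (m : ℕ) : rawPow h m ∈ Sector m := by
  rw [mem_sector_iff]
  intro σ
  have h1 := (measurePreserving_perm σ).quasiMeasurePreserving.ae_eq_comp (coeFn_rawPow h m)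
  filter_upwards [h1, coeFn_rawPow h m] with K h1 h2
  rw [h2]
  exact h1.trans (Equiv.prod_comp σ fun i => h (K i))

/-- The product state `h ⊗ ⋯ ⊗ h`, as an element of the `m`-boson sector. -/
def tensorPow (h : OneBoson) (m : ℕ) : Sector m := ⟨rawPow h m, rawPow_mem_sector h m⟩

theorem tensorPow_zero (h : OneBoson) : tensorPow h 0 = vacuumWave := rfl

theorem inner_tensorPow (g h : OneBoson) (m : ℕ) :
    ⟪tensorPow g m, tensorPow h m⟫_ℂ = ⟪g, h⟫_ℂ ^ m := by
  induction m with
  | zero =>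
    rw [tensorPow_zero, tensorPow_zero, inner_self_eq_norm_sq_to_K, norm_vacuumWave]
    simp
  | succ m ih =>
    rw [pow_succ', ← ih]
    exact inner_tensor_tensor g h (rawPow g m) (rawPow h m)

theorem norm_tensorPow (h : OneBoson) (m : ℕ) : ‖tensorPow h m‖ = ‖h‖ ^ m := by
  induction m with
  | zero => rw [tensorPow_zero, norm_vacuumWave, pow_zero]
  | succ m ih =>
    rw [pow_succ', ← ih]
    exact norm_tensor h (rawPow h m)

theorem create_tensorPow (h : OneBoson) (m : ℕ) :
    create m h (tensorPow h m) = (√(m + 1 : ℝ) : ℂ) • tensorPow h (m + 1) := by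
  rw [create_apply]
  congr 1
  exact Submodule.orthogonalProjectionOnto_mem_subspace_eq_self (tensorPow h (m + 1))

theorem annihilateSector_tensorPow (f h : OneBoson) (m : ℕ) :
    annihilateSector f m (tensorPow h (m + 1)) =
      ((√(m + 1 : ℝ) : ℂ) * ⟪f, h⟫_ℂ) • tensorPow h m := by
  refine Subtype.ext (ext_inner_left ℂ fun χ => ?_)
  rw [inner_annihilateSector, Submodule.coe_smul, inner_smul_right, mul_assoc]
  congr 1
  exact inner_tensor_tensor f h χ (rawPow h m)

theorem sqrt_succ_ne_zero (m : ℕ) : (√(m + 1 : ℝ) : ℂ) ≠ 0 := by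
  have : √(m + 1 : ℝ) ≠ 0 := by positivity
  exact_mod_cast this

theorem sqrt_succ_mul_self (m : ℕ) : (√(m + 1 : ℝ) : ℂ) * (√(m + 1 : ℝ) : ℂ) = m + 1 := by
  rw [← Complex.ofReal_mul, Real.mul_self_sqrt (by positivity)]
  push_cast
  rfl

theorem tensorPow_succ (h : OneBoson) (m : ℕ) :
    tensorPow h (m + 1) = (√(m + 1 : ℝ) : ℂ)⁻¹ • create m h (tensorPow h m) := by
  rw [create_tensorPow, inv_smul_smul₀ (sqrt_succ_ne_zero m)]

theorem hasDerivAt_add_smul (h f : OneBoson) : HasDerivAt (fun z : ℂ => h + z • f) f 0 := by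
  simpa using ((hasDerivAt_id (0 : ℂ)).smul_const f).const_add h

theorem hasDerivAt_tensorPow (h f : OneBoson) (m : ℕ) :
    HasDerivAt (fun z : ℂ => tensorPow (h + z • f) (m + 1))
      ((√(m + 1 : ℝ) : ℂ) • create m f (tensorPow h m)) 0 := by
  have hc : ∀ m, HasDerivAt (fun z : ℂ => create m (h + z • f)) (create m f) 0 := fun m =>
    (create m).hasFDerivAt.comp_hasDerivAt 0 (hasDerivAt_add_smul h f)
  simp only [tensorPow_succ]
  induction m with
  | zero =>
    have h1 := (hc 0).clm_apply (hasDerivAt_const (0 : ℂ) vacuumWave)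
    simpa [tensorPow_zero] using h1
  | succ m ih =>
    simp only [tensorPow_succ]
    have h1 := ((hc (m + 1)).clm_apply ih).const_smul (√((m + 1 : ℕ) + 1 : ℝ) : ℂ)⁻¹
    refine h1.congr_deriv ?_
    simp only [zero_smul, add_zero]
    rw [map_smul (create (m + 1) h), create_comm h f, create_tensorPow,
      inv_smul_smul₀ (sqrt_succ_ne_zero m), map_smul,
      smul_smul, sqrt_succ_mul_self]
    have h3 : (1 : ℂ) + (m + 1) =
        (√((m + 1 : ℕ) + 1 : ℝ) : ℂ) * (√((m + 1 : ℕ) + 1 : ℝ) : ℂ) := by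
      rw [sqrt_succ_mul_self (m + 1)]
      push_cast
      ring
    have h4 : ∀ x : Sector (m + 2), x + ((m : ℂ) + 1) • x =
        (√((m + 1 : ℕ) + 1 : ℝ) : ℂ) • (√((m + 1 : ℕ) + 1 : ℝ) : ℂ) • x := fun x => by
      rw [smul_smul, ← h3, add_smul (1 : ℂ), one_smul]
    rw [h4]
    exact inv_smul_smul₀ (sqrt_succ_ne_zero (m + 1)) _

/-- A state that all annihilation operators map to zero vanishes. Almost every slice `ψ(·, K)` is
orthogonal to a countable dense set. -/
theorem eq_zero_of_annihilateSector {m : ℕ} {ψ : Sector (m + 1)}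
    (h : ∀ f, annihilateSector f m ψ = 0) : ψ = 0 := by
  have h1 : ∀ n, ∀ᵐ K : Fin m → Momentum,
      ∫ k, (starRingEnd ℂ) (TopologicalSpace.denseSeq OneBoson n k) *
        (ψ : NBody (m + 1)) (Fin.cons k K) = 0 := by
    intro n
    have e := congrArg (fun χ : Sector m => (χ : NBody m))
      (h (TopologicalSpace.denseSeq OneBoson n))
    have e' := MemLp.coeFn_toLp
      (annihilateFun_bound (TopologicalSpace.denseSeq OneBoson n) ψ.1).1
    have e'' : MemLp.toLp _
      (annihilateFun_bound (TopologicalSpace.denseSeq OneBoson n) ψ.1).1 = 0 := e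
    rw [e''] at e'
    filter_upwards [e', Lp.coeFn_zero ℂ 2 (volume : Measure (Fin m → Momentum))] with K h1 h2
    rw [h2] at h1
    exact (mul_eq_zero.1 h1.symm).resolve_left (sqrt_succ_ne_zero m)
  have h2 : ∀ᵐ K : Fin m → Momentum, ∫⁻ k : Momentum,
      ‖(ψ : NBody (m + 1)) (Fin.cons k K)‖ₑ ^ (2 : ℝ) = 0 := by
    filter_upwards [ae_all_iff.2 h1, memLp_slice (ψ : NBody (m + 1))] with K hK hm
    have h3 : (fun f : OneBoson => ⟪f, hm.toLp _⟫_ℂ) = fun _ => 0 := by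
      refine (TopologicalSpace.denseRange_denseSeq OneBoson).equalizer (by fun_prop)
        (by fun_prop) ?_
      funext n
      simp only [Function.comp_apply]
      rw [L2.inner_def, ← hK n]
      refine integral_congr_ae ?_
      filter_upwards [hm.coeFn_toLp] with k hk
      rw [hk, RCLike.inner_apply, mul_comm]
    have h4 : hm.toLp _ = 0 := inner_self_eq_zero.1 (congrFun h3 (hm.toLp _))
    have h5 := (MemLp.toLp_eq_toLp_iff hm (MemLp.zero (ε := ℂ))).1 h4
    rw [← lintegral_zero (μ := (volume : Measure Momentum))]
    refine lintegral_congr_ae ?_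
    filter_upwards [h5] with k hk
    rw [hk]
    simp
  have h3 := lintegral_slice_sq (ψ : NBody (m + 1))
  rw [lintegral_congr_ae h2, lintegral_zero] at h3
  have h4 : eLpNorm (ψ : NBody (m + 1)) 2 volume = 0 := by
    have := h3.symm
    simpa using this
  exact Subtype.ext (Lp.eq_zero_iff_ae_eq_zero.2
    ((eLpNorm_eq_zero_iff (Lp.aestronglyMeasurable _) (by norm_num)).1 h4))

/-- The product states are total: by differentiation, a state orthogonal to all of them is mapped to
such a state by the annihilation operators. -/
theorem isTotal_tensorPow (m : ℕ) : IsTotal fun h => tensorPow h m := by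
  induction m with
  | zero =>
    intro φ hφ
    obtain ⟨c, rfl⟩ := exists_eq_smul_vacuumWave φ
    have : ⟪tensorPow 0 0, c • vacuumWave⟫_ℂ = 0 := hφ 0
    rw [tensorPow_zero, inner_smul_right, inner_self_eq_norm_sq_to_K, norm_vacuumWave] at this
    have hc : c = 0 := by simpa using this
    rw [hc, zero_smul]
  | succ m ih =>
    intro φ hφ
    refine eq_zero_of_annihilateSector fun f => ih _ fun h => ?_
    -- the derivative of `⟪φ, (h + z f)^⊗(m+1)⟫ = 0` at `z = 0`
    have h1 := (innerSL ℂ φ).hasFDerivAt.comp_hasDerivAt 0 (hasDerivAt_tensorPow h f m)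
    have h2 : (fun z : ℂ => innerSL ℂ φ (tensorPow (h + z • f) (m + 1))) = fun _ => 0 := by
      funext z
      rw [innerSL_apply_apply, ← inner_conj_symm]
      simp only [hφ, map_zero]
    have h3 := HasDerivAt.unique (h1.congr_of_eventuallyEq
      (Filter.Eventually.of_forall fun z => (congrFun h2 z).symm)) (hasDerivAt_const 0 0)
    rw [innerSL_apply_apply, inner_smul_right, inner_create_right] at h3
    have h4 := (mul_eq_zero.1 h3).resolve_left (sqrt_succ_ne_zero m)
    rw [← inner_conj_symm, h4, map_zero]

/-- The annihilation operator between sectors as a bounded operator. -/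
def annihilateL (f : OneBoson) (m : ℕ) : Sector (m + 1) →L[ℂ] Sector m :=
  (annihilateSector f m).mkContinuous (√(m + 1 : ℝ) * ‖f‖) (norm_annihilateSector_le f m)

theorem annihilateL_apply (f : OneBoson) {m : ℕ} (ψ : Sector (m + 1)) :
    annihilateL f m ψ = annihilateSector f m ψ := rfl

theorem annihilateSector_create_zero (f g : OneBoson) (ψ : Sector 0) :
    annihilateSector f 0 (create 0 g ψ) = ⟪f, g⟫_ℂ • ψ := by
  obtain ⟨c, rfl⟩ := exists_eq_smul_vacuumWave ψ
  have h := tensorPow_succ g 0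
  have h2 := annihilateSector_tensorPow f g 0
  rw [h] at h2
  simp only [map_smul, tensorPow_zero] at h2 ⊢
  simp only [Nat.cast_zero, zero_add, Real.sqrt_one, Complex.ofReal_one, inv_one, one_smul,
    one_mul] at h2
  rw [h2, smul_comm]

/-- The canonical commutation relation. On product states it is the derivative of
`a(f) (h + zg)^⊗(m+2) = √(m+2) ⟪f, h + zg⟫ (h + zg)^⊗(m+1)` at `z = 0`. -/
theorem annihilateSector_create (f g : OneBoson) {m : ℕ} (ψ : Sector (m + 1)) :
    annihilateSector f (m + 1) (create (m + 1) g ψ) =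
      ⟪f, g⟫_ℂ • ψ + create m g (annihilateSector f m ψ) := by
  have key : (annihilateL f (m + 1)).comp (create (m + 1) g) =
      ⟪f, g⟫_ℂ • ContinuousLinearMap.id ℂ (Sector (m + 1)) +
        (create m g).comp (annihilateL f m) := by
    refine (isTotal_tensorPow (m + 1)).clm_ext fun h => ?_
    have h1 := (annihilateL f (m + 1)).hasFDerivAt.comp_hasDerivAt 0
      (hasDerivAt_tensorPow h g (m + 1))
    have h2 : HasDerivAt (fun z : ℂ => ⟪f, h + z • g⟫_ℂ) ⟪f, g⟫_ℂ 0 :=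
      (innerSL ℂ f).hasFDerivAt.comp_hasDerivAt 0 (hasDerivAt_add_smul h g)
    have h3 := (h2.const_mul (√((m + 1 : ℕ) + 1 : ℝ) : ℂ)).smul (hasDerivAt_tensorPow h g m)
    have h4 := h1.unique (h3.congr_of_eventuallyEq (Filter.Eventually.of_forall fun z =>
      annihilateSector_tensorPow f (h + z • g) (m + 1)))
    simp only [zero_smul, add_zero, map_smul, annihilateL_apply] at h4
    change annihilateSector f (m + 1) (create (m + 1) g (tensorPow h (m + 1))) =
      ⟪f, g⟫_ℂ • tensorPow h (m + 1) + create m g (annihilateSector f m (tensorPow h (m + 1)))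
    rw [annihilateSector_tensorPow, map_smul]
    refine smul_right_injective _ (sqrt_succ_ne_zero (m + 1)) ?_
    simp only
    rw [h4, smul_add, smul_smul, smul_smul, smul_smul]
    refine (add_comm _ _).trans ?_
    congr 2
    ring
  exact DFunLike.congr_fun key ψ

/-! ### Exponential vectors -/

/-! Local shortcuts for the instance search on the Fock space. -/

local instance : NormedAddCommGroup Fock := inferInstance
local instance : InnerProductSpace ℂ Fock := inferInstance
local instance : NormedSpace ℂ Fock := inferInstance
local instance : AddCommGroup Fock := inferInstance
local instance : AddCommMonoid Fock := inferInstance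
local instance : Module ℂ Fock := inferInstance
local instance : SMul ℂ Fock := inferInstance
local instance : TopologicalSpace Fock := inferInstance
local instance : CompleteSpace Fock := inferInstance
local instance : SeminormedAddCommGroup Fock := inferInstance

theorem hasSum_norm_sq (ψ : Fock) : HasSum (fun m => ‖ψ m‖ ^ 2) (‖ψ‖ ^ 2) := by
  simpa using lp.hasSum_norm (p := 2) (by norm_num) ψ

theorem hasSum_inner_fock (φ ψ : Fock) : HasSum (fun m => ⟪φ m, ψ m⟫_ℂ) ⟪φ, ψ⟫_ℂ :=
  lp.hasSum_inner φ ψ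

theorem memℓp_of_summable_sq {ψ : ∀ m, Sector m} (h : Summable fun m => ‖ψ m‖ ^ 2) :
    Memℓp ψ 2 :=
  memℓp_gen (by simpa using h)

/-- The normalization `1 / √m!` of the `m`-boson component of an exponential vector. -/
def expCoeff (m : ℕ) : ℂ := ((√(m.factorial : ℝ))⁻¹ : ℝ)

theorem expCoeff_ne_zero (m : ℕ) : expCoeff m ≠ 0 := by
  exact Complex.ofReal_ne_zero.2 (by positivity)

theorem norm_expCoeff_sq (m : ℕ) : ‖expCoeff m‖ ^ 2 = ((m.factorial : ℝ))⁻¹ := by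
  rw [expCoeff, Complex.norm_real, Real.norm_of_nonneg (by positivity), inv_pow,
    Real.sq_sqrt (by positivity)]

theorem expCoeff_mul_self (m : ℕ) : expCoeff m * expCoeff m = ((m.factorial : ℂ))⁻¹ := by
  rw [expCoeff, ← Complex.ofReal_mul, ← mul_inv, Real.mul_self_sqrt (by positivity)]
  push_cast
  rfl

theorem conj_expCoeff (m : ℕ) : (starRingEnd ℂ) (expCoeff m) = expCoeff m :=
  Complex.conj_ofReal _

theorem expCoeff_succ (m : ℕ) : expCoeff (m + 1) * (√(m + 1 : ℝ) : ℂ) = expCoeff m := by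
  rw [expCoeff, expCoeff, ← Complex.ofReal_mul, Nat.factorial_succ]
  congr 1
  push_cast
  rw [Real.sqrt_mul (by positivity)]
  have : √(m + 1 : ℝ) ≠ 0 := by positivity
  field_simp

theorem norm_expCoeff_smul_tensorPow_sq (h : OneBoson) (m : ℕ) :
    ‖expCoeff m • tensorPow h m‖ ^ 2 = (‖h‖ ^ 2) ^ m / m.factorial := by
  rw [norm_smul, mul_pow, norm_expCoeff_sq, norm_tensorPow, ← pow_mul, ← pow_mul, mul_comm m 2]
  ring

/-- The exponential vector `ε(h) = ∑ h^⊗m / √m!`. -/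
def expVec (h : OneBoson) : Fock :=
  ⟨fun m => expCoeff m • tensorPow h m, memℓp_of_summable_sq <| by
    simp only [norm_expCoeff_smul_tensorPow_sq]
    exact Real.summable_pow_div_factorial _⟩

theorem expVec_apply (h : OneBoson) (m : ℕ) : expVec h m = expCoeff m • tensorPow h m := rfl

theorem inner_expVec (g h : OneBoson) : ⟪expVec g, expVec h⟫_ℂ = Complex.exp ⟪g, h⟫_ℂ := by
  refine (hasSum_inner_fock _ _).unique ?_
  rw [Complex.exp_eq_exp_ℂ]
  refine (NormedSpace.expSeries_div_hasSum_exp ⟪g, h⟫_ℂ).congr_fun fun m => ?_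
  rw [expVec_apply, expVec_apply, inner_smul_left, inner_smul_right, conj_expCoeff, inner_tensorPow,
    ← mul_assoc, expCoeff_mul_self, div_eq_inv_mul]

theorem rawPow_zero_left (m : ℕ) : rawPow 0 (m + 1) = 0 := by
  have h := norm_tensor 0 (rawPow 0 m)
  rw [norm_zero, zero_mul] at h
  exact norm_eq_zero.1 h

theorem expVec_zero : expVec 0 = vacuum := by
  refine lp.ext (funext fun m => ?_)
  rw [expVec_apply, vacuum]
  cases m with
  | zero => rw [lp.single_apply_self, tensorPow_zero]; simp [expCoeff]
  | succ m =>
    rw [lp.single_apply_ne _ _ _ (Nat.succ_ne_zero m)]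
    have : tensorPow 0 (m + 1) = 0 := Subtype.ext (rawPow_zero_left m)
    rw [this, smul_zero]

theorem tensorPow_smul (z : ℂ) (h : OneBoson) (m : ℕ) :
    tensorPow (z • h) m = z ^ m • tensorPow h m := by
  induction m with
  | zero => rw [tensorPow_zero, tensorPow_zero, pow_zero, one_smul]
  | succ m ih =>
    rw [tensorPow_succ, ih, tensorPow_succ, map_smul, map_smul, pow_succ]
    simp only [smul_smul, smul_apply]
    congr 1
    ring

/-- If `φ` is orthogonal to `∑ z^m T_m` for all complex `z`, it is orthogonal to each `T_m`. -/
theorem inner_apply_eq_zero {φ : Fock} {F : ℂ → Fock} {T : ∀ m, Sector m}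
    (hF : ∀ z m, F z m = z ^ m • T m) (h : ∀ z, ⟪F z, φ⟫_ℂ = 0) (m : ℕ) : ⟪T m, φ m⟫_ℂ = 0 := by
  rw [← inner_conj_symm]
  suffices ⟪φ m, T m⟫_ℂ = 0 by rw [this, map_zero]
  refine eq_zero_of_hasSum_pow (b := fun m => ⟪φ m, T m⟫_ℂ) (fun z => ?_) m
  have h1 := hasSum_inner_fock φ (F z)
  rw [← inner_conj_symm, h, map_zero] at h1
  simpa [hF, inner_smul_right] using h1

/-- Replacing `h` by `z • h` separates the numbers of bosons, so that the totality of the product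
states applies. -/
theorem isTotal_expVec : IsTotal expVec := by
  refine fun φ hφ => lp.ext (funext fun m => isTotal_tensorPow m _ fun h => ?_)
  have := inner_apply_eq_zero (φ := φ) (F := fun z => expVec (z • h))
    (T := fun m => expCoeff m • tensorPow h m) (fun z m => by
      rw [expVec_apply, tensorPow_smul, smul_comm]) (fun z => hφ _) m
  rw [inner_smul_left, conj_expCoeff] at this
  exact (mul_eq_zero.1 this).resolve_left (expCoeff_ne_zero m)

/-- The multilinear map `(f₁, …, f_m) ↦ a*(f₁) ⋯ a*(f_m) Ω₀`. -/
def createMulti : (m : ℕ) → ContinuousMultilinearMap ℂ (fun _ : Fin m => OneBoson) (Sector m)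
  | 0 => ContinuousMultilinearMap.constOfIsEmpty ℂ _ vacuumWave
  | m + 1 => ContinuousLinearMap.uncurryLeft
      (((ContinuousLinearMap.compContinuousMultilinearMapL ℂ (fun _ : Fin m => OneBoson)
        (Sector m) (Sector (m + 1))).flip (createMulti m)).comp (create m))

theorem norm_createMulti_le (m : ℕ) : ‖createMulti m‖ ≤ √(m.factorial : ℝ) := by
  induction m with
  | zero =>
    rw [createMulti, ContinuousMultilinearMap.norm_constOfIsEmpty, norm_vacuumWave]
    simp
  | succ m ih =>
    rw [createMulti, ContinuousLinearMap.uncurryLeft_norm]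
    refine ContinuousLinearMap.opNorm_le_bound _ (Real.sqrt_nonneg _) fun f => ?_
    refine (ContinuousLinearMap.norm_compContinuousMultilinearMap_le _ _).trans ?_
    have h1 : ‖create m f‖ ≤ √(m + 1 : ℝ) * ‖f‖ := (create m).le_of_opNorm_le (norm_create_le m) f
    rw [Nat.factorial_succ]
    push_cast
    rw [Real.sqrt_mul (by positivity)]
    calc _ ≤ √(m + 1 : ℝ) * ‖f‖ * √(m.factorial : ℝ) := by gcongr
      _ = _ := by ring

theorem createMulti_diag (h : OneBoson) (m : ℕ) :
    expCoeff m • createMulti m (fun _ => h) = tensorPow h m := by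
  induction m with
  | zero => simp [createMulti, tensorPow_zero, expCoeff]
  | succ m ih =>
    have h1 : createMulti (m + 1) (fun _ => h) = create m h (createMulti m fun _ => h) := rfl
    rw [h1, tensorPow_succ, ← ih, map_smul, smul_smul]
    congr 1
    rw [← expCoeff_succ m, mul_comm, mul_assoc, mul_inv_cancel₀ (sqrt_succ_ne_zero m), mul_one]

/-- The power series of `ε`. -/
def expSeries : FormalMultilinearSeries ℂ OneBoson Fock := fun m =>
  (expCoeff m * expCoeff m) •
    (lp.singleContinuousLinearMap ℂ (fun m => Sector m) 2 m).compContinuousMultilinearMap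
      (createMulti m)

theorem norm_expSeries_le (m : ℕ) : ‖expSeries m‖ ≤ (√(m.factorial : ℝ))⁻¹ := by
  have h1 : ‖lp.singleContinuousLinearMap ℂ (fun m => Sector m) 2 m‖ ≤ 1 :=
    ContinuousLinearMap.opNorm_le_bound _ zero_le_one fun ψ => by
      rw [lp.singleContinuousLinearMap_apply, lp.norm_single (by norm_num), one_mul]
  have h2 := ContinuousLinearMap.norm_compContinuousMultilinearMap_le
    (lp.singleContinuousLinearMap ℂ (fun m => Sector m) 2 m) (createMulti m)
  rw [expSeries, norm_smul, norm_mul, ← pow_two, norm_expCoeff_sq]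
  calc _ ≤ (m.factorial : ℝ)⁻¹ * (1 * √(m.factorial : ℝ)) := by
        gcongr
        exact h2.trans (mul_le_mul h1 (norm_createMulti_le m) (norm_nonneg _) zero_le_one)
    _ = _ := by
      have h3 : √(m.factorial : ℝ) ≠ 0 := by positivity
      have h4 : √(m.factorial : ℝ) * √(m.factorial : ℝ) = m.factorial :=
        Real.mul_self_sqrt (by positivity)
      rw [one_mul]
      nth_rewrite 1 [← h4]
      field_simp

theorem radius_expSeries : expSeries.radius = ⊤ := by
  refine ENNReal.eq_top_of_forall_nnreal_le fun r =>
    expSeries.le_radius_of_bound √(Real.exp ((r : ℝ) ^ 2)) fun m => ?_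
  refine (mul_le_mul_of_nonneg_right (norm_expSeries_le m) (by positivity)).trans ?_
  refine Real.le_sqrt_of_sq_le ?_
  rw [mul_pow, inv_pow, Real.sq_sqrt (by positivity), ← pow_mul, mul_comm m 2, pow_mul,
    ← div_eq_inv_mul]
  exact Real.pow_div_factorial_le_exp _ (by positivity) m

theorem hasFPowerSeriesOnBall_expVec : HasFPowerSeriesOnBall expVec expSeries 0 ⊤ where
  r_le := radius_expSeries.ge
  r_pos := by simp
  hasSum := fun {h} _ => by
    rw [zero_add]
    refine (lp.hasSum_single (by norm_num) (expVec h)).congr_fun fun m => ?_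
    change (expCoeff m * expCoeff m) •
      lp.single (E := fun m => Sector m) 2 m (createMulti m fun _ => h) = _
    rw [expVec_apply, ← createMulti_diag, smul_smul, lp.single_smul]

theorem contDiff_expVec {n : WithTop ℕ∞} : ContDiff ℂ n expVec := by
  refine AnalyticOnNhd.contDiff ?_
  have := hasFPowerSeriesOnBall_expVec.analyticOnNhd
  simpa using this

/-! ### Creation operators and Weyl operators on the Fock space -/

theorem mem_sqrtNumberDomain {ψ : Fock} :
    ψ ∈ sqrtNumberDomain ↔ Summable fun m : ℕ => (m : ℝ) * ‖ψ m‖ ^ 2 := Iff.rfl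

theorem summable_succ_mul_norm_sq {ψ : Fock} (hψ : ψ ∈ sqrtNumberDomain) :
    Summable fun m : ℕ => ((m : ℝ) + 1) * ‖ψ m‖ ^ 2 := by
  simpa [add_mul] using (mem_sqrtNumberDomain.1 hψ).add (hasSum_norm_sq ψ).summable

theorem norm_create_apply_sq_le (f : OneBoson) {m : ℕ} (ψ : Sector m) :
    ‖create m f ψ‖ ^ 2 ≤ ‖f‖ ^ 2 * (((m : ℝ) + 1) * ‖ψ‖ ^ 2) := by
  refine (pow_le_pow_left₀ (norm_nonneg _) (norm_create_apply_le f ψ) 2).trans (le_of_eq ?_)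
  rw [mul_pow, mul_pow, Real.sq_sqrt (by positivity)]
  ring

theorem norm_annihilateSector_sq_le (f : OneBoson) {m : ℕ} (ψ : Sector (m + 1)) :
    ‖annihilateSector f m ψ‖ ^ 2 ≤ ‖f‖ ^ 2 * (((m : ℝ) + 1) * ‖ψ‖ ^ 2) := by
  refine (pow_le_pow_left₀ (norm_nonneg _) (norm_annihilateSector_le f m ψ) 2).trans (le_of_eq ?_)
  rw [mul_pow, mul_pow, Real.sq_sqrt (by positivity)]
  ring

/-- The components of `a*(f)ψ`. -/
def creationFun (f : OneBoson) (ψ : Fock) : ∀ m, Sector m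
  | 0 => 0
  | m + 1 => create m f (ψ m)

/-- The creation operator `a*(f)` on the domain of the square root of the number operator. -/
def creation (f : OneBoson) : sqrtNumberDomain →ₗ[ℂ] Fock where
  toFun ψ := ⟨creationFun f ψ, memℓp_of_summable_sq <| (summable_nat_add_iff 1).1 <|
    Summable.of_nonneg_of_le (fun _ => by positivity)
      (fun m => norm_create_apply_sq_le f ((ψ : Fock) m))
      ((summable_succ_mul_norm_sq ψ.2).mul_left _)⟩
  map_add' ψ φ := lp.ext (funext fun m => by
    cases m with
    | zero => exact (add_zero (0 : Sector 0)).symm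
    | succ m => exact map_add (create m f) _ _)
  map_smul' z ψ := lp.ext (funext fun m => by
    cases m with
    | zero => exact (smul_zero z).symm
    | succ m => exact map_smul (create m f) z _)

theorem creation_zero (f : OneBoson) (ψ : sqrtNumberDomain) : creation f ψ 0 = 0 := rfl

theorem creation_succ (f : OneBoson) (ψ : sqrtNumberDomain) (m : ℕ) :
    creation f ψ (m + 1) = create m f ((ψ : Fock) m) := rfl

theorem annihilation_apply_eq (f : OneBoson) (ψ : sqrtNumberDomain) (m : ℕ) :
    annihilation f ψ m = annihilateSector f m ((ψ : Fock) (m + 1)) := rfl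

theorem inner_creation (f : OneBoson) (ψ φ : sqrtNumberDomain) :
    ⟪creation f ψ, (φ : Fock)⟫_ℂ = ⟪(ψ : Fock), annihilation f φ⟫_ℂ := by
  refine (hasSum_inner_fock _ _).unique ?_
  have h := hasSum_inner_fock (ψ : Fock) (annihilation f φ)
  rw [← hasSum_nat_add_iff' 1]
  simp only [Finset.range_one, Finset.sum_singleton, creation_zero, inner_zero_left, sub_zero]
  refine h.congr_fun fun m => ?_
  rw [creation_succ, annihilation_apply_eq, inner_create_left]

theorem expVec_mem (h : OneBoson) : expVec h ∈ sqrtNumberDomain := by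
  rw [mem_sqrtNumberDomain]
  refine (summable_nat_add_iff 1).1 ?_
  refine ((Real.summable_pow_div_factorial (‖h‖ ^ 2)).mul_left (‖h‖ ^ 2)).congr fun m => ?_
  rw [expVec_apply, norm_expCoeff_smul_tensorPow_sq, Nat.factorial_succ]
  push_cast
  field_simp
  ring

/-- The exponential vector `ε(h)` as an element of the domain of `a(f)` and `a*(f)`. -/
def expVecD (h : OneBoson) : sqrtNumberDomain := ⟨expVec h, expVec_mem h⟩

theorem annihilation_expVec (f h : OneBoson) :
    annihilation f (expVecD h) = ⟪f, h⟫_ℂ • expVec h := by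
  refine lp.ext (funext fun m => ?_)
  rw [annihilation_apply_eq]
  change annihilateSector f m (expCoeff (m + 1) • tensorPow h (m + 1)) =
    ⟪f, h⟫_ℂ • expCoeff m • tensorPow h m
  rw [map_smul, annihilateSector_tensorPow, smul_smul, smul_smul, ← mul_assoc, expCoeff_succ,
    mul_comm]

theorem hasDerivAt_expVec (h f : OneBoson) :
    HasDerivAt (fun z : ℂ => expVec (h + z • f)) (creation f (expVecD h)) 0 := by
  have hd : DifferentiableAt ℂ expVec (h + (0 : ℂ) • f) :=
    (contDiff_expVec (n := 1)).differentiable (by norm_num) _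
  have h1 := hd.hasFDerivAt.comp_hasDerivAt 0 (hasDerivAt_add_smul h f)
  refine h1.congr_deriv (lp.ext (funext fun m => ?_))
  have h2 := (lp.evalCLM ℂ (fun m => Sector m) 2 m).hasFDerivAt.comp_hasDerivAt 0 h1
  cases m with
  | zero =>
    exact h2.unique (hasDerivAt_const (0 : ℂ) (expCoeff 0 • vacuumWave))
  | succ m =>
    have h3 := (hasDerivAt_tensorPow h f m).const_smul (expCoeff (m + 1))
    refine (h2.unique h3).trans ?_
    rw [creation_succ, smul_smul, expCoeff_succ, ← map_smul]
    rfl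

/-- The factor in `W(f) ε(g) = exp(-‖f‖²/2 - ⟪f, g⟫) ε(g + f)`. -/
def weylFactor (f g : OneBoson) : ℂ := Complex.exp (-(⟪f, f⟫_ℂ / 2) - ⟪f, g⟫_ℂ)

theorem weylFactor_ne_zero (f g : OneBoson) : weylFactor f g ≠ 0 := Complex.exp_ne_zero _

theorem exists_weyl (f : OneBoson) :
    ∃ W : Fock ≃ₗᵢ[ℂ] Fock, ∀ g, W (expVec g) = weylFactor f g • expVec (g + f) := by
  refine exists_unitary_of_gram isTotal_expVec (fun φ hφ => isTotal_expVec φ fun g => ?_)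
    fun g g' => ?_
  · have := hφ (g - f)
    rw [inner_smul_left, sub_add_cancel] at this
    exact (mul_eq_zero.1 this).resolve_left
      ((map_ne_zero (starRingEnd ℂ)).2 (weylFactor_ne_zero _ _))
  · rw [inner_smul_left, inner_smul_right, inner_expVec, inner_expVec, weylFactor, weylFactor,
      ← Complex.exp_conj, ← Complex.exp_add, ← Complex.exp_add]
    congr 1
    simp only [inner_add_left, inner_add_right, map_sub, map_neg, map_div₀, inner_conj_symm,
      Complex.conj_ofNat]
    ring

/-- The Weyl operator `W(f)`, which displaces exponential vectors by `f`. -/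
def weyl (f : OneBoson) : Fock ≃ₗᵢ[ℂ] Fock := (exists_weyl f).choose

theorem weyl_expVec (f g : OneBoson) :
    weyl f (expVec g) = weylFactor f g • expVec (g + f) := (exists_weyl f).choose_spec g

theorem unitary_ext {U V : Fock ≃ₗᵢ[ℂ] Fock} (h : ∀ g, U (expVec g) = V (expVec g)) (ψ : Fock) :
    U ψ = V ψ :=
  isTotal_expVec.subset_of_isClosed
    (S := LinearMap.eqLocus U.toLinearEquiv.toLinearMap V.toLinearEquiv.toLinearMap)
    (isClosed_eq U.continuous V.continuous) h ψ

/-- The one-parameter group of Weyl operators with displacements `t f`. -/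
def weylGroup (f : OneBoson) (t : ℝ) : Fock ≃ₗᵢ[ℂ] Fock := weyl ((t : ℂ) • f)

theorem weylGroup_one (f : OneBoson) : weylGroup f 1 = weyl f := by
  rw [weylGroup, Complex.ofReal_one, one_smul]

theorem weylGroup_add (f : OneBoson) (s t : ℝ) (ψ : Fock) :
    weylGroup f (s + t) ψ = weylGroup f s (weylGroup f t ψ) := by
  refine unitary_ext (U := weylGroup f (s + t)) (V := (weylGroup f t).trans (weylGroup f s))
    (fun g => ?_) ψ
  rw [LinearIsometryEquiv.trans_apply]
  simp only [weylGroup, weyl_expVec, map_smul, smul_smul, weylFactor, ← Complex.exp_add]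
  congr 2
  · simp only [inner_smul_left, inner_smul_right, inner_add_right, Complex.conj_ofReal]
    push_cast
    ring
  · push_cast
    rw [add_smul]
    abel

theorem hasDerivAt_weylGroup (f g : OneBoson) :
    HasDerivAt (fun t => weylGroup f t (expVec g))
      (creation f (expVecD g) - annihilation f (expVecD g)) 0 := by
  have h1 : HasDerivAt (fun z : ℂ => -(z * z * ⟪f, f⟫_ℂ / 2) - z * ⟪f, g⟫_ℂ) (-⟪f, g⟫_ℂ) 0 := by
    have h2 : HasDerivAt (fun z : ℂ => z) 1 0 := hasDerivAt_id 0
    simpa using ((((h2.fun_mul h2).mul_const ⟪f, f⟫_ℂ).div_const 2).fun_neg).fun_sub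
      (h2.mul_const ⟪f, g⟫_ℂ)
  have h2 := h1.cexp.fun_smul (hasDerivAt_expVec g f)
  have h3 : HasDerivAt (fun t : ℝ => (t : ℂ)) 1 0 := Complex.ofRealCLM.hasDerivAt
  have h4 := HasDerivAt.scomp_of_eq (0 : ℝ) h2 h3 (by simp)
  simp only [one_smul] at h4
  refine (h4.congr_of_eventuallyEq (Filter.Eventually.of_forall fun t => ?_)).congr_deriv ?_
  · simp only [weylGroup, weyl_expVec, weylFactor, Function.comp_apply, inner_smul_left,
      inner_smul_right, Complex.conj_ofReal]
    congr 2
    ring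
  · rw [annihilation_expVec]
    simp [sub_eq_add_neg]

theorem continuous_weylGroup (f : OneBoson) (ψ : Fock) : Continuous fun t => weylGroup f t ψ := by
  refine isTotal_expVec.subset_of_isClosed (isClosed_continuousVectors (weylGroup f))
    (fun g => ?_) ψ
  have h := mem_generatorGraph (weylGroup_add f) (hasDerivAt_weylGroup f g)
  exact continuous_iff_continuousAt.2 fun t => (h t).continuousAt

/-! ### Field operators -/

/-- The vector `√(𝒩 + 1) ψ`, `𝒩` the number operator. -/
def numberScale (ψ : sqrtNumberDomain) : Fock :=
  ⟨fun m => (√(m + 1 : ℝ) : ℂ) • (ψ : Fock) m, memℓp_of_summable_sq <|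
    (summable_succ_mul_norm_sq ψ.2).congr fun m => by
      rw [norm_smul, Complex.norm_real, Real.norm_of_nonneg (Real.sqrt_nonneg _), mul_pow,
        Real.sq_sqrt (by positivity)]⟩

theorem numberScale_apply (ψ : sqrtNumberDomain) (m : ℕ) :
    numberScale ψ m = (√(m + 1 : ℝ) : ℂ) • (ψ : Fock) m := rfl

theorem hasSum_norm_numberScale_sq (ψ : sqrtNumberDomain) :
    HasSum (fun m : ℕ => ((m : ℝ) + 1) * ‖(ψ : Fock) m‖ ^ 2) (‖numberScale ψ‖ ^ 2) := by
  refine (hasSum_norm_sq (numberScale ψ)).congr_fun fun m => ?_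
  rw [numberScale_apply, norm_smul, Complex.norm_real, Real.norm_of_nonneg (Real.sqrt_nonneg _),
    mul_pow, Real.sq_sqrt (by positivity)]

/-- The bounded operator `(𝒩 + 1)^(-1/2)`, `𝒩` the number operator. -/
def numberUnscale : Fock →L[ℂ] Fock :=
  lp.mapCLM 2 (fun m => (√(m + 1 : ℝ) : ℂ)⁻¹ • ContinuousLinearMap.id ℂ (Sector m)) zero_le_one
    fun m => ContinuousLinearMap.opNorm_le_bound _ zero_le_one fun ψ => by
      rw [smul_apply, ContinuousLinearMap.id_apply, norm_smul, norm_inv,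
        Complex.norm_real, Real.norm_of_nonneg (Real.sqrt_nonneg _)]
      gcongr
      refine inv_le_one_of_one_le₀ (Real.one_le_sqrt.2 ?_)
      linarith [(Nat.cast_nonneg m : (0 : ℝ) ≤ m)]

theorem numberUnscale_apply (ψ : Fock) (m : ℕ) :
    numberUnscale ψ m = (√(m + 1 : ℝ) : ℂ)⁻¹ • ψ m := rfl

theorem numberUnscale_mem (ψ : Fock) : numberUnscale ψ ∈ sqrtNumberDomain := by
  rw [mem_sqrtNumberDomain]
  refine Summable.of_nonneg_of_le (fun m => by positivity) (fun m => ?_)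
    (hasSum_norm_sq ψ).summable
  rw [numberUnscale_apply, norm_smul, norm_inv, Complex.norm_real,
    Real.norm_of_nonneg (Real.sqrt_nonneg _), mul_pow, inv_pow, Real.sq_sqrt (by positivity),
    ← mul_assoc]
  refine mul_le_of_le_one_left (by positivity) ?_
  rw [← div_eq_mul_inv, div_le_one (by positivity)]
  linarith

theorem numberUnscale_numberScale (ψ : sqrtNumberDomain) : numberUnscale (numberScale ψ) = ψ := by
  refine lp.ext (funext fun m => ?_)
  rw [numberUnscale_apply, numberScale_apply, inv_smul_smul₀ (sqrt_succ_ne_zero m)]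

theorem numberScale_numberUnscale (ψ : Fock) :
    numberScale ⟨numberUnscale ψ, numberUnscale_mem ψ⟩ = ψ := by
  refine lp.ext (funext fun m => ?_)
  rw [numberScale_apply]
  change (√(m + 1 : ℝ) : ℂ) • (√(m + 1 : ℝ) : ℂ)⁻¹ • ψ m = ψ m
  rw [smul_inv_smul₀ (sqrt_succ_ne_zero m)]

theorem norm_creation_le (f : OneBoson) (ψ : sqrtNumberDomain) :
    ‖creation f ψ‖ ≤ ‖f‖ * ‖numberScale ψ‖ := by
  refine (pow_le_pow_iff_left₀ (norm_nonneg _) (by positivity) two_ne_zero).1 ?_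
  rw [mul_pow]
  have h := hasSum_norm_sq (creation f ψ)
  rw [← hasSum_nat_add_iff' 1] at h
  simp only [Finset.range_one, Finset.sum_singleton, creation_zero, norm_zero, ne_eq,
    OfNat.ofNat_ne_zero, not_false_eq_true, zero_pow, sub_zero] at h
  exact hasSum_le (fun m => norm_create_apply_sq_le f _) h
    ((hasSum_norm_numberScale_sq ψ).mul_left _)

theorem norm_annihilation_le (f : OneBoson) (ψ : sqrtNumberDomain) :
    ‖annihilation f ψ‖ ≤ ‖f‖ * ‖numberScale ψ‖ := by
  refine (pow_le_pow_iff_left₀ (norm_nonneg _) (by positivity) two_ne_zero).1 ?_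
  rw [mul_pow]
  have h := (hasSum_nat_add_iff' 1).2 (hasSum_norm_numberScale_sq ψ)
  refine (hasSum_le (fun m => ?_) (hasSum_norm_sq (annihilation f ψ))
    (h.mul_left (‖f‖ ^ 2))).trans ?_
  · refine (norm_annihilateSector_sq_le f ((ψ : Fock) (m + 1))).trans ?_
    gcongr
    linarith
  · gcongr
    simp only [Finset.range_one, Finset.sum_singleton, Nat.cast_zero, zero_add, one_mul,
      sub_le_self_iff]
    positivity

theorem isTotal_numberScale_expVec : IsTotal fun g => numberScale (expVecD g) := by
  refine fun φ hφ => lp.ext (funext fun m => isTotal_tensorPow m _ fun h => ?_)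
  have := inner_apply_eq_zero (φ := φ) (F := fun z => numberScale (expVecD (z • h)))
    (T := fun m => (√(m + 1 : ℝ) : ℂ) • expCoeff m • tensorPow h m) (fun z m => by
      rw [numberScale_apply]
      change (√(m + 1 : ℝ) : ℂ) • expCoeff m • tensorPow (z • h) m = _
      rw [tensorPow_smul, smul_comm _ (z ^ m), smul_comm _ (z ^ m)]) (fun z => hφ _) m
  rw [inner_smul_left, inner_smul_left, conj_expCoeff, Complex.conj_ofReal] at this
  exact (mul_eq_zero.1 ((mul_eq_zero.1 this).resolve_left (sqrt_succ_ne_zero m))).resolve_left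
    (expCoeff_ne_zero m)

/-- The span of the exponential vectors is a core for every operator that is bounded relative to
`√(𝒩 + 1)`: a closed set that contains its graph over the exponential vectors contains all of
it. -/
theorem mem_of_forall_expVec {A : sqrtNumberDomain →ₗ[ℂ] Fock} {C : ℝ}
    (hC : ∀ ψ, ‖A ψ‖ ≤ C * ‖numberScale ψ‖) {S : Submodule ℂ (Fock × Fock)}
    (hS : IsClosed (S : Set (Fock × Fock))) (h : ∀ g, (expVec g, A (expVecD g)) ∈ S)
    (ψ : sqrtNumberDomain) : ((ψ : Fock), A ψ) ∈ S := by
  let R : Fock →ₗ[ℂ] sqrtNumberDomain :=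
    numberUnscale.toLinearMap.codRestrict sqrtNumberDomain numberUnscale_mem
  have hR : ∀ ψ, R (numberScale ψ) = ψ := fun ψ => Subtype.ext (numberUnscale_numberScale ψ)
  let AR : Fock →L[ℂ] Fock := (A ∘ₗ R).mkContinuous C fun ψ => by
    refine (hC (R ψ)).trans (le_of_eq ?_)
    rw [show numberScale (R ψ) = ψ from numberScale_numberUnscale ψ]
  let J : Fock →L[ℂ] Fock × Fock := numberUnscale.prod AR
  have hJ : ∀ ψ, J (numberScale ψ) = ((ψ : Fock), A ψ) := fun ψ =>
    Prod.ext (numberUnscale_numberScale ψ) (congrArg A (hR ψ))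
  have := isTotal_numberScale_expVec.subset_of_isClosed (S := S.comap J.toLinearMap)
    (hS.preimage J.continuous) (fun g => by
      change J (numberScale (expVecD g)) ∈ S
      rw [hJ]
      exact h g) (numberScale ψ)
  change J (numberScale ψ) ∈ S at this
  rwa [hJ] at this

theorem annihilateSector_add_left (f g : OneBoson) {m : ℕ} (ψ : Sector (m + 1)) :
    annihilateSector (f + g) m ψ = annihilateSector f m ψ + annihilateSector g m ψ :=
  ext_inner_left ℂ fun χ => by
    rw [inner_add_right, ← inner_create_left, ← inner_create_left, ← inner_create_left, map_add,
      add_apply, inner_add_left]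

theorem annihilateSector_smul_left (z : ℂ) (f : OneBoson) {m : ℕ} (ψ : Sector (m + 1)) :
    annihilateSector (z • f) m ψ = (starRingEnd ℂ) z • annihilateSector f m ψ :=
  ext_inner_left ℂ fun χ => by
    rw [inner_smul_right, ← inner_create_left, ← inner_create_left, map_smul, smul_apply,
      inner_smul_left]

theorem annihilation_add_left (f g : OneBoson) (ψ : sqrtNumberDomain) :
    annihilation (f + g) ψ = annihilation f ψ + annihilation g ψ :=
  lp.ext (funext fun _ => annihilateSector_add_left f g _)

theorem annihilation_smul_left (z : ℂ) (f : OneBoson) (ψ : sqrtNumberDomain) :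
    annihilation (z • f) ψ = (starRingEnd ℂ) z • annihilation f ψ :=
  lp.ext (funext fun _ => annihilateSector_smul_left z f _)

theorem creation_add_left (f g : OneBoson) (ψ : sqrtNumberDomain) :
    creation (f + g) ψ = creation f ψ + creation g ψ :=
  lp.ext (funext fun m => by
    cases m with
    | zero => exact (add_zero (0 : Sector 0)).symm
    | succ m =>
      change create m (f + g) _ = create m f _ + create m g _
      rw [map_add, add_apply])

theorem creation_smul_left (z : ℂ) (f : OneBoson) (ψ : sqrtNumberDomain) :
    creation (z • f) ψ = z • creation f ψ :=
  lp.ext (funext fun m => by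
    cases m with
    | zero => exact (smul_zero z).symm
    | succ m =>
      change create m (z • f) _ = z • create m f _
      rw [map_smul, smul_apply])

theorem dense_sqrtNumberDomain : Dense (sqrtNumberDomain : Set Fock) :=
  isTotal_expVec.dense expVec_mem

open scoped LinearPMap in
theorem mem_adjoint_annihilation (f : OneBoson) (ψ : sqrtNumberDomain) :
    (ψ : Fock) ∈ (annihilation f)†.domain :=
  LinearPMap.mem_adjoint_domain_of_exists _ ⟨creation f ψ, fun φ => inner_creation f ψ φ⟩

open scoped LinearPMap in
theorem adjoint_annihilation_apply (f : OneBoson) (ψ : sqrtNumberDomain) :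
    (annihilation f)† ⟨ψ, mem_adjoint_annihilation f ψ⟩ = creation f ψ :=
  LinearPMap.adjoint_apply_eq (T := annihilation f) dense_sqrtNumberDomain
    ⟨ψ, mem_adjoint_annihilation f ψ⟩ fun φ => inner_creation f ψ φ

theorem domain_segalCore (f : OneBoson) : (segalCore f).domain = sqrtNumberDomain :=
  inf_eq_left.2 fun ψ hψ => mem_adjoint_annihilation f ⟨ψ, hψ⟩

/-- The annihilation operator as a linear map on its domain. -/
def annihilationLin (f : OneBoson) : sqrtNumberDomain →ₗ[ℂ] Fock := (annihilation f).toFun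

/-- The field operator on the domain of the square root of the number operator. -/
def segalFun (f : OneBoson) : sqrtNumberDomain →ₗ[ℂ] Fock :=
  (((√2 : ℝ) : ℂ)⁻¹) • (annihilationLin f + creation f)

theorem segalFun_apply (f : OneBoson) (ψ : sqrtNumberDomain) :
    segalFun f ψ = (((√2 : ℝ) : ℂ)⁻¹) • (annihilation f ψ + creation f ψ) := rfl

theorem segalCore_apply (f : OneBoson) (ψ : sqrtNumberDomain)
    (h : (ψ : Fock) ∈ (segalCore f).domain) :
    segalCore f ⟨ψ, h⟩ = segalFun f ψ := by
  rw [segalFun_apply, ← adjoint_annihilation_apply]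
  rfl

theorem mem_graph_segalCore {f : OneBoson} {p : Fock × Fock} :
    p ∈ (segalCore f).graph ↔ ∃ ψ : sqrtNumberDomain, ((ψ : Fock), segalFun f ψ) = p := by
  rw [LinearPMap.mem_graph_iff]
  constructor
  · rintro ⟨ψ, h1, h2⟩
    have hψ : (ψ : Fock) ∈ sqrtNumberDomain := domain_segalCore f ▸ ψ.2
    exact ⟨⟨ψ, hψ⟩, Prod.ext h1 ((segalCore_apply f ⟨ψ, hψ⟩ ψ.2).symm.trans h2)⟩
  · rintro ⟨ψ, rfl⟩
    have hψ : (ψ : Fock) ∈ (segalCore f).domain := (domain_segalCore f).symm ▸ ψ.2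
    exact ⟨⟨ψ, hψ⟩, rfl, segalCore_apply f ψ hψ⟩

theorem inner_segalFun (f : OneBoson) (ψ φ : sqrtNumberDomain) :
    ⟪segalFun f ψ, (φ : Fock)⟫_ℂ = ⟪(ψ : Fock), segalFun f φ⟫_ℂ := by
  have h : ⟪annihilation f ψ, (φ : Fock)⟫_ℂ = ⟪(ψ : Fock), creation f φ⟫_ℂ := by
    rw [← inner_conj_symm, ← inner_creation, inner_conj_symm]
  rw [segalFun_apply, segalFun_apply, inner_smul_left, inner_smul_right, inner_add_left,
    inner_add_right, inner_creation, h, map_inv₀, Complex.conj_ofReal, add_comm]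

theorem isFormalAdjoint_segalCore (f : OneBoson) : (segalCore f).IsFormalAdjoint (segalCore f) := by
  intro ψ φ
  have hψ : (ψ : Fock) ∈ sqrtNumberDomain := domain_segalCore f ▸ ψ.2
  have hφ : (φ : Fock) ∈ sqrtNumberDomain := domain_segalCore f ▸ φ.2
  have h1 := segalCore_apply f ⟨ψ, hψ⟩ ψ.2
  have h2 := segalCore_apply f ⟨φ, hφ⟩ φ.2
  have h3 := inner_segalFun f ⟨ψ, hψ⟩ ⟨φ, hφ⟩
  rw [← h1, ← h2] at h3
  exact h3

theorem isClosable_segalCore (f : OneBoson) : (segalCore f).IsClosable := by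
  have hd : Dense ((segalCore f).domain : Set Fock) := by
    rw [domain_segalCore]
    exact dense_sqrtNumberDomain
  exact (LinearPMap.adjoint_isClosed hd).isClosable.leIsClosable
    ((isFormalAdjoint_segalCore f).le_adjoint hd)

theorem isFormalAdjoint_segal (f : OneBoson) : (segal f).IsFormalAdjoint (segal f) :=
  isFormalAdjoint_closure (isClosable_segalCore f) (isFormalAdjoint_segalCore f)

theorem isClosed_segal (f : OneBoson) : (segal f).IsClosed :=
  (isClosable_segalCore f).closure_isClosed

theorem graph_segal_le {f : OneBoson} {S : Submodule ℂ (Fock × Fock)}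
    (hS : IsClosed (S : Set (Fock × Fock)))
    (h : ∀ ψ : sqrtNumberDomain, ((ψ : Fock), segalFun f ψ) ∈ S) :
    (segal f).graph ≤ S := by
  rw [segal, ← (isClosable_segalCore f).graph_closure_eq_closure_graph]
  refine Submodule.topologicalClosure_minimal _ (fun p hp => ?_) hS
  obtain ⟨ψ, rfl⟩ := mem_graph_segalCore.1 hp
  exact h ψ

theorem mem_graph_segal (f : OneBoson) (ψ : sqrtNumberDomain) :
    ((ψ : Fock), segalFun f ψ) ∈ (segal f).graph :=
  LinearPMap.le_graph_of_le (LinearPMap.le_closure _) (mem_graph_segalCore.2 ⟨ψ, rfl⟩)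

theorem norm_segalFun_le (f : OneBoson) (ψ : sqrtNumberDomain) :
    ‖segalFun f ψ‖ ≤ 2 * ‖f‖ * ‖numberScale ψ‖ := by
  have h2 : ‖(((√2 : ℝ) : ℂ)⁻¹)‖ ≤ 1 := by
    rw [norm_inv, Complex.norm_real, Real.norm_of_nonneg (Real.sqrt_nonneg _)]
    exact inv_le_one_of_one_le₀ (Real.one_le_sqrt.2 one_le_two)
  rw [segalFun_apply, norm_smul]
  calc _ ≤ 1 * (‖annihilation f ψ‖ + ‖creation f ψ‖) :=
        mul_le_mul h2 (norm_add_le _ _) (norm_nonneg _) zero_le_one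
    _ ≤ _ := by linarith [norm_annihilation_le f ψ, norm_creation_le f ψ]

/-- The displacement `-v/√2` of the Weyl operator `exp(iΦ(iv))`. -/
def displacement (v : OneBoson) : OneBoson := (-((√2 : ℝ) : ℂ)⁻¹) • v

theorem I_smul_segalFun (v : OneBoson) (ψ : sqrtNumberDomain) :
    Complex.I • segalFun (Complex.I • v) ψ =
      creation (displacement v) ψ - annihilation (displacement v) ψ := by
  rw [segalFun_apply, displacement, annihilation_smul_left, annihilation_smul_left,
    creation_smul_left, creation_smul_left, map_neg, map_inv₀, Complex.conj_ofReal, Complex.conj_I]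
  simp only [smul_add, smul_smul, sub_eq_add_neg, ← neg_smul]
  rw [add_comm]
  congr 2
  · linear_combination (((√2 : ℝ) : ℂ)⁻¹) * Complex.I_mul_I
  · linear_combination -(((√2 : ℝ) : ℂ)⁻¹) * Complex.I_mul_I

/-- The Weyl operators are the exponentials of the field operators. -/
theorem isExpI_weyl (v : OneBoson) :
    IsExpI (segal (Complex.I • v)) (weyl (displacement v)) := by
  refine ⟨weylGroup (displacement v), weylGroup_add _, continuous_weylGroup _, fun ψ => ?_,
    (weylGroup_one _).symm⟩
  let L : Fock × Fock →L[ℂ] Fock × Fock :=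
    (ContinuousLinearMap.fst ℂ Fock Fock).prod (Complex.I • ContinuousLinearMap.snd ℂ Fock Fock)
  have hS : IsClosed (((generatorGraph (weylGroup (displacement v))).comap L.toLinearMap :
      Submodule ℂ (Fock × Fock)) : Set (Fock × Fock)) :=
    (isClosed_generatorGraph _).preimage L.continuous
  have h1 := graph_segal_le hS (fun ψ => mem_of_forall_expVec (norm_segalFun_le _) hS (fun g => by
    change (expVec g, Complex.I • segalFun (Complex.I • v) (expVecD g)) ∈ generatorGraph _
    rw [I_smul_segalFun]
    exact mem_generatorGraph (weylGroup_add _) (hasDerivAt_weylGroup _ g)) ψ)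
    ((segal (Complex.I • v)).mem_graph ψ)
  have h2 : HasDerivAt (fun t => weylGroup (displacement v) t ψ)
    (weylGroup (displacement v) 0 (Complex.I • segal (Complex.I • v) ψ)) 0 := h1 0
  have h3 : ∀ φ, weylGroup (displacement v) 0 φ = φ := by
    intro φ
    have := weylGroup_add (displacement v) 0 0 φ
    rw [add_zero] at this
    exact ((weylGroup (displacement v) 0).injective this).symm
  rwa [h3] at h2

/-! ### Multiplication operators -/

section Multiplication

variable {α : Type*} {mα : MeasurableSpace α} {μ : Measure α}

theorem memLp_mul {s : α → ℂ} (hs : Measurable s) {C : ℝ} (hC : ∀ x, ‖s x‖ ≤ C) (f : Lp ℂ 2 μ) :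
    MemLp (fun x => s x * f x) 2 μ :=
  (Lp.memLp f).of_le_mul (hs.aestronglyMeasurable.mul (Lp.aestronglyMeasurable f))
    (Filter.Eventually.of_forall fun x => by
      rw [norm_mul]
      exact mul_le_mul_of_nonneg_right (hC x) (norm_nonneg _))

/-- Multiplication by a bounded measurable function, as a bounded operator on `L²`. -/
def mulL {s : α → ℂ} (hs : Measurable s) {C : ℝ} (hC : ∀ x, ‖s x‖ ≤ C) :
    Lp ℂ 2 μ →L[ℂ] Lp ℂ 2 μ :=
  LinearMap.mkContinuous
    { toFun := fun f => (memLp_mul hs hC f).toLp _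
      map_add' := fun f g => Lp.ext <| by
        filter_upwards [(memLp_mul hs hC (f + g)).coeFn_toLp, (memLp_mul hs hC f).coeFn_toLp,
          (memLp_mul hs hC g).coeFn_toLp, Lp.coeFn_add f g,
          Lp.coeFn_add ((memLp_mul hs hC f).toLp _) ((memLp_mul hs hC g).toLp _)]
          with x h1 h2 h3 h4 h5
        rw [h1, h5, Pi.add_apply, h2, h3, h4, Pi.add_apply, mul_add]
      map_smul' := fun z f => Lp.ext <| by
        filter_upwards [(memLp_mul hs hC (z • f)).coeFn_toLp, (memLp_mul hs hC f).coeFn_toLp,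
          Lp.coeFn_smul z f, Lp.coeFn_smul z ((memLp_mul hs hC f).toLp _)] with x h1 h2 h4 h5
        rw [h1, RingHom.id_apply, h5, Pi.smul_apply, h2, h4, Pi.smul_apply, smul_eq_mul,
          smul_eq_mul, mul_left_comm] }
    C fun f => Lp.norm_le_mul_norm_of_ae_le_mul <| by
      filter_upwards [(memLp_mul hs hC f).coeFn_toLp] with x hx
      refine (congrArg norm hx).le.trans ?_
      rw [norm_mul]
      exact mul_le_mul_of_nonneg_right (hC x) (norm_nonneg _)

theorem coeFn_mulL {s : α → ℂ} (hs : Measurable s) {C : ℝ} (hC : ∀ x, ‖s x‖ ≤ C) (f : Lp ℂ 2 μ) :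
    mulL hs hC f =ᵐ[μ] fun x => s x * f x :=
  (memLp_mul hs hC f).coeFn_toLp

theorem norm_mulL_le {s : α → ℂ} (hs : Measurable s) {C : ℝ} (hC : ∀ x, ‖s x‖ ≤ C)
    (f : Lp ℂ 2 μ) : ‖mulL hs hC f‖ ≤ C * ‖f‖ :=
  Lp.norm_le_mul_norm_of_ae_le_mul <| by
    filter_upwards [coeFn_mulL hs hC f] with x hx
    rw [hx, norm_mul]
    exact mul_le_mul_of_nonneg_right (hC x) (norm_nonneg _)

/-- Multiplication by a real function `s`, possibly unbounded, is a symmetric operation. -/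
theorem inner_mul_left {s : α → ℝ} {f f' g g' : Lp ℂ 2 μ} (hf : f' =ᵐ[μ] fun x => (s x : ℂ) * f x)
    (hg : g' =ᵐ[μ] fun x => (s x : ℂ) * g x) : ⟪f', g⟫_ℂ = ⟪f, g'⟫_ℂ := by
  rw [L2.inner_def, L2.inner_def]
  refine integral_congr_ae ?_
  filter_upwards [hf, hg] with x h1 h2
  rw [h1, h2]
  simp only [RCLike.inner_apply, map_mul, Complex.conj_ofReal]
  ring

theorem inner_mul_self {s : α → ℝ} {f f' : Lp ℂ 2 μ} (hf : f' =ᵐ[μ] fun x => (s x : ℂ) * f x) :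
    Integrable (fun x => s x * ‖f x‖ ^ 2) μ ∧ (⟪f, f'⟫_ℂ).re = ∫ x, s x * ‖f x‖ ^ 2 ∂μ := by
  have h1 : (fun x => ⟪f x, f' x⟫_ℂ) =ᵐ[μ] fun x => ((s x * ‖f x‖ ^ 2 : ℝ) : ℂ) := by
    filter_upwards [hf] with x hx
    rw [hx, RCLike.inner_apply, mul_assoc, Complex.mul_conj, Complex.normSq_eq_norm_sq]
    push_cast
    rfl
  have h2 : Integrable (fun x => s x * ‖f x‖ ^ 2) μ := by
    have := ((L2.integrable_inner (𝕜 := ℂ) f f').congr h1).re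
    simpa only [RCLike.re_to_complex, Complex.ofReal_re] using this
  refine ⟨h2, ?_⟩
  rw [L2.inner_def, integral_congr_ae h1, integral_complex_ofReal]
  exact Complex.ofReal_re _

end Multiplication

/-- Multiplication by a bounded symmetric function on the `m`-boson sector. -/
def mulSector {m : ℕ} {s : (Fin m → Momentum) → ℂ} (hs : Measurable s) {C : ℝ}
    (hC : ∀ K, ‖s K‖ ≤ C) (hσ : ∀ (σ : Equiv.Perm (Fin m)) K, s (fun i => K (σ i)) = s K) :
    Sector m →L[ℂ] Sector m :=
  ((mulL hs hC).comp (Sector m).subtypeL).codRestrict (Sector m) fun ψ => by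
    rw [mem_sector_iff]
    intro σ
    have h1 := (measurePreserving_perm σ).quasiMeasurePreserving.ae_eq_comp
      (coeFn_mulL hs hC (ψ : NBody m))
    filter_upwards [coeFn_mulL hs hC (ψ : NBody m), h1, mem_sector_iff.1 ψ.2 σ] with K h1 h2 h3
    refine h2.trans (Eq.trans ?_ h1.symm)
    simp only [Function.comp_apply] at h3 ⊢
    rw [hσ, h3]

theorem coeFn_mulSector {m : ℕ} {s : (Fin m → Momentum) → ℂ} (hs : Measurable s) {C : ℝ}
    (hC : ∀ K, ‖s K‖ ≤ C) (hσ : ∀ (σ : Equiv.Perm (Fin m)) K, s (fun i => K (σ i)) = s K)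
    (ψ : Sector m) :
    (mulSector hs hC hσ ψ : NBody m) =ᵐ[volume] fun K => s K * (ψ : NBody m) K :=
  coeFn_mulL hs hC (ψ : NBody m)

theorem norm_mulSector_le {m : ℕ} {s : (Fin m → Momentum) → ℂ} (hs : Measurable s) {C : ℝ}
    (hC0 : 0 ≤ C) (hC : ∀ K, ‖s K‖ ≤ C)
    (hσ : ∀ (σ : Equiv.Perm (Fin m)) K, s (fun i => K (σ i)) = s K) :
    ‖mulSector hs hC hσ‖ ≤ C :=
  ContinuousLinearMap.opNorm_le_bound _ hC0 fun ψ => norm_mulL_le hs hC (ψ : NBody m)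

/-! ### The free field -/

/-- The energy `|k₁| + ⋯ + |k_m|` of `m` bosons. -/
def energy {m : ℕ} (K : Fin m → Momentum) : ℝ := ∑ j, ‖K j‖

theorem energy_nonneg {m : ℕ} (K : Fin m → Momentum) : 0 ≤ energy K :=
  Finset.sum_nonneg fun _ _ => norm_nonneg _

theorem energy_perm {m : ℕ} (σ : Equiv.Perm (Fin m)) (K : Fin m → Momentum) :
    energy (fun i => K (σ i)) = energy K :=
  Equiv.sum_comp σ fun i => ‖K i‖

theorem measurable_energy (m : ℕ) : Measurable (energy : (Fin m → Momentum) → ℝ) := by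
  unfold energy
  fun_prop

theorem energy_succ {m : ℕ} (K : Fin (m + 1) → Momentum) :
    energy K = ‖K 0‖ + energy (Fin.tail K) := Fin.sum_univ_succ _

theorem mem_graph_freeField {p : Fock × Fock} :
    p ∈ freeField.graph ↔ ∀ m, (p.2 m : NBody m) =ᵐ[volume]
      fun K => (energy K : ℂ) * (p.1 m : NBody m) K := by
  rw [graph_freeField]
  rfl

theorem freeField_apply_ae (ψ : freeField.domain) (m : ℕ) :
    (freeField ψ m : NBody m) =ᵐ[volume] fun K => (energy K : ℂ) * ((ψ : Fock) m : NBody m) K :=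
  mem_graph_freeField.1 (freeField.mem_graph ψ) m

theorem isFormalAdjoint_freeField : freeField.IsFormalAdjoint freeField := fun ψ φ => by
  have h1 := hasSum_inner_fock (freeField ψ) (φ : Fock)
  have h2 := hasSum_inner_fock (ψ : Fock) (freeField φ)
  refine h1.unique (h2.congr_fun fun m => ?_)
  exact inner_mul_left (freeField_apply_ae ψ m) (freeField_apply_ae φ m)

theorem re_inner_freeField_apply (ψ : freeField.domain) (m : ℕ) :
    Integrable (fun K => energy K * ‖((ψ : Fock) m : NBody m) K‖ ^ 2) volume ∧
      (⟪(ψ : Fock) m, freeField ψ m⟫_ℂ).re =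
        ∫ K, energy K * ‖((ψ : Fock) m : NBody m) K‖ ^ 2 :=
  inner_mul_self (freeField_apply_ae ψ m)

theorem re_inner_freeField_apply_nonneg (ψ : freeField.domain) (m : ℕ) :
    0 ≤ (⟪(ψ : Fock) m, freeField ψ m⟫_ℂ).re := by
  rw [(re_inner_freeField_apply ψ m).2]
  exact integral_nonneg fun K => mul_nonneg (energy_nonneg K) (by positivity)

theorem hasSum_re_inner_freeField (ψ : freeField.domain) :
    HasSum (fun m => (⟪(ψ : Fock) m, freeField ψ m⟫_ℂ).re) (⟪(ψ : Fock), freeField ψ⟫_ℂ).re :=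
  Complex.hasSum_re (hasSum_inner_fock _ _)

theorem re_inner_freeField_nonneg (ψ : freeField.domain) : 0 ≤ (⟪(ψ : Fock), freeField ψ⟫_ℂ).re :=
  (hasSum_re_inner_freeField ψ).nonneg (re_inner_freeField_apply_nonneg ψ)

theorem mul_norm_le_norm_freeField_add (r : ℝ) (ψ : freeField.domain) :
    r * ‖(ψ : Fock)‖ ≤ ‖freeField ψ + (r : ℂ) • (ψ : Fock)‖ := by
  have h1 : r * ‖(ψ : Fock)‖ ^ 2 ≤ (⟪(ψ : Fock), freeField ψ + (r : ℂ) • (ψ : Fock)⟫_ℂ).re := by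
    rw [inner_add_right, inner_smul_right, inner_self_eq_norm_sq_to_K, Complex.add_re]
    have : ((r : ℂ) * ((‖(ψ : Fock)‖ : ℂ)) ^ 2).re = r * ‖(ψ : Fock)‖ ^ 2 := by
      rw [← Complex.ofReal_pow, ← Complex.ofReal_mul, Complex.ofReal_re]
    have h := re_inner_freeField_nonneg ψ
    simp only [Complex.coe_algebraMap]
    rw [this]
    linarith
  have h2 := (Complex.re_le_norm _).trans
    (norm_inner_le_norm (𝕜 := ℂ) (ψ : Fock) (freeField ψ + (r : ℂ) • (ψ : Fock)))
  rcases (norm_nonneg (ψ : Fock)).eq_or_lt with h | h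
  · rw [← h, mul_zero]
    exact norm_nonneg _
  · nlinarith

/-- The resolvent `(H_f + r)⁻¹`, `r > 0`. -/
def freeResolvent {r : ℝ} (hr : 0 < r) : Fock →L[ℂ] Fock :=
  lp.mapCLM 2 (fun m => mulSector (s := fun K : Fin m → Momentum => (((energy K + r)⁻¹ : ℝ) : ℂ))
      (C := r⁻¹) (by have := measurable_energy m; fun_prop) (fun K => by
        have := energy_nonneg K
        rw [Complex.norm_real, Real.norm_of_nonneg (by positivity)]
        gcongr
        linarith) (fun σ K => by rw [energy_perm]))
    (inv_nonneg.2 hr.le) fun m => norm_mulSector_le _ (inv_nonneg.2 hr.le) _ _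

theorem mem_graph_freeResolvent {r : ℝ} (hr : 0 < r) (φ : Fock) :
    (freeResolvent hr φ, φ - (r : ℂ) • freeResolvent hr φ) ∈ freeField.graph := by
  rw [mem_graph_freeField]
  intro m
  have h1 : (freeResolvent hr φ m : NBody m) =ᵐ[volume]
      fun K => (((energy K + r)⁻¹ : ℝ) : ℂ) * (φ m : NBody m) K := coeFn_mulSector _ _ _ _
  have h2 := Lp.coeFn_sub (φ m : NBody m) ((r : ℂ) • (freeResolvent hr φ m : NBody m))
  filter_upwards [h1, h2, Lp.coeFn_smul (r : ℂ) (freeResolvent hr φ m : NBody m)] with K h1 h2 h3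
  refine h2.trans ?_
  rw [Pi.sub_apply, h3, Pi.smul_apply]
  change (φ m : NBody m) K - (r : ℂ) • (freeResolvent hr φ m : NBody m) K =
    (energy K : ℂ) * (freeResolvent hr φ m : NBody m) K
  rw [h1]
  have h4 : (energy K : ℂ) + r ≠ 0 := by
    have := energy_nonneg K
    exact_mod_cast (by positivity : energy K + r ≠ 0)
  push_cast
  rw [smul_eq_mul]
  field_simp
  ring

theorem exists_freeField_add_eq {r : ℝ} (hr : 0 < r) (φ : Fock) :
    ∃ ψ : freeField.domain, freeField ψ + (r : ℂ) • (ψ : Fock) = φ := by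
  obtain ⟨h, e⟩ := exists_apply_of_mem_graph (mem_graph_freeResolvent hr φ)
  exact ⟨⟨_, h⟩, by rw [e, sub_add_cancel]⟩

theorem dense_freeField_domain : Dense (freeField.domain : Set Fock) := by
  rw [Submodule.dense_iff_topologicalClosure_eq_top, Submodule.topologicalClosure_eq_top_iff,
    Submodule.eq_bot_iff]
  intro φ hφ
  obtain ⟨ψ, hψ⟩ := exists_freeField_add_eq one_pos φ
  have h1 := (Submodule.mem_orthogonal _ _).1 hφ _ ψ.2
  have h2 := re_inner_freeField_nonneg ψ
  rw [← hψ, inner_add_right, inner_smul_right, inner_self_eq_norm_sq_to_K] at h1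
  have h3 := congrArg Complex.re h1
  have h4 : (((1 : ℝ) : ℂ) * ((‖(ψ : Fock)‖ : ℂ)) ^ 2).re = ‖(ψ : Fock)‖ ^ 2 := by
    rw [← Complex.ofReal_pow, ← Complex.ofReal_mul, Complex.ofReal_re, one_mul]
  simp only [Complex.coe_algebraMap, Complex.add_re, Complex.zero_re] at h3
  rw [h4] at h3
  have h5 : ‖(ψ : Fock)‖ = 0 := by nlinarith [sq_nonneg ‖(ψ : Fock)‖]
  have h6 : ψ = 0 := Subtype.ext (norm_eq_zero.1 h5)
  rw [← hψ, h6]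
  simp

theorem vacuum_mem_graph : (vacuum, (0 : Fock)) ∈ freeField.graph := by
  rw [mem_graph_freeField]
  intro m
  filter_upwards [Lp.coeFn_zero ℂ 2 (volume : Measure (Fin m → Momentum))] with K hK
  refine hK.trans ?_
  cases m with
  | zero => simp [energy]
  | succ m =>
    have h : vacuum (m + 1) = 0 := lp.single_apply_ne _ _ _ (Nat.succ_ne_zero m)
    have h2 : ((vacuum, (0 : Fock)).1 (m + 1) : NBody (m + 1)) K = 0 := by
      change (vacuum (m + 1) : NBody (m + 1)) K = 0
      rw [h]
      exact hK
    rw [h2, mul_zero, Pi.zero_apply]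

/-- The vacuum spans the kernel of the free field. -/
theorem exists_eq_smul_vacuum {ψ : Fock} (h : (ψ, (0 : Fock)) ∈ freeField.graph) :
    ∃ c : ℂ, ψ = c • vacuum := by
  obtain ⟨c, hc⟩ := exists_eq_smul_vacuumWave (ψ 0)
  refine ⟨c, lp.ext (funext fun m => ?_)⟩
  change ψ m = c • vacuum m
  cases m with
  | zero => rw [hc, vacuum, lp.single_apply_self]
  | succ m =>
    have h2 : vacuum (m + 1) = 0 := lp.single_apply_ne _ _ _ (Nat.succ_ne_zero m)
    rw [h2, smul_zero]
    refine Subtype.ext (Lp.ext ?_)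
    have h3 := mem_graph_freeField.1 h (m + 1)
    have h4 : ∀ᵐ K : Fin (m + 1) → Momentum, K 0 ≠ 0 :=
      ae_head (p := fun k => k ≠ 0) (by
        rw [ae_iff]
        simp)
    filter_upwards [h3, h4, Lp.coeFn_zero ℂ 2 (volume : Measure (Fin (m + 1) → Momentum))]
      with K h3 h4 h5
    have h6 : (0 : ℂ) = (energy K : ℂ) * (ψ (m + 1) : NBody (m + 1)) K := by
      rw [← h3]
      exact h5.symm
    have h7 : 0 < energy K := by
      rw [energy_succ]
      have := energy_nonneg (Fin.tail K)
      have := norm_pos_iff.2 h4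
      linarith
    have h8 := (mul_eq_zero.1 h6.symm).resolve_left (by exact_mod_cast h7.ne')
    exact h8.trans h5.symm

/-! ### Field operators are small relative to the free field -/

theorem integrable_head_energy {m : ℕ} {ψ : Sector (m + 1)}
    (hψ : Integrable (fun K => energy K * ‖(ψ : NBody (m + 1)) K‖ ^ 2)) (j : Fin (m + 1)) :
    Integrable fun K : Fin (m + 1) → Momentum => ‖K j‖ * ‖(ψ : NBody (m + 1)) K‖ ^ 2 := by
  refine hψ.mono' ?_ (Filter.Eventually.of_forall fun K => ?_)
  · have h1 : Measurable fun K : Fin (m + 1) → Momentum => ‖K j‖ := by fun_prop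
    exact h1.aestronglyMeasurable.mul ((Lp.aestronglyMeasurable _).norm.pow 2)
  · rw [Real.norm_of_nonneg (by positivity)]
    gcongr
    exact Finset.single_le_sum (f := fun i => ‖K i‖) (fun i _ => norm_nonneg _) (Finset.mem_univ j)

/-- By symmetry, each boson carries the same share of the energy. -/
theorem integral_energy {m : ℕ} {ψ : Sector (m + 1)}
    (hψ : Integrable (fun K => energy K * ‖(ψ : NBody (m + 1)) K‖ ^ 2)) :
    ∫ K, energy K * ‖(ψ : NBody (m + 1)) K‖ ^ 2 =
      (m + 1) * ∫ K : Fin (m + 1) → Momentum, ‖K 0‖ * ‖(ψ : NBody (m + 1)) K‖ ^ 2 := by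
  have h1 : ∀ j : Fin (m + 1),
      ∫ K : Fin (m + 1) → Momentum, ‖K j‖ * ‖(ψ : NBody (m + 1)) K‖ ^ 2 =
        ∫ K : Fin (m + 1) → Momentum, ‖K 0‖ * ‖(ψ : NBody (m + 1)) K‖ ^ 2 := by
    intro j
    let σ : Equiv.Perm (Fin (m + 1)) := Equiv.swap 0 j
    have h2 := (measurePreserving_perm σ).map_eq
    have h3 := integral_map (measurePreserving_perm σ).measurable.aemeasurable
      (f := fun K : Fin (m + 1) → Momentum => ‖K 0‖ * ‖(ψ : NBody (m + 1)) K‖ ^ 2)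
      (by rw [h2]; exact (integrable_head_energy hψ 0).aestronglyMeasurable)
    rw [h2] at h3
    rw [h3]
    refine integral_congr_ae ?_
    filter_upwards [mem_sector_iff.1 ψ.2 σ] with K hK
    have h4 : σ 0 = j := Equiv.swap_apply_left 0 j
    rw [hK, h4]
  simp only [energy, Finset.sum_mul]
  rw [integral_finsetSum _ fun j _ => integrable_head_energy hψ j, Finset.sum_congr rfl
    fun j _ => h1 j]
  simp

theorem norm_sq_eq_integral {α : Type*} {mα : MeasurableSpace α} {μ : Measure α} (f : Lp ℂ 2 μ) :
    ‖f‖ ^ 2 = ∫ x, ‖f x‖ ^ 2 ∂μ := by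
  have h := (inner_mul_self (s := fun _ => 1) (f := f) (f' := f)
    (Filter.Eventually.of_forall fun x => by simp)).2
  simp only [one_mul] at h
  rw [← h, inner_self_eq_norm_sq_to_K]
  simp [← Complex.ofReal_pow]

/-- The bound `‖a(g)ψ‖² ≤ ‖|k|^(-1/2) g‖² ⟪ψ, H_f ψ⟫` on a sector, with `q = |k|^(-1/2) g`. -/
theorem norm_annihilateSector_sq_le_energy {g q : OneBoson}
    (hgq : g =ᵐ[volume] fun k => (√‖k‖ : ℂ) * q k) {m : ℕ} {ψ : Sector (m + 1)}
    (hψ : Integrable (fun K => energy K * ‖(ψ : NBody (m + 1)) K‖ ^ 2)) :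
    ‖annihilateSector g m ψ‖ ^ 2 ≤
      ‖q‖ ^ 2 * ∫ K, energy K * ‖(ψ : NBody (m + 1)) K‖ ^ 2 := by
  have hs : Measurable fun K : Fin (m + 1) → Momentum => (√‖K 0‖ : ℂ) := by fun_prop
  have hsq : ∀ K : Fin (m + 1) → Momentum,
      ‖(√‖K 0‖ : ℂ) * (ψ : NBody (m + 1)) K‖ ^ 2 = ‖K 0‖ * ‖(ψ : NBody (m + 1)) K‖ ^ 2 := by
    intro K
    rw [norm_mul, Complex.norm_real, Real.norm_of_nonneg (Real.sqrt_nonneg _), mul_pow,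
      Real.sq_sqrt (norm_nonneg _)]
  have hm : MemLp (fun K : Fin (m + 1) → Momentum => (√‖K 0‖ : ℂ) * (ψ : NBody (m + 1)) K) 2
      volume := by
    refine (memLp_two_iff_integrable_sq_norm
      (hs.aestronglyMeasurable.mul (Lp.aestronglyMeasurable _))).2 ?_
    exact (integrable_head_energy hψ 0).congr (Filter.Eventually.of_forall fun K => (hsq K).symm)
  set ψ' : NBody (m + 1) := hm.toLp _ with hψ'
  have h1 : ‖ψ'‖ ^ 2 = ∫ K : Fin (m + 1) → Momentum, ‖K 0‖ * ‖(ψ : NBody (m + 1)) K‖ ^ 2 := by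
    rw [norm_sq_eq_integral]
    refine integral_congr_ae ?_
    filter_upwards [hm.coeFn_toLp] with K hK
    rw [← hsq, ← hK]
  -- the factor `√|k₀|` is moved from `g` to the wave function
  have h2 : ∀ χ : NBody m, ⟪tensor g χ, (ψ : NBody (m + 1))⟫_ℂ = ⟪tensor q χ, ψ'⟫_ℂ := by
    intro χ
    rw [L2.inner_def, L2.inner_def]
    refine integral_congr_ae ?_
    filter_upwards [coeFn_tensor g χ, coeFn_tensor q χ, hm.coeFn_toLp, ae_head hgq]
      with K h1 h2 h3 h4
    rw [h1, h2, h3, h4]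
    simp only [RCLike.inner_apply, map_mul, Complex.conj_ofReal]
    ring
  set A := annihilateSector g m ψ
  have h3 : ‖A‖ ^ 2 ≤ √(m + 1 : ℝ) * (‖q‖ * ‖A‖ * ‖ψ'‖) := by
    have h4 := inner_annihilateSector g (A : NBody m) ψ
    rw [h2] at h4
    have h5 : ‖⟪(A : NBody m), (A : NBody m)⟫_ℂ‖ = ‖A‖ ^ 2 := by
      rw [inner_self_eq_norm_sq_to_K]
      simp
    rw [← h5]
    refine (congrArg norm h4).le.trans ?_
    rw [norm_mul, Complex.norm_real, Real.norm_of_nonneg (Real.sqrt_nonneg _)]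
    gcongr
    refine (norm_inner_le_norm _ _).trans ?_
    rw [norm_tensor]
    rfl
  have h4 : ‖A‖ ≤ √(m + 1 : ℝ) * ‖q‖ * ‖ψ'‖ := by
    rcases (norm_nonneg A).eq_or_lt with h | h
    · rw [← h]
      positivity
    · refine le_of_mul_le_mul_left ?_ h
      linarith
  rw [integral_energy hψ, ← h1]
  refine (pow_le_pow_left₀ (norm_nonneg _) h4 2).trans (le_of_eq ?_)
  rw [mul_pow, mul_pow, Real.sq_sqrt (by positivity)]
  ring

/-- On the domain of both operators, `‖a(g)ψ‖² ≤ ‖|k|^(-1/2) g‖² ⟪ψ, H_f ψ⟫`. -/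
theorem norm_annihilation_sq_le {g q : OneBoson}
    (hgq : g =ᵐ[volume] fun k => (√‖k‖ : ℂ) * q k) (ψ : sqrtNumberDomain) (φ : freeField.domain)
    (h : (ψ : Fock) = φ) :
    ‖annihilation g ψ‖ ^ 2 ≤ ‖q‖ ^ 2 * (⟪(φ : Fock), freeField φ⟫_ℂ).re := by
  have h1 := hasSum_norm_sq (annihilation g ψ)
  have h2 := (hasSum_re_inner_freeField φ).mul_left (‖q‖ ^ 2)
  have h3 := (hasSum_nat_add_iff' 1).2 h2
  refine (hasSum_le (fun m => ?_) h1 h3).trans ?_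
  · rw [annihilation_apply_eq, h, (re_inner_freeField_apply φ (m + 1)).2]
    exact norm_annihilateSector_sq_le_energy hgq (re_inner_freeField_apply φ (m + 1)).1
  · rw [sub_le_self_iff]
    exact Finset.sum_nonneg fun m _ =>
      mul_nonneg (by positivity) (re_inner_freeField_apply_nonneg φ m)

theorem norm_create_sq (g : OneBoson) {m : ℕ} (ψ : Sector (m + 1)) :
    ‖create (m + 1) g ψ‖ ^ 2 = ‖annihilateSector g m ψ‖ ^ 2 + ‖g‖ ^ 2 * ‖ψ‖ ^ 2 := by
  have h := inner_create_left g ψ (create (m + 1) g ψ)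
  rw [annihilateSector_create, inner_add_right, inner_smul_right,
    inner_create_right g (annihilateSector g m ψ) ψ,
    inner_self_eq_norm_sq_to_K, inner_self_eq_norm_sq_to_K, inner_self_eq_norm_sq_to_K,
    inner_self_eq_norm_sq_to_K] at h
  have h' : ‖create (m + 1) g ψ‖ ^ 2 = ‖g‖ ^ 2 * ‖ψ‖ ^ 2 + ‖annihilateSector g m ψ‖ ^ 2 := by
    exact_mod_cast h
  rw [h', add_comm]

theorem norm_create_zero_sq (g : OneBoson) (ψ : Sector 0) :
    ‖create 0 g ψ‖ ^ 2 = ‖g‖ ^ 2 * ‖ψ‖ ^ 2 := by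
  have h := inner_create_left g ψ (create 0 g ψ)
  rw [annihilateSector_create_zero, inner_smul_right, inner_self_eq_norm_sq_to_K,
    inner_self_eq_norm_sq_to_K, inner_self_eq_norm_sq_to_K] at h
  exact_mod_cast h

/-- By the canonical commutation relation, `a(g) a*(g) = a*(g) a(g) + ‖g‖²`. -/
theorem norm_creation_sq (g : OneBoson) (ψ : sqrtNumberDomain) :
    ‖creation g ψ‖ ^ 2 = ‖annihilation g ψ‖ ^ 2 + ‖g‖ ^ 2 * ‖(ψ : Fock)‖ ^ 2 := by
  have h1 := hasSum_norm_sq (creation g ψ)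
  rw [← hasSum_nat_add_iff' 2] at h1
  have h2 := hasSum_norm_sq (annihilation g ψ)
  have h3 := (hasSum_norm_sq (ψ : Fock)).mul_left (‖g‖ ^ 2)
  rw [← hasSum_nat_add_iff' 1] at h3
  have h4 := h2.add h3
  have h5 := h1.unique (h4.congr_fun fun m => norm_create_sq g _)
  simp only [Finset.sum_range_succ, Finset.range_zero, Finset.sum_empty, creation_zero, norm_zero,
    creation_succ, norm_create_zero_sq] at h5
  linarith

/-- `‖Φ(g)ψ‖ ≤ 2 ‖|k|^(-1/2) g‖ (‖ψ‖ ‖H_f ψ‖)^(1/2) + ‖g‖ ‖ψ‖`. -/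
theorem norm_segalFun_le_sqrt {g q : OneBoson}
    (hgq : g =ᵐ[volume] fun k => (√‖k‖ : ℂ) * q k) (ψ : sqrtNumberDomain) (φ : freeField.domain)
    (h : (ψ : Fock) = φ) :
    ‖segalFun g ψ‖ ≤ 2 * ‖q‖ * √(‖(φ : Fock)‖ * ‖freeField φ‖) + ‖g‖ * ‖(φ : Fock)‖ := by
  set s := √(‖(φ : Fock)‖ * ‖freeField φ‖) with hs
  have hs2 : s ^ 2 = ‖(φ : Fock)‖ * ‖freeField φ‖ := Real.sq_sqrt (by positivity)
  have hs0 : 0 ≤ s := Real.sqrt_nonneg _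
  have h1 : ‖annihilation g ψ‖ ≤ ‖q‖ * s := by
    refine (pow_le_pow_iff_left₀ (norm_nonneg _) (by positivity) two_ne_zero).1 ?_
    rw [mul_pow, hs2]
    refine (norm_annihilation_sq_le hgq ψ φ h).trans ?_
    gcongr
    exact (Complex.re_le_norm _).trans (norm_inner_le_norm _ _)
  have h2 : ‖creation g ψ‖ ≤ ‖q‖ * s + ‖g‖ * ‖(φ : Fock)‖ := by
    refine (pow_le_pow_iff_left₀ (norm_nonneg _) (by positivity) two_ne_zero).1 ?_
    rw [norm_creation_sq, h]
    have := pow_le_pow_left₀ (norm_nonneg _) h1 2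
    have h3 : 0 ≤ (‖q‖ * s) * (‖g‖ * ‖(φ : Fock)‖) := by positivity
    nlinarith
  have h3 : ‖(((√2 : ℝ) : ℂ)⁻¹)‖ ≤ 1 := by
    rw [norm_inv, Complex.norm_real, Real.norm_of_nonneg (Real.sqrt_nonneg _)]
    exact inv_le_one_of_one_le₀ (Real.one_le_sqrt.2 one_le_two)
  rw [segalFun_apply, norm_smul]
  calc _ ≤ 1 * (‖annihilation g ψ‖ + ‖creation g ψ‖) :=
        mul_le_mul h3 (norm_add_le _ _) (norm_nonneg _) zero_le_one
    _ ≤ _ := by linarith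

theorem single_mem_sqrtNumberDomain (m : ℕ) (ψ : Sector m) :
    (lp.single 2 m ψ : Fock) ∈ sqrtNumberDomain := by
  rw [mem_sqrtNumberDomain]
  refine summable_of_ne_finset_zero (s := {m}) fun j hj => ?_
  rw [lp.single_apply_ne _ _ _ (by simpa using hj)]
  simp

theorem single_mem_graph_freeField {p : Fock × Fock} (hp : p ∈ freeField.graph) (m : ℕ) :
    ((lp.single 2 m (p.1 m) : Fock), (lp.single 2 m (p.2 m) : Fock)) ∈ freeField.graph := by
  rw [mem_graph_freeField] at hp ⊢
  intro j
  by_cases hj : j = m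
  · subst hj
    simp only [lp.single_apply_self]
    exact hp j
  · simp only [lp.single_apply_ne _ _ _ hj]
    filter_upwards [Lp.coeFn_zero ℂ 2 (volume : Measure (Fin j → Momentum))] with K hK
    have h0 : ((0 : Sector j) : NBody j) K = 0 := hK
    rw [h0, mul_zero]

theorem sqrt_mul_le_add {a b : ℝ} (ha : 0 ≤ a) (hb : 0 ≤ b) : √(a * b) ≤ a + b := by
  rw [Real.sqrt_le_left (by positivity)]
  nlinarith

theorem cauchySeq_of_norm_sub_le {E F G : Type*} [NormedAddCommGroup E] [NormedAddCommGroup F]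
    [NormedAddCommGroup G] {A : ℕ → E} {P : ℕ → F} {Q : ℕ → G} {C : ℝ} (hC0 : 0 ≤ C)
    (h : ∀ M M', ‖A M - A M'‖ ≤ C * (‖P M - P M'‖ + ‖Q M - Q M'‖)) (hP : CauchySeq P)
    (hQ : CauchySeq Q) : CauchySeq A := by
  rw [Metric.cauchySeq_iff] at hP hQ ⊢
  intro ε hε
  obtain ⟨M1, h1⟩ := hP (ε / (2 * (C + 1))) (by positivity)
  obtain ⟨M2, h2⟩ := hQ (ε / (2 * (C + 1))) (by positivity)
  refine ⟨max M1 M2, fun M hM M' hM' => ?_⟩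
  have a1 := h1 M (le_of_max_le_left hM) M' (le_of_max_le_left hM')
  have a2 := h2 M (le_of_max_le_right hM) M' (le_of_max_le_right hM')
  rw [dist_eq_norm] at a1 a2 ⊢
  have c1 : (C + 1) * (2 * (ε / (2 * (C + 1)))) = ε := by field_simp
  calc _ ≤ C * (‖P M - P M'‖ + ‖Q M - Q M'‖) := h M M'
    _ ≤ (C + 1) * (‖P M - P M'‖ + ‖Q M - Q M'‖) := by
      gcongr
      linarith
    _ < (C + 1) * (2 * (ε / (2 * (C + 1)))) := by
      gcongr
      linarith
    _ = ε := c1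

/-- The domain of the free field is contained in that of the field operators `Φ(g)` for which also
`|k|^(-1/2) g` is square integrable. The truncations of `ψ` to finitely many bosons converge in the
graph norm of `Φ(g)`. -/
theorem exists_segal_apply {g q : OneBoson} (hgq : g =ᵐ[volume] fun k => (√‖k‖ : ℂ) * q k)
    (ψ : freeField.domain) :
    ∃ h : (ψ : Fock) ∈ (segal g).domain,
      ‖segal g ⟨ψ, h⟩‖ ≤ 2 * ‖q‖ * √(‖(ψ : Fock)‖ * ‖freeField ψ‖) + ‖g‖ * ‖(ψ : Fock)‖ := by
  let P : ℕ → Fock := fun M => ∑ m ∈ Finset.range M, lp.single 2 m ((ψ : Fock) m)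
  let Q : ℕ → Fock := fun M => ∑ m ∈ Finset.range M, lp.single 2 m (freeField ψ m)
  have hP : Filter.Tendsto P Filter.atTop (nhds (ψ : Fock)) :=
    (lp.hasSum_single (by norm_num) (ψ : Fock)).tendsto_sum_nat
  have hQ : Filter.Tendsto Q Filter.atTop (nhds (freeField ψ)) :=
    (lp.hasSum_single (by norm_num) (freeField ψ)).tendsto_sum_nat
  have hPQ : ∀ M, (P M, Q M) ∈ freeField.graph := by
    intro M
    have : (P M, Q M) = ∑ m ∈ Finset.range M,
        ((lp.single 2 m ((ψ : Fock) m) : Fock), (lp.single 2 m (freeField ψ m) : Fock)) :=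
      Prod.ext (by rw [Prod.fst_sum]) (by rw [Prod.snd_sum])
    rw [this]
    exact Submodule.sum_mem _ fun m _ =>
      single_mem_graph_freeField (p := ((ψ : Fock), freeField ψ)) (freeField.mem_graph ψ) m
  have hPn : ∀ M, P M ∈ sqrtNumberDomain := fun M =>
    Submodule.sum_mem _ fun m _ => single_mem_sqrtNumberDomain m _
  let A : ℕ → Fock := fun M => segalFun g ⟨P M, hPn M⟩
  have hA : ∀ M, ‖A M‖ ≤ 2 * ‖q‖ * √(‖P M‖ * ‖Q M‖) + ‖g‖ * ‖P M‖ := by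
    intro M
    obtain ⟨h, e⟩ := exists_apply_of_mem_graph (hPQ M)
    have := norm_segalFun_le_sqrt hgq ⟨P M, hPn M⟩ ⟨P M, h⟩ rfl
    rwa [e] at this
  have hAsub : ∀ M M', ‖A M - A M'‖ ≤
      (2 * ‖q‖ + ‖g‖) * (‖P M - P M'‖ + ‖Q M - Q M'‖) := by
    intro M M'
    obtain ⟨h, e⟩ := exists_apply_of_mem_graph (freeField.graph.sub_mem (hPQ M) (hPQ M'))
    have h1 := norm_segalFun_le_sqrt hgq (⟨P M, hPn M⟩ - ⟨P M', hPn M'⟩) ⟨P M - P M', h⟩ rfl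
    rw [e, map_sub] at h1
    refine h1.trans ?_
    have h2 := sqrt_mul_le_add (norm_nonneg (P M - P M')) (norm_nonneg (Q M - Q M'))
    have h3 := mul_le_mul_of_nonneg_left h2 (by positivity : 0 ≤ 2 * ‖q‖)
    have h4 : 0 ≤ ‖g‖ * ‖Q M - Q M'‖ := by positivity
    simp only
    linarith
  have hC : CauchySeq A := cauchySeq_of_norm_sub_le (by positivity) hAsub hP.cauchySeq hQ.cauchySeq
  obtain ⟨η, hη⟩ := cauchySeq_tendsto_of_complete hC
  have hg : ((ψ : Fock), η) ∈ (segal g).graph :=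
    IsClosed.mem_of_tendsto (isClosed_segal g) (hP.prodMk_nhds hη)
      (Filter.Eventually.of_forall fun M => mem_graph_segal g ⟨P M, hPn M⟩)
  obtain ⟨hd, hv⟩ := exists_apply_of_mem_graph hg
  refine ⟨hd, ?_⟩
  rw [hv]
  refine le_of_tendsto_of_tendsto' hη.norm ?_ hA
  exact ((((hP.norm.mul hQ.norm).sqrt).const_mul _)).add (hP.norm.const_mul _)

/-! ### The free field on exponential vectors -/

theorem coeFn_energy_tensor {g g₁ : OneBoson} (hg : g₁ =ᵐ[volume] fun k => (‖k‖ : ℂ) * g k) {m : ℕ}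
    {χ χ' : NBody m} (hχ : χ' =ᵐ[volume] fun K => (energy K : ℂ) * χ K) :
    (tensor g₁ χ + tensor g χ' : NBody (m + 1)) =ᵐ[volume]
      fun K => (energy K : ℂ) * tensor g χ K := by
  filter_upwards [Lp.coeFn_add (tensor g₁ χ) (tensor g χ'), coeFn_tensor g₁ χ, coeFn_tensor g χ',
    coeFn_tensor g χ, ae_head hg, ae_tail hχ] with K h1 h2 h3 h4 h5 h6
  rw [h1, Pi.add_apply, h2, h3, h4, h5, h6, energy_succ]
  push_cast
  ring

/-- If the sum of `g₁ ⊗ φ` and `g ⊗ χ` is symmetric, it is `(a*(g₁) φ + a*(g) χ) / √(m+1)`. -/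
theorem smul_eq_create_add {g g₁ : OneBoson} {m : ℕ} {φ χ : Sector m} {T : Sector (m + 1)}
    (hT : (T : NBody (m + 1)) = tensor g₁ (φ : NBody m) + tensor g (χ : NBody m)) :
    (√(m + 1 : ℝ) : ℂ) • T = create m g₁ φ + create m g χ := by
  have h1 : (Sector (m + 1)).orthogonalProjectionOnto (T : NBody (m + 1)) = T :=
    Submodule.orthogonalProjectionOnto_mem_subspace_eq_self T
  have h2 := map_add (Sector (m + 1)).orthogonalProjectionOnto (tensor g₁ (φ : NBody m))
    (tensor g (χ : NBody m))
  rw [← hT, h1] at h2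
  have h3 := congrArg (fun x : Sector (m + 1) => (√(m + 1 : ℝ) : ℂ) • x) h2
  exact h3.trans (smul_add _ _ _)

theorem smul_create_eq_of_add_eq {g g₁ : OneBoson} {m : ℕ} {φ χ : Sector m} {T : Sector (m + 1)}
    (hT : (T : NBody (m + 1)) = tensor g₁ (φ : NBody m) + tensor g (χ : NBody m))
    (hc : create m g χ = (m : ℂ) • create m g₁ φ) :
    (√(m + 1 : ℝ) : ℂ) • create m g₁ φ = T := by
  have key : ∀ x y : Sector (m + 1), (√(m + 1 : ℝ) : ℂ) • y = x + (m : ℂ) • x →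
      (√(m + 1 : ℝ) : ℂ) • x = y := by
    intro x y h
    have h0 := sqrt_succ_ne_zero m
    refine smul_right_injective (Sector (m + 1)) h0 ?_
    have h1 := sqrt_succ_mul_self m
    have h2 : (√(m + 1 : ℝ) : ℂ) • ((√(m + 1 : ℝ) : ℂ) • x) = x + (m : ℂ) • x := by
      have := smul_smul (√(m + 1 : ℝ) : ℂ) (√(m + 1 : ℝ) : ℂ) x
      refine this.trans ?_
      have h3 := congrArg (fun c : ℂ => c • x) h1
      refine h3.trans ?_
      have h4 := add_smul (m : ℂ) 1 x
      refine h4.trans ?_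
      have h5 := one_smul ℂ x
      exact (congrArg _ h5).trans (add_comm _ _)
    exact h2.trans h.symm
  exact key _ _ ((smul_eq_create_add hT).trans (congrArg _ hc))

/-- The energy acts on product states as
`(|k₁| + ⋯ + |k_{m+1}|) g^⊗(m+1) = √(m+1) a*(|k|g) g^⊗m`. -/
theorem coeFn_energy_tensorPow {g g₁ : OneBoson}
    (hg : g₁ =ᵐ[volume] fun k => (‖k‖ : ℂ) * g k) (m : ℕ) :
    (((√(m + 1 : ℝ) : ℂ) • create m g₁ (tensorPow g m) : Sector (m + 1)) : NBody (m + 1))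
      =ᵐ[volume] fun K => (energy K : ℂ) * (tensorPow g (m + 1) : NBody (m + 1)) K := by
  -- one more boson, where `χ` is the product state of `m` bosons times its energy
  have step : ∀ m (χ : Sector m),
      ((χ : NBody m) =ᵐ[volume] fun K => (energy K : ℂ) * (tensorPow g m : NBody m) K) →
      create m g χ = (m : ℂ) • create m g₁ (tensorPow g m) →
      (((√(m + 1 : ℝ) : ℂ) • create m g₁ (tensorPow g m) : Sector (m + 1)) : NBody (m + 1))
        =ᵐ[volume] fun K => (energy K : ℂ) * (tensorPow g (m + 1) : NBody (m + 1)) K := by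
    intro m χ hχ hc
    have h1 := coeFn_energy_tensor hg hχ
    set T : NBody (m + 1) := tensor g₁ (tensorPow g m : NBody m) + tensor g (χ : NBody m) with hT
    have hTs : T ∈ Sector (m + 1) := by
      rw [mem_sector_iff]
      intro σ
      have h2 := (measurePreserving_perm σ).quasiMeasurePreserving.ae_eq_comp h1
      filter_upwards [h1, h2, mem_sector_iff.1 (tensorPow g (m + 1)).2 σ] with K h1 h2 h3
      refine h2.trans (Eq.trans ?_ h1.symm)
      simp only [Function.comp_apply]
      rw [energy_perm]
      exact congrArg _ h3
    have h3 := smul_create_eq_of_add_eq (φ := tensorPow g m) (T := ⟨T, hTs⟩) hT hc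
    rw [h3]
    exact h1
  induction m with
  | zero =>
    refine step 0 0 ?_ (by simp)
    filter_upwards [Lp.coeFn_zero ℂ 2 (volume : Measure (Fin 0 → Momentum))] with K hK
    refine hK.trans ?_
    simp [energy]
  | succ m ih =>
    refine step (m + 1) _ ih ?_
    rw [map_smul, create_comm, create_tensorPow, map_smul, smul_smul, sqrt_succ_mul_self]
    push_cast
    rfl

theorem expVec_mem_graph_freeField {g g₁ : OneBoson}
    (hg : g₁ =ᵐ[volume] fun k => (‖k‖ : ℂ) * g k) :
    (expVec g, creation g₁ (expVecD g)) ∈ freeField.graph := by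
  rw [mem_graph_freeField]
  intro m
  cases m with
  | zero =>
    filter_upwards [Lp.coeFn_zero ℂ 2 (volume : Measure (Fin 0 → Momentum))] with K hK
    refine hK.trans ?_
    simp [energy]
  | succ m =>
    have h1 : creation g₁ (expVecD g) (m + 1) =
        expCoeff (m + 1) • ((√(m + 1 : ℝ) : ℂ) • create m g₁ (tensorPow g m)) := by
      rw [creation_succ, smul_smul, expCoeff_succ, ← map_smul]
      rfl
    have h2 : (creation g₁ (expVecD g) (m + 1) : NBody (m + 1)) =
        expCoeff (m + 1) • (((√(m + 1 : ℝ) : ℂ) • create m g₁ (tensorPow g m) : Sector (m + 1)) :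
          NBody (m + 1)) := congrArg Subtype.val h1
    change (creation g₁ (expVecD g) (m + 1) : NBody (m + 1)) =ᵐ[volume] fun K =>
      (energy K : ℂ) * (expCoeff (m + 1) • (tensorPow g (m + 1) : NBody (m + 1)) : NBody (m + 1)) K
    rw [h2]
    filter_upwards [Lp.coeFn_smul (expCoeff (m + 1))
        (((√(m + 1 : ℝ) : ℂ) • create m g₁ (tensorPow g m) : Sector (m + 1)) : NBody (m + 1)),
      Lp.coeFn_smul (expCoeff (m + 1)) (tensorPow g (m + 1) : NBody (m + 1)),
      coeFn_energy_tensorPow hg m] with K h3 h4 h5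
    rw [h3, h4, Pi.smul_apply, Pi.smul_apply, h5, smul_eq_mul, smul_eq_mul, mul_left_comm]

/-! ### A core of the free field -/

/-- The indicator function of the momenta with `|k| ≤ R`. -/
def cutFun (R : ℕ) : Momentum → ℂ := (Metric.closedBall 0 R).indicator fun _ => 1

theorem measurable_cutFun (R : ℕ) : Measurable (cutFun R) :=
  measurable_const.indicator Metric.isClosed_closedBall.measurableSet

theorem cutFun_of_le {R : ℕ} {k : Momentum} (h : ‖k‖ ≤ R) : cutFun R k = 1 :=
  Set.indicator_of_mem (mem_closedBall_zero_iff.2 h) _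

theorem cutFun_of_lt {R : ℕ} {k : Momentum} (h : (R : ℝ) < ‖k‖) : cutFun R k = 0 :=
  Set.indicator_of_notMem (fun h' => (mem_closedBall_zero_iff.1 h').not_gt h) _

theorem norm_cutFun_le (R : ℕ) (k : Momentum) : ‖cutFun R k‖ ≤ 1 := by
  rcases le_or_gt ‖k‖ (R : ℝ) with h | h
  · rw [cutFun_of_le h, norm_one]
  · rw [cutFun_of_lt h, norm_zero]
    exact zero_le_one

theorem norm_mul_cutFun_le (R : ℕ) (k : Momentum) : ‖(‖k‖ : ℂ) * cutFun R k‖ ≤ R := by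
  rcases le_or_gt ‖k‖ (R : ℝ) with h | h
  · rw [cutFun_of_le h, mul_one, Complex.norm_real, norm_norm]
    exact h
  · rw [cutFun_of_lt h, mul_zero, norm_zero]
    exact Nat.cast_nonneg R

/-- The momentum cutoff `g ↦ 1_{|k| ≤ R} g`. -/
def cut (R : ℕ) : OneBoson →L[ℂ] OneBoson := mulL (measurable_cutFun R) (norm_cutFun_le R)

/-- The map `g ↦ |k| 1_{|k| ≤ R} g`. -/
def energyCut (R : ℕ) : OneBoson →L[ℂ] OneBoson :=
  mulL (s := fun k => (‖k‖ : ℂ) * cutFun R k) (by have := measurable_cutFun R; fun_prop)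
    (norm_mul_cutFun_le R)

theorem coeFn_energyCut (R : ℕ) (g : OneBoson) :
    energyCut R g =ᵐ[volume] fun k => (‖k‖ : ℂ) * cut R g k := by
  filter_upwards [coeFn_mulL (s := fun k => (‖k‖ : ℂ) * cutFun R k)
      (by have := measurable_cutFun R; fun_prop) (norm_mul_cutFun_le R) g,
    coeFn_mulL (measurable_cutFun R) (norm_cutFun_le R) g] with k h1 h2
  refine h1.trans ?_
  rw [mul_assoc]
  exact congrArg _ h2.symm

/-- The function `1 + |k₁| + ⋯ + |k_m|`, cut off to momenta with `|k_j| ≤ R`. -/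
def cutEnergy (R : ℕ) {m : ℕ} (K : Fin m → Momentum) : ℂ :=
  (1 + (energy K : ℂ)) * ∏ i, cutFun R (K i)

theorem measurable_cutEnergy (R m : ℕ) : Measurable (cutEnergy R : (Fin m → Momentum) → ℂ) := by
  have h1 := measurable_energy m
  have h2 := measurable_cutFun R
  unfold cutEnergy
  fun_prop

theorem cutEnergy_perm (R : ℕ) {m : ℕ} (σ : Equiv.Perm (Fin m)) (K : Fin m → Momentum) :
    cutEnergy R (fun i => K (σ i)) = cutEnergy R K := by
  rw [cutEnergy, cutEnergy, energy_perm, Equiv.prod_comp σ fun i => cutFun R (K i)]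

theorem cutEnergy_of_le {R m : ℕ} {K : Fin m → Momentum} (h : ∀ i, ‖K i‖ ≤ R) :
    cutEnergy R K = 1 + energy K := by
  rw [cutEnergy, Finset.prod_eq_one fun i _ => cutFun_of_le (h i), mul_one]

theorem norm_cutEnergy_le (R m : ℕ) (K : Fin m → Momentum) : ‖cutEnergy R K‖ ≤ 1 + m * R := by
  by_cases h : ∀ i, ‖K i‖ ≤ R
  · have h1 : energy K ≤ m * R := by
      refine (Finset.sum_le_card_nsmul _ _ _ fun i _ => h i).trans (le_of_eq ?_)
      simp
    have h2 := energy_nonneg K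
    have h3 : (1 : ℂ) + energy K = ((1 + energy K : ℝ) : ℂ) := by push_cast; rfl
    rw [cutEnergy_of_le h, h3, Complex.norm_real, Real.norm_of_nonneg (by positivity)]
    linarith
  · push Not at h
    obtain ⟨i, hi⟩ := h
    rw [cutEnergy, Finset.prod_eq_zero (Finset.mem_univ i) (cutFun_of_lt hi), mul_zero, norm_zero]
    positivity

/-- Multiplication by `cutEnergy R` on the `m`-boson sector. -/
def cutEnergyL (R m : ℕ) : Sector m →L[ℂ] Sector m :=
  mulSector (measurable_cutEnergy R m) (norm_cutEnergy_le R m) (cutEnergy_perm R)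

theorem coeFn_cutEnergyL (R : ℕ) {m : ℕ} (ψ : Sector m) :
    (cutEnergyL R m ψ : NBody m) =ᵐ[volume] fun K => cutEnergy R K * (ψ : NBody m) K :=
  coeFn_mulSector _ _ _ _

theorem inner_cutEnergyL (R : ℕ) {m : ℕ} (ψ φ : Sector m) :
    ⟪cutEnergyL R m ψ, φ⟫_ℂ = ⟪ψ, cutEnergyL R m φ⟫_ℂ := by
  have hr : ∀ K : Fin m → Momentum, cutEnergy R K = (((cutEnergy R K).re : ℝ) : ℂ) := by
    intro K
    by_cases h : ∀ i, ‖K i‖ ≤ R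
    · rw [cutEnergy_of_le h]
      simp
    · push Not at h
      obtain ⟨i, hi⟩ := h
      rw [cutEnergy, Finset.prod_eq_zero (Finset.mem_univ i) (cutFun_of_lt hi)]
      simp
  refine inner_mul_left (s := fun K => (cutEnergy R K).re)
    (f := (ψ : NBody m)) (g := (φ : NBody m)) ?_ ?_
  · filter_upwards [coeFn_cutEnergyL R ψ] with K hK
    rw [← hr]
    exact hK
  · filter_upwards [coeFn_cutEnergyL R φ] with K hK
    rw [← hr]
    exact hK

theorem coeFn_rawPow_cut (R : ℕ) (g : OneBoson) (m : ℕ) :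
    rawPow (cut R g) m =ᵐ[volume] fun K => (∏ i, cutFun R (K i)) * rawPow g m K := by
  have h : ∀ᵐ K : Fin m → Momentum, ∀ i, cut R g (K i) = cutFun R (K i) * g (K i) := by
    rw [ae_all_iff]
    exact fun i => (Measure.quasiMeasurePreserving_eval
      (fun _ : Fin m => (volume : Measure Momentum)) i).ae
      (p := fun k => cut R g k = cutFun R k * g k)
      (coeFn_mulL (measurable_cutFun R) (norm_cutFun_le R) g)
  filter_upwards [coeFn_rawPow (cut R g) m, coeFn_rawPow g m, h] with K h1 h2 h3
  rw [h1, h2, ← Finset.prod_mul_distrib]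
  exact Finset.prod_congr rfl fun i _ => h3 i

/-- The vector `(H_f + 1) ε(1_{|k| ≤ R} g)`. -/
def coreVec (p : ℕ × OneBoson) : Fock :=
  creation (energyCut p.1 p.2) (expVecD (cut p.1 p.2)) + expVec (cut p.1 p.2)

theorem coreVec_apply (R : ℕ) (g : OneBoson) (m : ℕ) :
    coreVec (R, g) m = expCoeff m • cutEnergyL R m (tensorPow g m) := by
  refine Subtype.ext (Lp.ext ?_)
  have h1 := mem_graph_freeField.1 (expVec_mem_graph_freeField (coeFn_energyCut R g)) m
  filter_upwards [h1, Lp.coeFn_add (creation (energyCut R g) (expVecD (cut R g)) m : NBody m)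
      (expVec (cut R g) m : NBody m),
    Lp.coeFn_smul (expCoeff m) (rawPow (cut R g) m),
    Lp.coeFn_smul (expCoeff m) (cutEnergyL R m (tensorPow g m) : NBody m),
    coeFn_cutEnergyL R (tensorPow g m), coeFn_rawPow_cut R g m] with K h1 h2 h3 h4 h5 h6
  refine h2.trans (Eq.trans ?_ h4.symm)
  rw [Pi.add_apply, Pi.smul_apply, h5, h1]
  change (energy K : ℂ) * (expCoeff m • rawPow (cut R g) m : NBody m) K +
    (expCoeff m • rawPow (cut R g) m : NBody m) K = expCoeff m • (cutEnergy R K * rawPow g m K)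
  rw [h3, Pi.smul_apply, h6, cutEnergy, smul_eq_mul, smul_eq_mul]
  ring

/-- The exponential vectors of the functions with bounded momentum span a core of the free
field. -/
theorem isTotal_coreVec : IsTotal coreVec := by
  refine fun φ hφ => lp.ext (funext fun m => ?_)
  have h1 : ∀ R, cutEnergyL R m (φ m) = 0 := by
    refine fun R => isTotal_tensorPow m _ fun g => ?_
    have := inner_apply_eq_zero (φ := φ) (F := fun z => coreVec (R, z • g))
      (T := fun m => expCoeff m • cutEnergyL R m (tensorPow g m)) (fun z m => by
        rw [coreVec_apply, tensorPow_smul, map_smul, smul_comm]) (fun z => hφ _) m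
    rw [inner_smul_left, conj_expCoeff] at this
    rw [← inner_cutEnergyL]
    exact (mul_eq_zero.1 this).resolve_left (expCoeff_ne_zero m)
  have h2 : ∀ᵐ K : Fin m → Momentum, ∀ R : ℕ, cutEnergy R K * (φ m : NBody m) K = 0 := by
    rw [ae_all_iff]
    intro R
    have h3 := coeFn_cutEnergyL R (φ m)
    rw [h1 R] at h3
    filter_upwards [h3, Lp.coeFn_zero ℂ 2 (volume : Measure (Fin m → Momentum))] with K h3 h4
    rw [← h3]
    exact h4
  refine Subtype.ext (Lp.ext ?_)
  filter_upwards [h2, Lp.coeFn_zero ℂ 2 (volume : Measure (Fin m → Momentum))] with K h2 h4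
  refine Eq.trans ?_ h4.symm
  -- for `R` above the total energy no momentum is cut off
  obtain ⟨R, hR⟩ := exists_nat_ge (energy K)
  have h5 := h2 R
  rw [cutEnergy_of_le fun i => (Finset.single_le_sum (f := fun i => ‖K i‖)
    (fun i _ => norm_nonneg _) (Finset.mem_univ i)).trans hR] at h5
  refine (mul_eq_zero.1 h5).resolve_left ?_
  have := energy_nonneg K
  exact_mod_cast (by positivity : 1 + energy K ≠ 0)

/-! ### The fiber Hamiltonian on the domain of the free field -/

open Filter Topology

theorem isClosed_graph_freeField : IsClosed (freeField.graph : Set (Fock × Fock)) := by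
  have h : IsSelfAdjoint freeField := by
    refine isSelfAdjoint_of_surjective dense_freeField_domain isFormalAdjoint_freeField (-1)
      fun φ => ?_
    obtain ⟨ψ, hψ⟩ := exists_freeField_add_eq one_pos φ
    exact ⟨ψ, by simpa using hψ⟩
  exact h.isClosed

theorem mem_graph_fiberHamiltonian {G : OneBoson} {c : ℝ} {ψ φ χ : Fock}
    (hφ : (ψ, φ) ∈ freeField.graph) (hχ : (ψ, χ) ∈ (segal G).graph) :
    (ψ, (c : ℂ) • ψ + (φ + χ)) ∈ (fiberHamiltonian G c).graph := by
  obtain ⟨h1, rfl⟩ := exists_apply_of_mem_graph hφ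
  obtain ⟨h2, rfl⟩ := exists_apply_of_mem_graph hχ
  exact (fiberHamiltonian G c).mem_graph ⟨ψ, h1, h2⟩

theorem domain_fiberHamiltonian {G q : OneBoson} (hq : G =ᵐ[volume] fun k => (√‖k‖ : ℂ) * q k)
    (c : ℝ) : (fiberHamiltonian G c).domain = freeField.domain :=
  inf_eq_left.2 fun ψ hψ => (exists_segal_apply hq ⟨ψ, hψ⟩).1

theorem fiberHamiltonian_apply {G : OneBoson} {c : ℝ} {ψ : Fock}
    (h : ψ ∈ (fiberHamiltonian G c).domain) :
    fiberHamiltonian G c ⟨ψ, h⟩ =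
      (c : ℂ) • ψ + (freeField ⟨ψ, h.1⟩ + segal G ⟨ψ, h.2⟩) := rfl

theorem isFormalAdjoint_fiberHamiltonian (G : OneBoson) (c : ℝ) :
    (fiberHamiltonian G c).IsFormalAdjoint (fiberHamiltonian G c) := by
  rintro ⟨ψ, hψ⟩ ⟨φ, hφ⟩
  have h1 := isFormalAdjoint_freeField ⟨ψ, hψ.1⟩ ⟨φ, hφ.1⟩
  have h2 := isFormalAdjoint_segal G ⟨ψ, hψ.2⟩ ⟨φ, hφ.2⟩
  simp only at h1 h2
  rw [fiberHamiltonian_apply, fiberHamiltonian_apply, inner_add_left, inner_add_right,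
    inner_add_left, inner_add_right, inner_smul_left, inner_smul_right, Complex.conj_ofReal, h1, h2]

/-- The free field is bounded relative to the fiber Hamiltonian, as the field operator is
infinitesimally small relative to the free field. -/
theorem norm_freeField_le {G q : OneBoson} (hq : G =ᵐ[volume] fun k => (√‖k‖ : ℂ) * q k)
    {c : ℝ} {ψ : Fock} (h : ψ ∈ (fiberHamiltonian G c).domain) :
    ‖freeField ⟨ψ, h.1⟩‖ ≤
      2 * (1 + |c| + ‖G‖ + 2 * ‖q‖ ^ 2) * (‖ψ‖ + ‖fiberHamiltonian G c ⟨ψ, h⟩‖) := by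
  obtain ⟨h', hs⟩ := exists_segal_apply hq ⟨ψ, h.1⟩
  simp only at hs
  set a := ‖ψ‖
  set b := ‖freeField ⟨ψ, h.1⟩‖
  have ha : 0 ≤ a := norm_nonneg _
  have hb : 0 ≤ b := norm_nonneg _
  have h1 : 2 * ‖q‖ * √(a * b) ≤ b / 2 + 2 * ‖q‖ ^ 2 * a := by
    refine abs_le_of_sq_le_sq' ?_ (by positivity) |>.2
    rw [mul_pow, Real.sq_sqrt (by positivity)]
    nlinarith [sq_nonneg (b / 2 - 2 * ‖q‖ ^ 2 * a)]
  have h2 : b ≤ ‖fiberHamiltonian G c ⟨ψ, h⟩‖ + |c| * a + ‖segal G ⟨ψ, h.2⟩‖ := by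
    have e : freeField ⟨ψ, h.1⟩ =
        fiberHamiltonian G c ⟨ψ, h⟩ - (c : ℂ) • ψ - segal G ⟨ψ, h.2⟩ := by
      rw [fiberHamiltonian_apply]
      abel
    have h3 : ‖(c : ℂ) • ψ‖ = |c| * a := by rw [norm_smul, Complex.norm_real, Real.norm_eq_abs]
    rw [← h3]
    refine (congrArg norm e).le.trans ((norm_sub_le _ _).trans ?_)
    gcongr
    exact norm_sub_le _ _
  have h4 := norm_nonneg (fiberHamiltonian G c ⟨ψ, h⟩)
  have h5 : 0 ≤ (|c| + ‖G‖ + 2 * ‖q‖ ^ 2) * ‖fiberHamiltonian G c ⟨ψ, h⟩‖ := by positivity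
  nlinarith

/-- The closedness carries the intertwining relation over from a core to the whole domain. -/
theorem isClosed_graph_fiberHamiltonian {G q : OneBoson}
    (hq : G =ᵐ[volume] fun k => (√‖k‖ : ℂ) * q k) (c : ℝ) :
    IsClosed ((fiberHamiltonian G c).graph : Set (Fock × Fock)) := by
  refine isSeqClosed_iff_isClosed.1 fun p r hp hpr => ?_
  have h1 : Tendsto (fun n => (p n).1) atTop (𝓝 r.1) := (continuous_fst.tendsto r).comp hpr
  have h2 : Tendsto (fun n => (p n).2) atTop (𝓝 r.2) := (continuous_snd.tendsto r).comp hpr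
  choose hd he using fun n => exists_apply_of_mem_graph (hp n)
  have hC : CauchySeq fun n => freeField ⟨(p n).1, (hd n).1⟩ := by
    refine cauchySeq_of_norm_sub_le (C := 2 * (1 + |c| + ‖G‖ + 2 * ‖q‖ ^ 2)) (by positivity)
      (fun M M' => ?_) h1.cauchySeq h2.cauchySeq
    have h3 := norm_freeField_le hq (Submodule.sub_mem _ (hd M) (hd M'))
    have h4 : fiberHamiltonian G c ⟨(p M).1 - (p M').1, Submodule.sub_mem _ (hd M) (hd M')⟩ =
        (p M).2 - (p M').2 := by
      rw [← he M, ← he M']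
      exact LinearPMap.map_sub _ ⟨_, hd M⟩ ⟨_, hd M'⟩
    rw [h4] at h3
    refine le_trans (le_of_eq (congrArg norm ?_)) h3
    exact (LinearPMap.map_sub freeField ⟨_, (hd M).1⟩ ⟨_, (hd M').1⟩).symm
  obtain ⟨a, ha⟩ := cauchySeq_tendsto_of_complete hC
  have h5 : (r.1, a) ∈ freeField.graph :=
    isClosed_graph_freeField.mem_of_tendsto (h1.prodMk_nhds ha)
      (Eventually.of_forall fun n => freeField.mem_graph ⟨_, (hd n).1⟩)
  have h6 : (r.1, r.2 - (c : ℂ) • r.1 - a) ∈ (segal G).graph := by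
    refine (isClosed_segal G).mem_of_tendsto
      (h1.prodMk_nhds ((h2.sub (h1.const_smul (c : ℂ))).sub ha)) (Eventually.of_forall fun n => ?_)
    have h7 := (segal G).mem_graph ⟨_, (hd n).2⟩
    have h8 : segal G ⟨(p n).1, (hd n).2⟩ =
        (p n).2 - (c : ℂ) • (p n).1 - freeField ⟨(p n).1, (hd n).1⟩ := by
      rw [← he n, fiberHamiltonian_apply]
      abel
    rw [h8] at h7
    exact h7
  have h7 := mem_graph_fiberHamiltonian (c := c) h5 h6
  have h8 : (c : ℂ) • r.1 + (a + (r.2 - (c : ℂ) • r.1 - a)) = r.2 := by abel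
  rw [h8] at h7
  exact h7

/-! ### The Weyl operator intertwines the free field and the fiber Hamiltonian -/

/-- The derivative of `W(h) ε(g + zf) = exp(-‖h‖²/2 - ⟪h, g + zf⟫) ε(g + h + zf)` at `z = 0`. -/
theorem weyl_creation (h f g : OneBoson) :
    weyl h (creation f (expVecD g)) =
      weylFactor h g • (creation f (expVecD (g + h)) - ⟪h, f⟫_ℂ • expVec (g + h)) := by
  have h1 : HasDerivAt (fun z : ℂ => weyl h (expVec (g + z • f)))
      (weyl h (creation f (expVecD g))) 0 :=
    (weyl h).toContinuousLinearEquiv.toContinuousLinearMap.hasFDerivAt.comp_hasDerivAt 0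
      (hasDerivAt_expVec g f)
  have h2 : HasDerivAt (fun z : ℂ => weylFactor h (g + z • f)) (weylFactor h g * -⟪h, f⟫_ℂ) 0 := by
    have h3 : HasDerivAt (fun z : ℂ => -(⟪h, h⟫_ℂ / 2) - (⟪h, g⟫_ℂ + z * ⟪h, f⟫_ℂ))
        (-⟪h, f⟫_ℂ) 0 := by
      have h4 : HasDerivAt (fun z : ℂ => z) 1 0 := hasDerivAt_id 0
      simpa using ((h4.mul_const ⟪h, f⟫_ℂ).const_add ⟪h, g⟫_ℂ).const_sub (-(⟪h, h⟫_ℂ / 2))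
    have h5 := h3.cexp
    simp only [zero_mul, add_zero] at h5
    refine h5.congr_of_eventuallyEq (Eventually.of_forall fun z => ?_)
    simp only [weylFactor, inner_add_right, inner_smul_right]
  have h6 := h2.smul (hasDerivAt_expVec (g + h) f)
  have h7 := h1.unique (h6.congr_of_eventuallyEq (Eventually.of_forall fun z => by
    simp only [weyl_expVec, Pi.smul_apply']
    rw [add_right_comm]))
  rw [h7]
  simp only [zero_smul, add_zero]
  rw [smul_sub, sub_eq_add_neg, smul_smul, ← neg_smul, mul_neg]

theorem coeFn_displacement {v G : OneBoson} (hG : G =ᵐ[volume] fun k => (‖k‖ : ℂ) * v k) :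
    displacement G =ᵐ[volume] fun k => (‖k‖ : ℂ) * displacement v k := by
  filter_upwards [hG, Lp.coeFn_smul (-((√2 : ℝ) : ℂ)⁻¹) G, Lp.coeFn_smul (-((√2 : ℝ) : ℂ)⁻¹) v]
    with k h1 h2 h3
  rw [displacement, displacement, h2, h3, Pi.smul_apply, Pi.smul_apply, h1, smul_eq_mul,
    smul_eq_mul, mul_left_comm]

theorem segalFun_expVec (G g : OneBoson) :
    segalFun G (expVecD g) =
      -(⟪displacement G, g⟫_ℂ • expVec g + creation (displacement G) (expVecD g)) := by
  rw [segalFun_apply, annihilation_expVec, displacement, creation_smul_left, inner_smul_left,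
    map_neg, map_inv₀, Complex.conj_ofReal, smul_add, smul_smul, neg_mul, neg_smul, neg_smul,
    ← neg_add, neg_neg]

/-- The relation `H₀ W(h) ε(g) = W(h) (H_f + E) ε(g)` with `h = -v/√2`, in the form of graphs: the
mixed terms cancel because `⟪|k| h, g⟫ = ⟪h, |k| g⟫`. -/
theorem weyl_expVec_mem_graph {v G : OneBoson} (hG : G =ᵐ[volume] fun k => (‖k‖ : ℂ) * v k)
    {c E : ℝ} (hE : (E : ℂ) = c - ⟪displacement G, displacement v⟫_ℂ) {g g₁ : OneBoson}
    (hg : g₁ =ᵐ[volume] fun k => (‖k‖ : ℂ) * g k) :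
    (weyl (displacement v) (expVec g),
      weyl (displacement v) (creation g₁ (expVecD g) + (E : ℂ) • expVec g)) ∈
        (fiberHamiltonian G c).graph := by
  set h := displacement v with hh
  set h₁ := displacement G with hh1
  have e1 : h₁ =ᵐ[volume] fun k => (‖k‖ : ℂ) * h k := coeFn_displacement hG
  have e2 : (g₁ + h₁ : OneBoson) =ᵐ[volume] fun k => (‖k‖ : ℂ) * (g + h : OneBoson) k := by
    filter_upwards [hg, e1, Lp.coeFn_add g₁ h₁, Lp.coeFn_add g h] with k a1 a2 a3 a4
    rw [a3, a4, Pi.add_apply, Pi.add_apply, a1, a2, mul_add]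
  have h1 := mem_graph_fiberHamiltonian (c := c) (expVec_mem_graph_freeField e2)
    (mem_graph_segal G (expVecD (g + h)))
  have h2 := Submodule.smul_mem _ (weylFactor h g) h1
  have e3 : ⟪h₁, g⟫_ℂ = ⟪h, g₁⟫_ℂ := inner_mul_left e1 hg
  convert h2 using 2
  · exact weyl_expVec h g
  · simp only [Prod.smul_snd]
    rw [map_add, map_smul, weyl_creation, weyl_expVec, segalFun_expVec, creation_add_left, hE,
      ← hh1, inner_add_right, e3, smul_comm _ (weylFactor h g), ← smul_add]
    congr 1
    simp only [sub_smul, add_smul]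
    abel

/-- The map `ψ ↦ (R ψ, ψ + (E - 1) R ψ)` onto the graph of `H_f + E`, where `R = (H_f + 1)⁻¹`. It
turns the closedness of the graph of `H₀` into that of a subspace of the Fock space. -/
def resolventPair (E : ℝ) : Fock →L[ℂ] Fock × Fock :=
  (freeResolvent one_pos).prod
    (ContinuousLinearMap.id ℂ Fock + ((E : ℂ) - 1) • freeResolvent one_pos)

theorem freeResolvent_of_mem_graph {ψ φ : Fock} (h : (ψ, φ) ∈ freeField.graph) :
    freeResolvent one_pos (φ + ψ) = ψ := by
  have h1 := Submodule.sub_mem _ (mem_graph_freeResolvent one_pos (φ + ψ)) h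
  obtain ⟨h2, h3⟩ := exists_apply_of_mem_graph h1
  have h4 := mul_norm_le_norm_freeField_add 1 ⟨_, h2⟩
  rw [h3] at h4
  simp only [Complex.ofReal_one, one_smul] at h4
  have h5 : φ + ψ - freeResolvent one_pos (φ + ψ) - φ +
      (freeResolvent one_pos (φ + ψ) - ψ) = 0 := by
    abel
  rw [h5, norm_zero, one_mul] at h4
  exact sub_eq_zero.1 (norm_le_zero_iff.1 h4)

/-- On all of the domain of the free field, `H₀ U = U (H_f + E)`. -/
theorem weyl_mem_graph {v G q : OneBoson} (hG : G =ᵐ[volume] fun k => (‖k‖ : ℂ) * v k)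
    (hq : G =ᵐ[volume] fun k => (√‖k‖ : ℂ) * q k)
    {c E : ℝ} (hE : (E : ℂ) = c - ⟪displacement G, displacement v⟫_ℂ) {ψ φ : Fock}
    (h : (ψ, φ) ∈ freeField.graph) :
    (weyl (displacement v) ψ, weyl (displacement v) (φ + (E : ℂ) • ψ)) ∈
      (fiberHamiltonian G c).graph := by
  let U : Fock →L[ℂ] Fock := (weyl (displacement v)).toContinuousLinearEquiv.toContinuousLinearMap
  let T : Fock →L[ℂ] Fock × Fock := (U.prodMap U).comp (resolventPair E)
  have hT : ∀ ψ φ, (ψ, φ) ∈ freeField.graph → T (φ + ψ) = (U ψ, U (φ + (E : ℂ) • ψ)) := by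
    intro ψ φ h
    have h1 := freeResolvent_of_mem_graph h
    have h2 : resolventPair E (φ + ψ) = (ψ, φ + (E : ℂ) • ψ) := by
      change (freeResolvent one_pos (φ + ψ),
        φ + ψ + ((E : ℂ) - 1) • freeResolvent one_pos (φ + ψ)) = _
      rw [h1, sub_smul, one_smul]
      congr 1
      abel
    change (U.prodMap U) (resolventPair E (φ + ψ)) = _
    rw [h2]
    rfl
  have hS : IsClosed (((fiberHamiltonian G c).graph.comap T.toLinearMap : Submodule ℂ Fock) :
      Set Fock) :=
    (isClosed_graph_fiberHamiltonian hq c).preimage T.continuous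
  have h1 := isTotal_coreVec.subset_of_isClosed hS (fun p => by
    have h2 := expVec_mem_graph_freeField (coeFn_energyCut p.1 p.2)
    change T (coreVec p) ∈ (fiberHamiltonian G c).graph
    rw [coreVec, hT _ _ h2]
    exact weyl_expVec_mem_graph hG hE (coeFn_energyCut p.1 p.2)) (φ + ψ)
  have h2 : T (φ + ψ) ∈ (fiberHamiltonian G c).graph := h1
  rw [hT _ _ h] at h2
  exact h2

/-! ### Self-adjointness and ground state of the fiber Hamiltonian -/

section Fiber

variable {v G q : OneBoson} {c E : ℝ}

/-- For `r < E` the operator `H₀ - r` is onto, and the solution of `(H₀ - r) ψ = φ` is found in the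
image of the domain of the free field under the Weyl operator. -/
theorem exists_fiberHamiltonian_sub_eq (hG : G =ᵐ[volume] fun k => (‖k‖ : ℂ) * v k)
    (hq : G =ᵐ[volume] fun k => (√‖k‖ : ℂ) * q k)
    (hE : (E : ℂ) = c - ⟪displacement G, displacement v⟫_ℂ) {r : ℝ} (hr : r < E) (φ : Fock) :
    ∃ χ : freeField.domain, ∃ ψ : (fiberHamiltonian G c).domain,
      (ψ : Fock) = weyl (displacement v) χ ∧
      fiberHamiltonian G c ψ = weyl (displacement v) (freeField χ + (E : ℂ) • (χ : Fock)) ∧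
      fiberHamiltonian G c ψ - (r : ℂ) • (ψ : Fock) = φ := by
  obtain ⟨χ, hχ⟩ := exists_freeField_add_eq (sub_pos.2 hr) ((weyl (displacement v)).symm φ)
  obtain ⟨h1, h2⟩ := exists_apply_of_mem_graph (weyl_mem_graph hG hq hE (freeField.mem_graph χ))
  refine ⟨χ, ⟨_, h1⟩, rfl, h2, ?_⟩
  rw [h2, ← map_smul, ← map_sub, ← (weyl (displacement v)).apply_symm_apply φ, ← hχ]
  congr 1
  rw [Complex.ofReal_sub, sub_smul]
  abel

theorem isSelfAdjoint_fiberHamiltonian (hG : G =ᵐ[volume] fun k => (‖k‖ : ℂ) * v k)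
    (hq : G =ᵐ[volume] fun k => (√‖k‖ : ℂ) * q k)
    (hE : (E : ℂ) = c - ⟪displacement G, displacement v⟫_ℂ) :
    IsSelfAdjoint (fiberHamiltonian G c) := by
  refine isSelfAdjoint_of_surjective ?_ (isFormalAdjoint_fiberHamiltonian G c) (E - 1) fun φ => ?_
  · rw [domain_fiberHamiltonian hq]
    exact dense_freeField_domain
  · obtain ⟨-, ψ, -, -, h⟩ := exists_fiberHamiltonian_sub_eq hG hq hE (sub_one_lt E) φ
    exact ⟨ψ, h⟩

/-- The Weyl operator maps the domain of the free field onto the domain of `H₀`. -/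
theorem exists_weyl_eq (hG : G =ᵐ[volume] fun k => (‖k‖ : ℂ) * v k)
    (hq : G =ᵐ[volume] fun k => (√‖k‖ : ℂ) * q k)
    (hE : (E : ℂ) = c - ⟪displacement G, displacement v⟫_ℂ)
    (ψ : (fiberHamiltonian G c).domain) :
    ∃ χ : freeField.domain, (ψ : Fock) = weyl (displacement v) χ ∧
      fiberHamiltonian G c ψ = weyl (displacement v) (freeField χ + (E : ℂ) • (χ : Fock)) := by
  obtain ⟨χ, ψ', h1, h2, h3⟩ := exists_fiberHamiltonian_sub_eq hG hq hE (sub_one_lt E)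
    (fiberHamiltonian G c ψ - ((E - 1 : ℝ) : ℂ) • (ψ : Fock))
  -- a solution of `(H₀ - r) η = 0` is orthogonal to the range of `H₀ - r`, which is everything
  have h4 : ((ψ' - ψ : (fiberHamiltonian G c).domain) : Fock) = 0 := by
    obtain ⟨-, η, -, -, h5⟩ := exists_fiberHamiltonian_sub_eq hG hq hE (sub_one_lt E)
      ((ψ' - ψ : (fiberHamiltonian G c).domain) : Fock)
    have h6 : fiberHamiltonian G c (ψ' - ψ) = ((E - 1 : ℝ) : ℂ) • ((ψ' : Fock) - ψ) := by
      rw [LinearPMap.map_sub, smul_sub]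
      exact sub_eq_sub_iff_sub_eq_sub.1 h3
    have h7 := isFormalAdjoint_fiberHamiltonian G c (ψ' - ψ) η
    rw [h6, inner_smul_left, Complex.conj_ofReal] at h7
    rw [← inner_self_eq_zero (𝕜 := ℂ)]
    nth_rw 2 [← h5]
    rw [inner_sub_right, inner_smul_right, ← h7, Submodule.coe_sub, sub_self]
  obtain rfl : ψ' = ψ := sub_eq_zero.1 (Subtype.ext h4)
  exact ⟨χ, h1, h2⟩

theorem isGroundState_weyl_vacuum (hG : G =ᵐ[volume] fun k => (‖k‖ : ℂ) * v k)
    (hq : G =ᵐ[volume] fun k => (√‖k‖ : ℂ) * q k)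
    (hE : (E : ℂ) = c - ⟪displacement G, displacement v⟫_ℂ) :
    IsGroundState (fiberHamiltonian G c) E (weyl (displacement v) vacuum) := by
  have h1 : weyl (displacement v) vacuum ≠ 0 := by
    rw [← expVec_zero, weyl_expVec]
    intro h
    have h2 := congrArg (fun ψ => ⟪expVec (0 : OneBoson), ψ⟫_ℂ) h
    simp only [inner_smul_right, inner_expVec, inner_zero_left, inner_zero_right, Complex.exp_zero,
      mul_one] at h2
    exact weylFactor_ne_zero _ _ h2
  have h2 : ∃ h : weyl (displacement v) vacuum ∈ (fiberHamiltonian G c).domain,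
      fiberHamiltonian G c ⟨_, h⟩ = (E : ℂ) • weyl (displacement v) vacuum := by
    obtain ⟨h3, h4⟩ := exists_apply_of_mem_graph (weyl_mem_graph hG hq hE vacuum_mem_graph)
    exact ⟨h3, by rw [h4, zero_add, map_smul]⟩
  refine ⟨⟨mem_opSpectrum_of_eigenvector h1 h2, fun r hr => ?_⟩, h1, h2⟩
  by_contra! hlt
  refine notMem_opSpectrum (sub_pos.2 hlt) (fun φ => ?_) (fun ψ => ?_) hr
  · obtain ⟨-, ψ, -, -, h⟩ := exists_fiberHamiltonian_sub_eq hG hq hE hlt φ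
    exact ⟨ψ, h⟩
  · obtain ⟨χ, h3, h4⟩ := exists_weyl_eq hG hq hE ψ
    rw [h4, h3, ← map_smul, ← map_sub, LinearIsometryEquiv.norm_map, LinearIsometryEquiv.norm_map]
    refine (mul_norm_le_norm_freeField_add (E - r) χ).trans (le_of_eq (congrArg norm ?_))
    rw [Complex.ofReal_sub, sub_smul]
    abel

theorem exists_eq_smul_weyl_vacuum (hG : G =ᵐ[volume] fun k => (‖k‖ : ℂ) * v k)
    (hq : G =ᵐ[volume] fun k => (√‖k‖ : ℂ) * q k)
    (hE : (E : ℂ) = c - ⟪displacement G, displacement v⟫_ℂ) {E' : ℝ} {ψ : Fock}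
    (h : IsGroundState (fiberHamiltonian G c) E' ψ) :
    ∃ a : ℂ, ψ = a • weyl (displacement v) vacuum := by
  obtain rfl : E' = E := h.1.unique (isGroundState_weyl_vacuum hG hq hE).1
  obtain ⟨-, -, h1, h2⟩ := h
  obtain ⟨χ, h3, h4⟩ := exists_weyl_eq hG hq hE ⟨ψ, h1⟩
  simp only at h3
  rw [h2, h3, ← map_smul, (weyl (displacement v)).injective.eq_iff, right_eq_add] at h4
  have h5 := freeField.mem_graph χ
  rw [h4] at h5
  obtain ⟨a, ha⟩ := exists_eq_smul_vacuum h5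
  exact ⟨a, by rw [h3, ha, map_smul]⟩

end Fiber

/-! ### The fiber Hamiltonian as an operator on the domain with the graph norm -/

theorem segalFun_add_left (f g : OneBoson) (ψ : sqrtNumberDomain) :
    segalFun (f + g) ψ = segalFun f ψ + segalFun g ψ := by
  rw [segalFun_apply, segalFun_apply, segalFun_apply, annihilation_add_left, creation_add_left,
    ← smul_add]
  congr 1
  abel

theorem segalFun_smul_left (r : ℝ) (f : OneBoson) (ψ : sqrtNumberDomain) :
    segalFun ((r : ℂ) • f) ψ = (r : ℂ) • segalFun f ψ := by
  rw [segalFun_apply, segalFun_apply, annihilation_smul_left, creation_smul_left,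
    Complex.conj_ofReal, ← smul_add, smul_comm]

/-- A vector in the domain of the self-adjoint field operator is tested against `D(√𝒩)`. -/
theorem inner_segal_apply (f : OneBoson) (φ : sqrtNumberDomain) {ψ : Fock}
    (h : ψ ∈ (segal f).domain) : ⟪(φ : Fock), segal f ⟨ψ, h⟩⟫_ℂ = ⟪segalFun f φ, ψ⟫_ℂ := by
  obtain ⟨h1, h2⟩ := exists_apply_of_mem_graph (mem_graph_segal f φ)
  rw [← h2]
  exact (isFormalAdjoint_segal f ⟨_, h1⟩ ⟨ψ, h⟩).symm

theorem eq_of_forall_inner_sqrtNumberDomain {χ χ' : Fock}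
    (h : ∀ φ : sqrtNumberDomain, ⟪(φ : Fock), χ⟫_ℂ = ⟪(φ : Fock), χ'⟫_ℂ) : χ = χ' :=
  isTotal_expVec.eq_of_forall_inner fun g => h (expVecD g)

theorem segal_apply_add {f g : OneBoson} {ψ : Fock} (h : ψ ∈ (segal (f + g)).domain)
    (hf : ψ ∈ (segal f).domain) (hg : ψ ∈ (segal g).domain) :
    segal (f + g) ⟨ψ, h⟩ = segal f ⟨ψ, hf⟩ + segal g ⟨ψ, hg⟩ :=
  eq_of_forall_inner_sqrtNumberDomain fun φ => by
    rw [inner_add_right, inner_segal_apply, inner_segal_apply, inner_segal_apply,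
      segalFun_add_left, inner_add_left]

theorem segal_apply_smul {r : ℝ} {f : OneBoson} {ψ : Fock} (h : ψ ∈ (segal ((r : ℂ) • f)).domain)
    (hf : ψ ∈ (segal f).domain) :
    segal ((r : ℂ) • f) ⟨ψ, h⟩ = (r : ℂ) • segal f ⟨ψ, hf⟩ :=
  eq_of_forall_inner_sqrtNumberDomain fun φ => by
    rw [inner_smul_right, inner_segal_apply, inner_segal_apply, segalFun_smul_left,
      inner_smul_left, Complex.conj_ofReal]

theorem norm_sqrt_div_le (k : Momentum) : ‖((√‖k‖ / (1 + √‖k‖) : ℝ) : ℂ)‖ ≤ 1 := by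
  have := Real.sqrt_nonneg ‖k‖
  rw [Complex.norm_real, Real.norm_of_nonneg (by positivity), div_le_one (by positivity)]
  linarith

theorem norm_inv_sqrt_le (k : Momentum) : ‖(((1 + √‖k‖)⁻¹ : ℝ) : ℂ)‖ ≤ 1 := by
  have := Real.sqrt_nonneg ‖k‖
  rw [Complex.norm_real, Real.norm_of_nonneg (by positivity)]
  exact inv_le_one_of_one_le₀ (by linarith)

/-- Multiplication by `|k|^(1/2) / (1 + |k|^(1/2))`. It maps `(|k|^(1/2) + |k|) v` to `|k| v`, so
that `L²` parametrizes the form factors `g` for which `g` and `|k|^(-1/2) g` are square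
integrable. -/
def formFactor : OneBoson →L[ℂ] OneBoson :=
  mulL (s := fun k : Momentum => ((√‖k‖ / (1 + √‖k‖) : ℝ) : ℂ)) (by fun_prop) norm_sqrt_div_le

/-- Multiplication by `1 / (1 + |k|^(1/2))`. -/
def infraredFactor : OneBoson →L[ℂ] OneBoson :=
  mulL (s := fun k : Momentum => (((1 + √‖k‖)⁻¹ : ℝ) : ℂ)) (by fun_prop) norm_inv_sqrt_le

theorem coeFn_formFactor (u : OneBoson) :
    formFactor u =ᵐ[volume] fun k => ((√‖k‖ / (1 + √‖k‖) : ℝ) : ℂ) * u k := coeFn_mulL _ _ u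

theorem coeFn_infraredFactor (u : OneBoson) :
    infraredFactor u =ᵐ[volume] fun k => (((1 + √‖k‖)⁻¹ : ℝ) : ℂ) * u k := coeFn_mulL _ _ u

theorem formFactor_eq (u : OneBoson) :
    formFactor u =ᵐ[volume] fun k => (√‖k‖ : ℂ) * infraredFactor u k := by
  filter_upwards [coeFn_formFactor u, coeFn_infraredFactor u] with k h1 h2
  rw [h1, h2, div_eq_mul_inv, Complex.ofReal_mul, mul_assoc]

theorem norm_formFactor_le (u : OneBoson) : ‖formFactor u‖ ≤ ‖u‖ :=
  (norm_mulL_le _ _ u).trans_eq (one_mul _)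

theorem norm_infraredFactor_le (u : OneBoson) : ‖infraredFactor u‖ ≤ ‖u‖ :=
  (norm_mulL_le _ _ u).trans_eq (one_mul _)

/-- A linear map on the domain of `A` that is bounded relative to `A`, as a bounded operator for the
graph norm. -/
def graphDomainL {A : Fock →ₗ.[ℂ] Fock} (T : A.domain →ₗ[ℂ] Fock) (C : ℝ)
    (hT : ∀ ψ, ‖T ψ‖ ≤ C * (‖(ψ : Fock)‖ + ‖A ψ‖)) : GraphDomain A →L[ℂ] Fock :=
  LinearMap.mkContinuous (E := GraphDomain A) T C fun ψ =>
    (hT ψ).trans_eq (congrArg (C * ·) (GraphDomain.norm_of A ψ).symm)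

theorem norm_graphDomainL_le {A : Fock →ₗ.[ℂ] Fock} (T : A.domain →ₗ[ℂ] Fock) {C : ℝ} (hC : 0 ≤ C)
    (hT : ∀ ψ, ‖T ψ‖ ≤ C * (‖(ψ : Fock)‖ + ‖A ψ‖)) : ‖graphDomainL T C hT‖ ≤ C :=
  LinearMap.mkContinuous_norm_le (E := GraphDomain A) T hC _

/-- The field operator of the form factor `formFactor u`, on the domain of the free field. -/
def fieldOnDomain (u : OneBoson) : GraphDomain freeField →L[ℂ] Fock :=
  graphDomainL
    { toFun := fun ψ => segal (formFactor u) ⟨ψ, (exists_segal_apply (formFactor_eq u) ψ).1⟩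
      map_add' := fun ψ φ => LinearPMap.map_add _ ⟨_, _⟩ ⟨_, _⟩
      map_smul' := fun z ψ => LinearPMap.map_smul _ z ⟨_, _⟩ }
    (3 * ‖u‖) fun ψ => by
      have h3 := sqrt_mul_le_add (norm_nonneg (ψ : Fock)) (norm_nonneg (freeField ψ))
      have h4 := norm_formFactor_le u
      have h5 := norm_infraredFactor_le u
      have h6 := norm_nonneg (freeField ψ)
      refine (exists_segal_apply (formFactor_eq u) ψ).2.trans ?_
      calc _ ≤ 2 * ‖u‖ * (‖(ψ : Fock)‖ + ‖freeField ψ‖) +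
            ‖u‖ * (‖(ψ : Fock)‖ + ‖freeField ψ‖) := by
            gcongr
            linarith
        _ = _ := by ring

theorem fieldOnDomain_of (u : OneBoson) (ψ : freeField.domain)
    (h : (ψ : Fock) ∈ (segal (formFactor u)).domain) :
    fieldOnDomain u (GraphDomain.of freeField ψ) = segal (formFactor u) ⟨ψ, h⟩ := rfl

theorem norm_fieldOnDomain_le (u : OneBoson) : ‖fieldOnDomain u‖ ≤ 3 * ‖u‖ :=
  norm_graphDomainL_le _ (by positivity) _

theorem fieldOnDomain_add (u u' : OneBoson) :
    fieldOnDomain (u + u') = fieldOnDomain u + fieldOnDomain u' := by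
  have key : ∀ ψ : freeField.domain, fieldOnDomain (u + u') (GraphDomain.of freeField ψ) =
      fieldOnDomain u (GraphDomain.of freeField ψ) +
        fieldOnDomain u' (GraphDomain.of freeField ψ) := by
    intro ψ
    have h := (exists_segal_apply (formFactor_eq (u + u')) ψ).1
    rw [fieldOnDomain_of _ _ h,
      fieldOnDomain_of _ _ (exists_segal_apply (formFactor_eq u) ψ).1,
      fieldOnDomain_of _ _ (exists_segal_apply (formFactor_eq u') ψ).1]
    generalize hw : formFactor (u + u') = w at h ⊢
    obtain rfl : formFactor u + formFactor u' = w := by rw [← hw, map_add]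
    exact segal_apply_add _ _ _
  exact ContinuousLinearMap.ext key

theorem fieldOnDomain_smul (r : ℝ) (u : OneBoson) :
    fieldOnDomain ((r : ℂ) • u) = (r : ℂ) • fieldOnDomain u := by
  have key : ∀ ψ : freeField.domain,
      fieldOnDomain ((r : ℂ) • u) (GraphDomain.of freeField ψ) =
        (r : ℂ) • fieldOnDomain u (GraphDomain.of freeField ψ) := by
    intro ψ
    have h := (exists_segal_apply (formFactor_eq ((r : ℂ) • u)) ψ).1
    rw [fieldOnDomain_of _ _ h, fieldOnDomain_of _ _ (exists_segal_apply (formFactor_eq u) ψ).1]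
    generalize hw : formFactor ((r : ℂ) • u) = w at h ⊢
    obtain rfl : (r : ℂ) • formFactor u = w := by rw [← hw, map_smul]
    exact segal_apply_smul _ _
  exact ContinuousLinearMap.ext key

/-- The map `fieldOnDomain` is only real-linear, as the annihilation operator is antilinear in the
form factor. -/
def fieldL : OneBoson →L[ℝ] (GraphDomain freeField →L[ℂ] Fock) :=
  LinearMap.mkContinuous
    { toFun := fieldOnDomain
      map_add' := fieldOnDomain_add
      map_smul' := fieldOnDomain_smul }
    3 norm_fieldOnDomain_le

/-- The free field as a bounded operator on its domain with the graph norm. -/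
def freeFieldL : GraphDomain freeField →L[ℂ] Fock :=
  graphDomainL freeField.toFun 1 fun ψ => by
    rw [one_mul]
    exact le_add_of_nonneg_left (norm_nonneg _)

/-- The inclusion of the domain of the free field, with the graph norm, into the Fock space. -/
def domainInclusion : GraphDomain freeField →L[ℂ] Fock :=
  graphDomainL freeField.domain.subtype 1 fun ψ => by
    rw [one_mul]
    exact le_add_of_nonneg_right (norm_nonneg _)

/-- The fiber Hamiltonian with form factor `formFactor u` as a bounded operator on the domain of
the free field. -/
def fiberL (u : OneBoson) (c : ℝ) : GraphDomain freeField →L[ℂ] Fock :=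
  freeFieldL + fieldL u + c • domainInclusion

theorem fiberL_of {G u : OneBoson} (hG : G = formFactor u) {c : ℝ} (ψ : freeField.domain)
    (h : (ψ : Fock) ∈ (fiberHamiltonian G c).domain) :
    fiberL u c (GraphDomain.of freeField ψ) = fiberHamiltonian G c ⟨ψ, h⟩ := by
  subst hG
  rw [fiberHamiltonian_apply, add_comm]
  rfl

/-! ### Maps with bounded derivatives -/

section Bounded

variable {X Y Z : Type*} [NormedAddCommGroup X] [NormedSpace ℝ X] [NormedAddCommGroup Y]
  [NormedSpace ℝ Y] [NormedAddCommGroup Z] [NormedSpace ℝ Z] {n : ℕ}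

theorem IsCnb.add {f g : X → Y} (hf : IsCnb n f) (hg : IsCnb n g) :
    IsCnb n fun x => f x + g x := by
  refine ⟨hf.1.add hg.1, fun m hm => ?_⟩
  obtain ⟨C, hC⟩ := hf.2 m hm
  obtain ⟨D, hD⟩ := hg.2 m hm
  have hm' : (m : WithTop ℕ∞) ≤ n := by exact_mod_cast hm
  refine ⟨C + D, fun x => ?_⟩
  rw [fun_iteratedFDeriv_add_apply (hf.1.of_le hm').contDiffAt (hg.1.of_le hm').contDiffAt]
  exact (norm_add_le _ _).trans (add_le_add (hC x) (hD x))

theorem IsCnb.clm_comp {f : X → Y} (hf : IsCnb n f) (L : Y →L[ℝ] Z) : IsCnb n fun x => L (f x) := by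
  refine ⟨L.contDiff.comp hf.1, fun m hm => ?_⟩
  obtain ⟨C, hC⟩ := hf.2 m hm
  exact ⟨‖L‖ * C, fun x => (L.norm_iteratedFDeriv_comp_left hf.1.contDiffAt
    (by exact_mod_cast hm)).trans (mul_le_mul_of_nonneg_left (hC x) (norm_nonneg _))⟩

theorem isCnb_const (y : Y) : IsCnb n fun _ : X => y := by
  refine ⟨contDiff_const, fun m _ => ?_⟩
  cases m with
  | zero => exact ⟨‖y‖, fun x => by rw [norm_iteratedFDeriv_zero]⟩
  | succ m => exact ⟨0, fun x => by rw [iteratedFDeriv_succ_const]; simp⟩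

theorem norm_iteratedFDeriv_sub_const {f : X → Y} (hf : ContDiff ℝ n f) (y : Y) {m : ℕ}
    (hm : 1 ≤ m) (hmn : m ≤ n) (x : X) :
    ‖iteratedFDeriv ℝ m (fun x => f x - y) x‖ = ‖iteratedFDeriv ℝ m f x‖ := by
  have hm' : (m : WithTop ℕ∞) ≤ n := by exact_mod_cast hmn
  rw [fun_iteratedFDeriv_sub_apply (hf.of_le hm').contDiffAt contDiffAt_const,
    iteratedFDeriv_const_of_ne (by omega), Pi.zero_apply, sub_zero]

/-- A derivative of a bilinear expression in two maps with bounded derivatives is bounded, with a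
bound in terms of the bounds of the two maps at the same point. -/
theorem exists_norm_iteratedFDeriv_bilinear_le {W : Type*} [NormedAddCommGroup W] [NormedSpace ℝ W]
    (B : Y →L[ℝ] Z →L[ℝ] W) : ∃ M : ℝ, 0 ≤ M ∧ ∀ (f : X → Y) (g : X → Z) (m : ℕ) (K : ℝ) (x : X),
      ContDiff ℝ m f → ContDiff ℝ m g → (∀ i ≤ m, ‖iteratedFDeriv ℝ i f x‖ ≤ K) →
      (∀ i ≤ m, ‖iteratedFDeriv ℝ i g x‖ ≤ K) →
      ‖iteratedFDeriv ℝ m (fun y => B (f y) (g y)) x‖ ≤ M * (2 ^ m * K ^ 2) := by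
  refine ⟨‖B‖, norm_nonneg B, fun f g m K x hf hg hfK hgK => ?_⟩
  have hK : 0 ≤ K := (norm_nonneg _).trans (hfK 0 (Nat.zero_le _))
  refine (B.norm_iteratedFDeriv_le_of_bilinear hf hg x le_rfl).trans ?_
  have h2 : ((2 : ℝ) ^ m) = ∑ i ∈ Finset.range (m + 1), (m.choose i : ℝ) := by
    exact_mod_cast (Nat.sum_range_choose m).symm
  rw [h2, Finset.sum_mul]
  refine mul_le_mul_of_nonneg_left (Finset.sum_le_sum fun i hi => ?_) (norm_nonneg B)
  rw [mul_assoc, sq]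
  gcongr
  · exact hfK i (Finset.mem_range_succ_iff.1 hi)
  · exact hgK (m - i) (Nat.sub_le _ _)

end Bounded

section Fiber

variable {X : Type*} [NormedAddCommGroup X] [NormedSpace ℝ X] {n : ℕ} {u : X → OneBoson}
  {V : X → ℝ}

/-- The map that takes `c` to the multiplication by `c`, restricted to the domain of the free
field. -/
def constL : ℝ →L[ℝ] (GraphDomain freeField →L[ℂ] Fock) :=
  (ContinuousLinearMap.id ℝ ℝ).smulRight domainInclusion

theorem contDiff_fiberL (hu : ContDiff ℝ n u) (hV : ContDiff ℝ n V) :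
    ContDiff ℝ n fun x => fiberL (u x) (V x) :=
  (contDiff_const.add (fieldL.contDiff.comp hu)).add (constL.contDiff.comp hV)

theorem isCnb_fiberL (hu : IsCnb n u) (hV : IsCnb n V) : IsCnb n fun x => fiberL (u x) (V x) :=
  ((isCnb_const freeFieldL).add (hu.clm_comp fieldL)).add (hV.clm_comp constL)

end Fiber

/-! ### The ground state as a function of the configuration -/

/-- The real bilinear form `(f, g) ↦ Im ⟪f, g⟫`. -/
def imInner : OneBoson →L[ℝ] OneBoson →L[ℝ] ℝ :=
  LinearMap.mkContinuous₂
    (LinearMap.mk₂ ℝ (fun f g : OneBoson => (⟪f, g⟫_ℂ).im)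
      (fun f f' g => by rw [inner_add_left, Complex.add_im])
      (fun r f g => by
        change (⟪(r : ℂ) • f, g⟫_ℂ).im = _
        rw [inner_smul_left, Complex.conj_ofReal, Complex.im_ofReal_mul, smul_eq_mul])
      (fun f g g' => by rw [inner_add_right, Complex.add_im])
      (fun r f g => by
        change (⟪f, (r : ℂ) • g⟫_ℂ).im = _
        rw [inner_smul_right, Complex.im_ofReal_mul, smul_eq_mul]))
    1 fun f g => by
      rw [one_mul]
      exact (Complex.abs_im_le_norm _).trans (norm_inner_le_norm f g)

theorem imInner_apply (f g : OneBoson) : imInner f g = (⟪f, g⟫_ℂ).im := rfl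

/-- The function `(t, g) ↦ e^{it} W(g) Ω₀`, where `W` denotes the Weyl operators. -/
def phasedCoherent (p : ℝ × OneBoson) : Fock :=
  Complex.exp (p.1 * Complex.I) • weyl p.2 vacuum

theorem weyl_vacuum (g : OneBoson) :
    weyl g vacuum = Complex.exp (-(((‖g‖ ^ 2 : ℝ) : ℂ) / 2)) • expVec g := by
  rw [← expVec_zero, weyl_expVec, zero_add, weylFactor, inner_zero_right, sub_zero,
    inner_self_eq_norm_sq_to_K]
  push_cast
  rfl

theorem contDiff_phasedCoherent {k : WithTop ℕ∞} : ContDiff ℝ k phasedCoherent := by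
  have h0 : ContDiff ℂ k expVec := contDiff_expVec
  have h1 : ContDiff ℝ k expVec := h0.restrict_scalars ℝ
  have h2 : ContDiff ℝ k fun g : OneBoson => ‖g‖ ^ 2 := contDiff_norm_sq ℂ
  have h3 : ContDiff ℝ k (fun r : ℝ => (r : ℂ)) := Complex.ofRealCLM.contDiff
  unfold phasedCoherent
  simp only [weyl_vacuum]
  have hfst : ContDiff ℝ k (Prod.fst : ℝ × OneBoson → ℝ) := contDiff_fst
  have hsnd : ContDiff ℝ k (Prod.snd : ℝ × OneBoson → OneBoson) := contDiff_snd
  have h4 : ContDiff ℝ k fun _ : ℝ × OneBoson => Complex.I := contDiff_const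
  have h5 : ContDiff ℝ k fun p : ℝ × OneBoson => Complex.exp (p.1 * Complex.I) :=
    ((h3.comp hfst).mul h4).cexp
  have h6 : ContDiff ℝ k fun p : ℝ × OneBoson =>
      Complex.exp (-(((‖p.2‖ ^ 2 : ℝ) : ℂ) / 2)) := ((h3.comp (h2.comp hsnd)).div_const 2).neg.cexp
  exact h5.smul (h6.smul (h1.comp hsnd))

/-- The Weyl relation, applied to the vacuum. -/
theorem weyl_weyl_vacuum (f g : OneBoson) :
    weyl f (phasedCoherent (imInner f (g - f), g - f)) = weyl g vacuum := by
  obtain ⟨d, rfl⟩ : ∃ d, g = f + d := ⟨g - f, by abel⟩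
  rw [phasedCoherent, weyl_vacuum, weyl_vacuum, map_smul, map_smul, weyl_expVec, smul_smul,
    smul_smul, weylFactor, ← Complex.exp_add, ← Complex.exp_add]
  simp only [add_sub_cancel_left]
  rw [add_comm d f]
  congr 2
  have h1 : (((‖f + d‖ ^ 2 : ℝ) : ℂ)) = ⟪f + d, f + d⟫_ℂ := by
    rw [inner_self_eq_norm_sq_to_K]
    push_cast
    rfl
  have h2 : (((‖d‖ ^ 2 : ℝ) : ℂ)) = ⟪d, d⟫_ℂ := by
    rw [inner_self_eq_norm_sq_to_K]
    push_cast
    rfl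
  have h3 : (⟪d, f⟫_ℂ).re = (⟪f, d⟫_ℂ).re := inner_re_symm (𝕜 := ℂ) d f
  have h4 : (⟪d, f⟫_ℂ).im = -(⟪f, d⟫_ℂ).im := inner_im_symm (𝕜 := ℂ) d f
  rw [h1, h2, imInner_apply, inner_add_left, inner_add_right, inner_add_right]
  apply Complex.ext <;> simp <;> linarith

section Curve

variable {X : Type*} [NormedAddCommGroup X] [NormedSpace ℝ X] {n : ℕ}

/-- The Berry connection form `Im ⟪h, ∇h⟫` vanishes, so the derivative of the phase that relates
`W(h(x)) Ω₀` to `W(h(a)) Ω₀` is small for `x` near `a`, however large `h(a)` is. -/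
theorem fderiv_phase {h : X → OneBoson} (hd : Differentiable ℝ h)
    (him : ∀ x y, imInner (h x) (fderiv ℝ h x y) = 0) (a x : X) :
    fderiv ℝ (fun x => imInner (h a) (h x - h a)) x =
      (-(ContinuousLinearMap.compL ℝ X OneBoson ℝ).comp imInner) (h x - h a) (fderiv ℝ h x) := by
  have h1 : HasFDerivAt (fun x => imInner (h a) (h x - h a))
      ((imInner (h a)).comp (fderiv ℝ h x)) x :=
    (imInner (h a)).hasFDerivAt.comp x ((hd x).hasFDerivAt.sub_const (h a))
  rw [h1.fderiv]
  ext y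
  have h2 := him x y
  have h3 : imInner (h x - h a) (fderiv ℝ h x y) =
      imInner (h x) (fderiv ℝ h x y) - imInner (h a) (fderiv ℝ h x y) := by
    rw [map_sub, sub_apply]
  change imInner (h a) (fderiv ℝ h x y) = -imInner (h x - h a) (fderiv ℝ h x y)
  rw [h3, h2, zero_sub, neg_neg]

/-- If the derivatives of `h` of order `1, …, n` are bounded and `Im ⟪h, ∇h⟫ = 0`, then the coherent
states `W(h(x)) Ω₀` have bounded derivatives, even if `h` is unbounded. -/
theorem isCnb_weyl_vacuum {h : X → OneBoson} (hs : ContDiff ℝ n h)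
    (hb : ∀ m : ℕ, 1 ≤ m → m ≤ n → ∃ C : ℝ, ∀ x, ‖iteratedFDeriv ℝ m h x‖ ≤ C)
    (him : ∀ x y, imInner (h x) (fderiv ℝ h x y) = 0) :
    IsCnb n fun x => weyl (h x) vacuum := by
  -- the phase and the displacement relative to the point `a`
  let p : X → X → ℝ × OneBoson := fun a x => (imInner (h a) (h x - h a), h x - h a)
  have hp2 : ∀ a, ContDiff ℝ n fun x => h x - h a := fun a => hs.sub contDiff_const
  have hp1 : ∀ a, ContDiff ℝ n fun x => imInner (h a) (h x - h a) := fun a =>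
    (imInner (h a)).contDiff.comp (hp2 a)
  have hp : ∀ a, ContDiff ℝ n (p a) := fun a => (hp1 a).prodMk (hp2 a)
  let U : X → Fock →ₗᵢ[ℝ] Fock := fun a =>
    { toLinearMap := (weyl (h a)).toLinearEquiv.toLinearMap.restrictScalars ℝ
      norm_map' := (weyl (h a)).norm_map }
  have key : ∀ a, (fun x => weyl (h x) vacuum) = U a ∘ phasedCoherent ∘ p a := fun a =>
    funext fun x => (weyl_weyl_vacuum (h a) (h x)).symm
  have hF : ∀ a, ContDiff ℝ n (phasedCoherent ∘ p a) := fun a => contDiff_phasedCoherent.comp (hp a)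
  have hpa : ∀ a, p a a = 0 := fun a => by
    simp only [p, sub_self, map_zero]
    rfl
  refine ⟨?_, fun m hm => ?_⟩
  · rw [key 0]
    exact (U 0).contDiff.comp (hF 0)
  have hmn : (m : WithTop ℕ∞) ≤ n := by exact_mod_cast hm
  -- one bound for all derivatives of `h`
  obtain ⟨K, hK1, hK⟩ : ∃ K : ℝ, 1 ≤ K ∧
      ∀ i : ℕ, 1 ≤ i → i ≤ n → ∀ x, ‖iteratedFDeriv ℝ i h x‖ ≤ K := by
    have h1 : ∀ i : ℕ, ∃ C : ℝ, 1 ≤ i → i ≤ n → ∀ x, ‖iteratedFDeriv ℝ i h x‖ ≤ C := by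
      intro i
      by_cases hi : 1 ≤ i ∧ i ≤ n
      · obtain ⟨C, hC⟩ := hb i hi.1 hi.2
        exact ⟨C, fun _ _ => hC⟩
      · exact ⟨0, fun h1 h2 => absurd ⟨h1, h2⟩ hi⟩
    choose C hC using h1
    refine ⟨1 + ∑ i ∈ Finset.range (n + 1), |C i|, ?_, fun i hi hin x => ?_⟩
    · exact le_add_of_nonneg_right (Finset.sum_nonneg fun i _ => abs_nonneg _)
    · have h2 := Finset.single_le_sum (f := fun i => |C i|) (fun i _ => abs_nonneg _)
        (Finset.mem_range_succ_iff.2 hin)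
      linarith [hC i hi hin x, le_abs_self (C i)]
  obtain ⟨M, hM, hB⟩ := exists_norm_iteratedFDeriv_bilinear_le (X := X)
    (-(ContinuousLinearMap.compL ℝ X OneBoson ℝ).comp imInner)
  have hd : Differentiable ℝ h ∨ m = 0 := by
    rcases Nat.eq_zero_or_pos m with h0 | h0
    · exact Or.inr h0
    · refine Or.inl (hs.differentiable ?_)
      exact_mod_cast (by omega : n ≠ 0)
  rcases hd with hd | rfl
  swap
  · exact ⟨‖vacuum‖, fun x => by rw [norm_iteratedFDeriv_zero, LinearIsometryEquiv.norm_map]⟩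
  have hθ : ∀ (a : X) (i : ℕ), 1 ≤ i → i ≤ n →
      ‖iteratedFDeriv ℝ i (fun x => imInner (h a) (h x - h a)) a‖ ≤ M * (2 ^ n * K ^ 2) := by
    intro a i hi hin
    obtain ⟨j, rfl⟩ : ∃ j, i = j + 1 := ⟨i - 1, by omega⟩
    rw [← norm_iteratedFDeriv_fderiv, funext (fderiv_phase hd him a)]
    have hjn : j ≤ n := by omega
    refine (hB _ _ j K a ((hp2 a).of_le (by exact_mod_cast hjn))
      (hs.fderiv_right (by exact_mod_cast hin)) (fun l hl => ?_) (fun l hl => ?_)).trans ?_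
    · rcases Nat.eq_zero_or_pos l with rfl | h0
      · rw [norm_iteratedFDeriv_zero, sub_self, norm_zero]
        linarith
      · rw [norm_iteratedFDeriv_sub_const hs _ h0 (by omega)]
        exact hK l h0 (by omega) a
    · rw [norm_iteratedFDeriv_fderiv]
      exact hK (l + 1) (by omega) (by omega) a
    · gcongr
      exact one_le_two
  set D := max K (M * (2 ^ n * K ^ 2)) with hD
  have hD1 : 1 ≤ D := hK1.trans (le_max_left _ _)
  refine ⟨m.factorial * (∑ i ∈ Finset.range (m + 1), ‖iteratedFDeriv ℝ i phasedCoherent 0‖) * D ^ m,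
    fun a => ?_⟩
  rw [key a, (U a).norm_iteratedFDeriv_comp_left (hF a).contDiffAt hmn]
  refine norm_iteratedFDeriv_comp_le (N := n) contDiff_phasedCoherent (hp a) hmn a
    (fun i hi => ?_) (fun i hi him => ?_)
  · rw [hpa a]
    exact Finset.single_le_sum (f := fun i => ‖iteratedFDeriv ℝ i phasedCoherent 0‖)
      (fun i _ => norm_nonneg (iteratedFDeriv ℝ i phasedCoherent 0))
      (Finset.mem_range_succ_iff.2 hi)
  · have hin : i ≤ n := him.trans hm
    rw [iteratedFDeriv_prodMk (hp1 a).contDiffAt (hp2 a).contDiffAt (by exact_mod_cast hin),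
      ContinuousMultilinearMap.opNorm_prod, norm_iteratedFDeriv_sub_const hs _ hi hin]
    refine le_trans ?_ (le_self_pow₀ hD1 (by omega))
    exact max_le ((hθ a i hi hin).trans (le_max_right _ _))
      ((hK i hi hin a).trans (le_max_left _ _))

end Curve

/-! ### The weights `|k|^s` -/

section Weights

variable {X : Type*} {v : X → Momentum → ℂ}

theorem toL2_one_eq (hv : ∀ x, MemLp (v x) 2 volume)
    (hv_one : ∀ x, MemLp (weight 1 (v x)) 2 volume) (x : X) :
    toL2 hv_one x =ᵐ[volume] fun k => (‖k‖ : ℂ) * toL2 hv x k := by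
  filter_upwards [(hv x).coeFn_toLp, (hv_one x).coeFn_toLp] with k h1 h2
  rw [toL2, toL2, h1, h2, weight, Real.rpow_one]

theorem toL2_one_eq_sqrt (hv_half : ∀ x, MemLp (weight (1 / 2) (v x)) 2 volume)
    (hv_one : ∀ x, MemLp (weight 1 (v x)) 2 volume) (x : X) :
    toL2 hv_one x =ᵐ[volume] fun k => (√‖k‖ : ℂ) * toL2 hv_half x k := by
  filter_upwards [(hv_half x).coeFn_toLp, (hv_one x).coeFn_toLp] with k h1 h2
  rw [toL2, toL2, h1, h2, weight, weight, Real.rpow_one, ← Real.sqrt_eq_rpow, ← mul_assoc,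
    ← Complex.ofReal_mul, Real.mul_self_sqrt (norm_nonneg k)]

theorem toL2_one_eq_formFactor (hv_half : ∀ x, MemLp (weight (1 / 2) (v x)) 2 volume)
    (hv_one : ∀ x, MemLp (weight 1 (v x)) 2 volume) (x : X) :
    toL2 hv_one x = formFactor (toL2 hv_one x + toL2 hv_half x) := by
  refine Lp.ext ?_
  filter_upwards [toL2_one_eq_sqrt hv_half hv_one x,
    coeFn_formFactor (toL2 hv_one x + toL2 hv_half x),
    Lp.coeFn_add (toL2 hv_one x) (toL2 hv_half x)] with k h1 h2 h3
  rw [h2, h3, Pi.add_apply, h1]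
  have h4 : (1 + √‖k‖ : ℂ) ≠ 0 := by
    have : (1 + √‖k‖ : ℝ) ≠ 0 := by positivity
    exact_mod_cast this
  push_cast
  field_simp
  ring

/-- The ground state energy is `c - ⟪|k| h, h⟫` for the displacement `h`. -/
theorem energy_eq (hv : ∀ x, MemLp (v x) 2 volume)
    (hv_one : ∀ x, MemLp (weight 1 (v x)) 2 volume) (x : X) (c : ℝ) :
    ((-(1 / 2) * (∫ k, ‖k‖ * ‖v x k‖ ^ 2) + c : ℝ) : ℂ) =
      c - ⟪displacement (toL2 hv_one x), displacement (toL2 hv x)⟫_ℂ := by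
  have h1 := toL2_one_eq hv hv_one x
  have h2 : ⟪toL2 hv_one x, toL2 hv x⟫_ℂ = ⟪toL2 hv x, toL2 hv_one x⟫_ℂ := inner_mul_left h1 h1
  have h3 : (⟪toL2 hv x, toL2 hv_one x⟫_ℂ).im = 0 := by
    have h4 : (⟪toL2 hv_one x, toL2 hv x⟫_ℂ).im = -(⟪toL2 hv x, toL2 hv_one x⟫_ℂ).im :=
      inner_im_symm (𝕜 := ℂ) _ _
    rw [h2] at h4
    linarith
  have h5 : (⟪toL2 hv x, toL2 hv_one x⟫_ℂ).re = ∫ k, ‖k‖ * ‖v x k‖ ^ 2 := by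
    rw [(inner_mul_self h1).2]
    refine integral_congr_ae ?_
    filter_upwards [(hv x).coeFn_toLp] with k h6
    rw [toL2, h6]
  have h6 : ⟪toL2 hv x, toL2 hv_one x⟫_ℂ = ((∫ k, ‖k‖ * ‖v x k‖ ^ 2 : ℝ) : ℂ) :=
    Complex.ext (by rw [h5, Complex.ofReal_re]) (by rw [h3, Complex.ofReal_im])
  have h7 : ((√2 : ℝ) : ℂ)⁻¹ * ((√2 : ℝ) : ℂ)⁻¹ = 1 / 2 := by
    rw [← mul_inv, ← Complex.ofReal_mul, Real.mul_self_sqrt zero_le_two]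
    norm_num
  rw [displacement, displacement, inner_smul_left, inner_smul_right, h2, h6, map_neg, map_inv₀,
    Complex.conj_ofReal, ← mul_assoc, neg_mul_neg, h7]
  push_cast
  ring

end Weights

/-- The displacement as a real-linear map. -/
def displacementL : OneBoson →L[ℝ] OneBoson :=
  (((-((√2 : ℝ) : ℂ)⁻¹) • ContinuousLinearMap.id ℂ OneBoson) :
    OneBoson →L[ℂ] OneBoson).restrictScalars ℝ

theorem isCnb_weyl_displacement {X : Type*} [NormedAddCommGroup X] [NormedSpace ℝ X] {n : ℕ}
    (hn : 1 ≤ n) {u : X → OneBoson} (hs : ContDiff ℝ n u)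
    (hb : ∀ m : ℕ, 1 ≤ m → m ≤ n → ∃ C : ℝ, ∀ x, ‖iteratedFDeriv ℝ m u x‖ ≤ C)
    (him : ∀ x y, (⟪u x, fderiv ℝ u x y⟫_ℂ).im = 0) :
    IsCnb n fun x => weyl (displacement (u x)) vacuum := by
  have hd : Differentiable ℝ u := hs.differentiable (by exact_mod_cast (by omega : n ≠ 0))
  refine isCnb_weyl_vacuum (h := fun x => displacementL (u x)) (displacementL.contDiff.comp hs)
    (fun m hm hmn => ?_) fun x y => ?_
  · obtain ⟨C, hC⟩ := hb m hm hmn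
    exact ⟨‖displacementL‖ * C, fun x =>
      (displacementL.norm_iteratedFDeriv_comp_left hs.contDiffAt (by exact_mod_cast hmn)).trans
        (mul_le_mul_of_nonneg_left (hC x) (norm_nonneg _))⟩
  · have h1 : HasFDerivAt (fun x => displacementL (u x)) (displacementL.comp (fderiv ℝ u x)) x :=
      displacementL.hasFDerivAt.comp x (hd x).hasFDerivAt
    rw [h1.fderiv, imInner_apply]
    change (⟪(-((√2 : ℝ) : ℂ)⁻¹) • u x, (-((√2 : ℝ) : ℂ)⁻¹) • fderiv ℝ u x y⟫_ℂ).im = 0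
    rw [inner_smul_left, inner_smul_right, map_neg, map_inv₀, Complex.conj_ofReal, ← mul_assoc,
      neg_mul_neg, ← Complex.ofReal_inv, ← Complex.ofReal_mul, Complex.im_ofReal_mul, him, mul_zero]

end

end Nelson

theorem proposition3 (N n : ℕ) (hn : 1 ≤ n)
    (v : Nelson.Config N → Nelson.Momentum → ℂ) (V : Nelson.Config N → ℝ)
    (hv : ∀ x, MemLp (v x) 2 volume)
    (hv_half : ∀ x, MemLp (Nelson.weight (1 / 2) (v x)) 2 volume)
    (hv_one : ∀ x, MemLp (Nelson.weight 1 (v x)) 2 volume)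
    (hv_smooth : ContDiff ℝ n (Nelson.toL2 hv))
    (hv_one_smooth : ContDiff ℝ n (Nelson.toL2 hv_one))
    (hv_half_Cnb : Nelson.IsCnb n (Nelson.toL2 hv_half))
    (hv_bdd : ∀ m : ℕ, 1 ≤ m → m ≤ n →
      ∃ C : ℝ, ∀ x, ‖iteratedFDeriv ℝ m (Nelson.toL2 hv) x‖ ≤ C)
    (hIm : ∀ x y : Nelson.Config N,
      (inner ℂ (Nelson.toL2 hv x) (fderiv ℝ (Nelson.toL2 hv) x y)).im = 0)
    (hV : Nelson.IsCnb n V) :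
    -- `H₀(x) = H_f + Φ(|k| v(x,·)) + V_IR(x)` is self-adjoint on `D(H_f)`
    (∀ x, (Nelson.fiberHamiltonian (Nelson.toL2 hv_one x) (V x)).domain = Nelson.freeField.domain ∧
      IsSelfAdjoint (Nelson.fiberHamiltonian (Nelson.toL2 hv_one x) (V x))) ∧
    -- `H₀` is `C^n` into `L(D(H_f), F)`, with bounded derivatives if those of `|k| v` are bounded
    (∃ T : Nelson.Config N → (Nelson.GraphDomain Nelson.freeField →L[ℂ] Nelson.Fock),
      (∀ (x : Nelson.Config N) (ψ : Nelson.freeField.domain)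
        (h : (ψ : Nelson.Fock) ∈ (Nelson.fiberHamiltonian (Nelson.toL2 hv_one x) (V x)).domain),
        T x (Nelson.GraphDomain.of Nelson.freeField ψ) =
          Nelson.fiberHamiltonian (Nelson.toL2 hv_one x) (V x) ⟨ψ, h⟩) ∧
      ContDiff ℝ n T ∧
      ((∀ m : ℕ, m ≤ n → ∃ C : ℝ, ∀ x, ‖iteratedFDeriv ℝ m (Nelson.toL2 hv_one) x‖ ≤ C) →
        Nelson.IsCnb n T)) ∧
    -- the ground state `Ω(x) = U(x) Ω₀` with `U(x) = exp(i Φ(i v(x,·)))`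
    (∃ U : Nelson.Config N → (Nelson.Fock ≃ₗᵢ[ℂ] Nelson.Fock),
      (∀ x, Nelson.IsExpI (Nelson.segal (Complex.I • Nelson.toL2 hv x)) (U x)) ∧
      (∀ x,
        Nelson.IsGroundState (Nelson.fiberHamiltonian (Nelson.toL2 hv_one x) (V x))
          (-(1 / 2) * (∫ k, ‖k‖ * ‖v x k‖ ^ 2) + V x) (U x Nelson.vacuum) ∧
        ∀ (E : ℝ) (ψ : Nelson.Fock),
          Nelson.IsGroundState (Nelson.fiberHamiltonian (Nelson.toL2 hv_one x) (V x)) E ψ →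
          ∃ c : ℂ, ψ = c • U x Nelson.vacuum) ∧
      Nelson.IsCnb n (fun x => U x Nelson.vacuum)) := by
  have hG := Nelson.toL2_one_eq hv hv_one
  have hq := Nelson.toL2_one_eq_sqrt hv_half hv_one
  have hE := fun x => Nelson.energy_eq hv hv_one x (V x)
  refine ⟨fun x => ⟨Nelson.domain_fiberHamiltonian (hq x) (V x),
    Nelson.isSelfAdjoint_fiberHamiltonian (hG x) (hq x) (hE x)⟩,
    ⟨fun x => Nelson.fiberL (Nelson.toL2 hv_one x + Nelson.toL2 hv_half x) (V x),
      fun x ψ h => Nelson.fiberL_of (Nelson.toL2_one_eq_formFactor hv_half hv_one x) ψ h,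
      Nelson.contDiff_fiberL (hv_one_smooth.add hv_half_Cnb.1) hV.1,
      fun hb => Nelson.isCnb_fiberL (Nelson.IsCnb.add ⟨hv_one_smooth, hb⟩ hv_half_Cnb) hV⟩,
    ⟨fun x => Nelson.weyl (Nelson.displacement (Nelson.toL2 hv x)),
      fun x => Nelson.isExpI_weyl _,
      fun x => ⟨Nelson.isGroundState_weyl_vacuum (hG x) (hq x) (hE x),
        fun _ _ h => Nelson.exists_eq_smul_weyl_vacuum (hG x) (hq x) (hE x) h⟩,
      Nelson.isCnb_weyl_displacement hn hv_smooth hv_bdd hIm⟩⟩
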